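/- Let $M$ be a hyperbolic once-punctured torus bundle. Its monodromy is an automorphism $\varphi$ of the free group $F_2=\langle a,b\rangle=\pi_1(\text{fiber})$ induced by an orientation-preserving homeomorphism of the once-punctured torus (so $\varphi$ preserves the conjugacy class of the boundary loop $aba^{-1}b^{-1}$), whose action on $H_1=\mathbb{Z}^2$ is a matrix in $\mathrm{SL}(2,\mathbb{Z})$ with $|\mathrm{tr}|>2$. The fundamental group of $M$ is $\Gamma=\langle a,b,x\mid xax^{-1}=\varphi(a),\ xbx^{-1}=\varphi(b)\rangle=F_2\rtimes\langle x\rangle$. Let $\rho:\Gamma\to\mathrm{PSO}(3,1)\subset\mathrm{PGL}(4,\mathbb{R})$ be the holonomy of the complete hyperbolic structure, that is, a discrete and faithful representation. Give $\mathrm{Hom}(F_2,\mathrm{PGL}(4,\mathbb{R}))$ the smooth structure of $\mathrm{PGL}(4,\mathbb{R})^2$ (values at $a,b$), and let $\chi=\chi(F_2,\mathrm{PGL}(4,\mathbb{R}))$ be its quotient by conjugation, with the quotient topology and projection $\pi$. A smooth chart of $\chi$ is a homeomorphism $\psi$ from an open subset of $\chi$ onto an open subset of some $\mathbb{R}^n$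 such that $\psi\circ\pi$ is a smooth submersion; a point of $\chi$ is smooth if it lies in the domain of a smooth chart. The group $\Gamma$ acts on $\mathrm{Hom}(F_2,\mathrm{PGL}(4,\mathbb{R}))$ by $(\gamma\sigma)(w)=\rho(\gamma)\,\sigma(\gamma^{-1}w\gamma)\,\rho(\gamma)^{-1}$; in particular $x$ acts by $\sigma\mapsto\rho(x)\,\sigma(\varphi^{-1}(\cdot))\,\rho(x)^{-1}$. This induces an action of $\Gamma/F_2$ on $\chi$. Write $\mathfrak g=\mathfrak{sl}(4,\mathbb{R})_{\mathrm{Ad}\,\rho}$. Then: 1. $[\rho|_{F_2}]$ is a smooth point of $\chi$. 2. $[\rho|_{F_2}]$ is a fixed point of the action of $\Gamma/F_2$ on $\chi$. 3. For every smooth chart $\psi$ at $[\rho|_{F_2}]$, sending a cocycle $f\in Z^1(F_2;\mathfrak g)$ to the derivative at $t=0$ of $\psi([\rho_t])$, where $\rho_t$ is a smooth path in $\mathrm{Hom}(F_2,\mathrm{PGL}(4,\mathbb{R}))$ with $\rho_0=\rho|_{F_2}$ and $f(w)=\frac{d}{dt}\big|_{t=0}\rho_t(w)\rho(w)^{-1}$,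 induces a linear isomorphism $\Theta_\psi$ from $H^1(F_2;\mathfrak g)$ onto $\mathbb{R}^n=T_{[\rho]}\chi$. Under this identification, for every $q\in\Gamma/F_2$, the action of $q$ on $\chi$ is differentiable at $[\rho|_{F_2}]$, and its differential there is the action of $q$ on $H^1(F_2;\mathfrak g)$ in the Lyndon–Hochschild–Serre spectral sequence $H^p(\Gamma/F_2;H^q(F_2;\mathfrak g))\Rightarrow H^{p+q}(\Gamma;\mathfrak g)$, which is given on cocycles by $(\gamma f)(w)=\mathrm{Ad}(\rho(\gamma))\,f(\gamma^{-1}w\gamma)$ for $\gamma\in\Gamma$ in the class $q$. -/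

import Mathlib

open scoped MatrixGroups ContDiff
open CategoryTheory

noncomputable section

namespace TorusBundle

/-! ### The group `PGL(4, ℝ)`, its Lie algebra and the adjoint representation -/

/-- `PGL(4, ℝ) = GL(4, ℝ) / center`. -/
abbrev PGL4 : Type := PGL(4, ℝ)

/-- `PGL(4, ℝ)` carries the quotient topology of `GL(4, ℝ)`. -/
instance : TopologicalSpace PGL4 :=
  TopologicalSpace.coinduced (Matrix.ProjGenLinGroup.mk : GL (Fin 4) ℝ → PGL4) inferInstance

attribute [local instance] Matrix.normedAddCommGroup Matrix.normedSpace

/-- The Lie algebra `𝔰𝔩(4, ℝ)` of traceless matrices (normed by the sup norm of the entries; the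
norm is only used for derivatives, so its choice is irrelevant). -/
abbrev sl4 : Submodule ℝ (Matrix (Fin 4) (Fin 4) ℝ) :=
  LinearMap.ker (Matrix.traceLinearMap (Fin 4) ℝ ℝ)

lemma mem_sl4 (X : Matrix (Fin 4) (Fin 4) ℝ) : X ∈ sl4 ↔ X.trace = 0 := Iff.rfl

/-- The conjugation action of `GL(4, ℝ)` on `𝔰𝔩(4, ℝ)`, `X ↦ A X A⁻¹`. -/
def adGL : Representation ℝ (GL (Fin 4) ℝ) sl4 where
  toFun A :=
    { toFun := fun X => ⟨A.1 * X.1 * (A⁻¹).1, by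
        have h := (mem_sl4 _).1 X.2
        rw [mem_sl4, Matrix.trace_mul_comm, ← Matrix.mul_assoc, ← Units.val_mul,
          inv_mul_cancel, Units.val_one, Matrix.one_mul, h]⟩
      map_add' := fun X Y => Subtype.ext (by simp [mul_add, add_mul])
      map_smul' := fun c X => Subtype.ext (by simp) }
  map_one' := by ext X : 2; simp
  map_mul' A B := by ext X : 2; simp [mul_assoc]

/-- The adjoint representation `Ad` of `PGL(4, ℝ)` on `𝔰𝔩(4, ℝ)`. -/
def Ad : Representation ℝ PGL4 sl4 :=
  QuotientGroup.lift (Subgroup.center (GL (Fin 4) ℝ)) adGL (by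
    intro A hA
    ext X : 2
    rw [Matrix.GeneralLinearGroup.center_eq_range_scalar] at hA
    obtain ⟨u, rfl⟩ := hA
    have hu : (Matrix.GeneralLinearGroup.scalar (Fin 4) u).1 * X.1 =
        X.1 * (Matrix.GeneralLinearGroup.scalar (Fin 4) u).1 := by
      simp [Matrix.scalar_apply, ← Matrix.smul_one_eq_diagonal]
    change (Matrix.GeneralLinearGroup.scalar (Fin 4) u).1 * X.1 *
      ((Matrix.GeneralLinearGroup.scalar (Fin 4) u)⁻¹).1 = X.1
    rw [hu, Matrix.mul_assoc, ← Units.val_mul, mul_inv_cancel, Units.val_one, Matrix.mul_one])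

/-- The class in `PGL(4, ℝ)` of the matrix exponential of `X ∈ 𝔰𝔩(4, ℝ)`. -/
def expPGL (X : sl4) : PGL4 :=
  Matrix.ProjGenLinGroup.mk (Matrix.isUnit_exp (X : Matrix (Fin 4) (Fin 4) ℝ)).unit

/-! ### The group `PSO(3, 1)` -/

/-- The Lorentzian form `x₁y₁ + x₂y₂ + x₃y₃ - x₄y₄`. -/
def lorentz : Matrix (Fin 4) (Fin 4) ℝ := Matrix.diagonal ![1, 1, 1, -1]

/-- Membership in `SO⁰(3, 1)`, the identity component of `SO(3, 1)`: preserve the Lorentzian form,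
have determinant one, and preserve the upper sheet of the hyperboloid. -/
structure IsSO31 (A : GL (Fin 4) ℝ) : Prop where
  form : A.1.transpose * lorentz * A.1 = lorentz
  det : A.1.det = 1
  sheet : 0 < A.1 3 3

/-- `PSO(3, 1) ⊆ PGL(4, ℝ)`, the projectivization of `SO⁰(3, 1)`, which is the group of orientation
preserving isometries of the Klein model of hyperbolic 3-space. -/
def PSO31 : Set PGL4 := Matrix.ProjGenLinGroup.mk '' {A | IsSO31 A}

/-! ### Representation variety and character variety -/

section Varieties

variable {F : Type} [Group F]

/-- The representation variety `Hom(F, PGL(4, ℝ))`. -/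
abbrev RepVariety (F : Type) [Group F] : Type := F →* PGL4

/-- The topology of pointwise convergence; for `F` free on `k` generators this is the product
topology of `PGL(4, ℝ)ᵏ`. -/
instance : TopologicalSpace (RepVariety F) :=
  TopologicalSpace.induced (fun σ (w : F) => σ w) inferInstance

/-- Two representations are equivalent when they are conjugate by an element of `PGL(4, ℝ)`. -/
instance conjSetoid (F : Type) [Group F] : Setoid (RepVariety F) where
  r σ τ := ∃ g : PGL4, ∀ w, τ w = g * σ w * g⁻¹
  iseqv :=
    { refl := fun σ => ⟨1, fun w => by simp⟩
      symm := by
        rintro σ τ ⟨g, h⟩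
        exact ⟨g⁻¹, fun w => by simp [h, mul_assoc]⟩
      trans := by
        rintro σ τ υ ⟨g, h⟩ ⟨g', h'⟩
        exact ⟨g' * g, fun w => by simp [h, h', mul_assoc]⟩ }

/-- The character variety `χ(F, PGL(4, ℝ))`: representations up to conjugation. -/
def CharVariety (F : Type) [Group F] : Type := Quotient (conjSetoid F)

/-- The character variety carries the quotient topology. -/
instance : TopologicalSpace (CharVariety F) :=
  inferInstanceAs (TopologicalSpace (Quotient (conjSetoid F)))

/-- The point `[σ]` of the character variety. -/
def charClass (σ : RepVariety F) : CharVariety F := Quotient.mk (conjSetoid F) σ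

/-- Exponential coordinates of `Hom(F, PGL(4, ℝ)) ≅ PGL(4, ℝ)²` centred at `σ`, for `F` free with
basis `b`: the pair `X` goes to the representation `b i ↦ exp(X i) σ(b i)`.  These are charts near
`X = 0` of the Lie group `PGL(4, ℝ)²`. -/
def expCoord (b : FreeGroupBasis (Fin 2) F) (σ : RepVariety F) (X : Fin 2 → sl4) : RepVariety F :=
  b.lift fun i => expPGL (X i) * σ (b i)

/-- The expression in exponential coordinates at `σ` of the composition of the projection
`Hom(F, PGL(4, ℝ)) → χ(F, PGL(4, ℝ))` with a map `ψ` on the character variety. -/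
def inCoord (b : FreeGroupBasis (Fin 2) F) {E : Type} (ψ : CharVariety F → E) (σ : RepVariety F)
    (X : Fin 2 → sl4) : E :=
  ψ (charClass (expCoord b σ X))

/-- A smooth chart of the character variety: a homeomorphism `ψ` from an open set of
`χ(F, PGL(4, ℝ))` onto an open set of `ℝⁿ` whose composition with the projection
`Hom(F, PGL(4, ℝ)) → χ(F, PGL(4, ℝ))` is a smooth submersion.  Any two such charts are smoothly
compatible. -/
structure IsSmoothChart (b : FreeGroupBasis (Fin 2) F) {n : ℕ}
    (ψ : OpenPartialHomeomorph (CharVariety F) (EuclideanSpace ℝ (Fin n))) : Prop where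
  smooth : ∀ σ : RepVariety F, charClass σ ∈ ψ.source → ContDiffAt ℝ ∞ (inCoord b ψ σ) 0
  submersion : ∀ σ : RepVariety F, charClass σ ∈ ψ.source →
    Function.Surjective (fderiv ℝ (inCoord b ψ σ) 0)

/-- A smooth point of the character variety: a point in the domain of some smooth chart. -/
def IsSmoothPoint (b : FreeGroupBasis (Fin 2) F) (p : CharVariety F) : Prop :=
  ∃ (n : ℕ) (ψ : OpenPartialHomeomorph (CharVariety F) (EuclideanSpace ℝ (Fin n))),
    IsSmoothChart b ψ ∧ p ∈ ψ.source

end Varieties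

/-! ### The action of `Γ/N` on the character variety of a normal subgroup `N` -/

section CharAction

variable {Γ : Type} [Group Γ] (ρ : Γ →* PGL4) (N : Subgroup Γ) [N.Normal]

/-- The action of `γ ∈ Γ` on `Hom(N, PGL(4, ℝ))`: precomposition with the inverse of the
automorphism `w ↦ γ w γ⁻¹` of `N`, followed by conjugation by `ρ(γ)`, that is
`(γ σ)(w) = ρ(γ) σ(γ⁻¹ w γ) ρ(γ)⁻¹`. -/
def repAct (γ : Γ) (σ : RepVariety N) : RepVariety N :=
  (MulAut.conj (ρ γ)).toMonoidHom.comp (σ.comp (MulAut.conjNormal γ⁻¹).toMonoidHom)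

lemma repAct_apply (γ : Γ) (σ : RepVariety N) (w : N) :
    repAct ρ N γ σ w = ρ γ * σ (MulAut.conjNormal γ⁻¹ w) * (ρ γ)⁻¹ := rfl

/-- The induced action of `Γ` on the character variety of `N`. -/
def charActAux : Γ →* Function.End (CharVariety N) where
  toFun γ := Quotient.map' (s₁ := conjSetoid N) (s₂ := conjSetoid N) (repAct ρ N γ) (by
    rintro σ τ ⟨g, h⟩
    refine ⟨ρ γ * g * (ρ γ)⁻¹, fun w => ?_⟩
    simp only [repAct_apply, h]
    group)
  map_one' := by
    funext p
    induction p using Quotient.inductionOn'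
    refine congrArg (Quotient.mk _) (MonoidHom.ext fun w => ?_)
    rw [repAct_apply, inv_one, map_one MulAut.conjNormal]
    simp
  map_mul' γ δ := by
    funext p
    induction p using Quotient.inductionOn'
    refine congrArg (Quotient.mk _) (MonoidHom.ext fun w => ?_)
    simp only [repAct_apply]
    rw [mul_inv_rev, map_mul MulAut.conjNormal, map_mul ρ, MulAut.mul_apply]
    group

/-- The subgroup `N` acts trivially, whence the action of `Γ/N` on the character variety of `N`. -/
def charAct : Γ ⧸ N →* Function.End (CharVariety N) :=
  QuotientGroup.lift N (charActAux ρ N) (by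
    intro h hh
    funext p
    induction p using Quotient.inductionOn' with | h σ =>
    refine Quotient.sound' ⟨σ ⟨h, hh⟩ * (ρ h)⁻¹, fun w => ?_⟩
    have e : MulAut.conjNormal h⁻¹ w = (⟨h, hh⟩ : N)⁻¹ * w * ⟨h, hh⟩ :=
      Subtype.ext (by simp)
    rw [repAct_apply, e]
    simp [mul_assoc])

lemma charAct_mk (γ : Γ) (σ : RepVariety N) :
    charAct ρ N (γ : Γ ⧸ N) (charClass σ) = charClass (repAct ρ N γ σ) := rfl

end CharAction

/-! ### The action of `Γ/N` on `H¹(N; A)` in the Lyndon–Hochschild–Serre spectral sequence -/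

section LHS

open groupCohomology

variable {Γ : Type} [Group Γ] (A : Rep.{0} ℝ Γ) (N : Subgroup Γ) [N.Normal]

/-- The action of `γ ∈ Γ` on the coefficients `A`, as a morphism of `N`-modules after twisting by
the automorphism `w ↦ γ⁻¹ w γ` of `N`. -/
def coeffMap (γ : Γ) :
    Rep.res (MulAut.conjNormal (H := N) γ⁻¹).toMonoidHom (Rep.res N.subtype A) ⟶
      Rep.res N.subtype A :=
  Rep.ofHom ⟨A.ρ γ, fun w => by
    ext v
    simp [← Module.End.mul_apply, ← map_mul, mul_assoc]⟩

/-- The map `H¹(N; A) → H¹(N; A)` given on cocycles by `(γ f)(w) = γ f(γ⁻¹ w γ)`. -/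
def lhsMap (γ : Γ) : H1 (Rep.res N.subtype A) ⟶ H1 (Rep.res N.subtype A) :=
  groupCohomology.map (MulAut.conjNormal γ⁻¹).toMonoidHom (coeffMap A N γ) 1

lemma exists_cocycle_lhsMap (γ : Γ) (f : cocycles₁ (Rep.res N.subtype A)) :
    ∃ f' : cocycles₁ (Rep.res N.subtype A),
      (∀ w : N, f' w = A.ρ γ (f (MulAut.conjNormal γ⁻¹ w))) ∧
      (lhsMap A N γ).hom (H1π _ f) = H1π _ f' := by
  refine ⟨mapCocycles₁ (MulAut.conjNormal γ⁻¹).toMonoidHom (coeffMap A N γ) f, fun _ => ?_, ?_⟩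
  · rw [coe_mapCocycles₁]
    rfl
  · unfold lhsMap
    erw [H1π_comp_map_apply]

lemma lhsMap_one : (lhsMap A N 1).hom = LinearMap.id := by
  ext x
  induction x using H1_induction_on with | h f =>
  obtain ⟨f', h, e⟩ := exists_cocycle_lhsMap A N 1 f
  rw [e, LinearMap.id_apply]
  congr 1
  refine cocycles₁_ext fun w => ?_
  rw [h, inv_one, map_one MulAut.conjNormal, map_one A.ρ]
  rfl

lemma lhsMap_mul (γ δ : Γ) :
    (lhsMap A N (γ * δ)).hom = (lhsMap A N γ).hom ∘ₗ (lhsMap A N δ).hom := by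
  ext x
  induction x using H1_induction_on with | h f =>
  obtain ⟨f₁, h₁, e₁⟩ := exists_cocycle_lhsMap A N δ f
  obtain ⟨f₂, h₂, e₂⟩ := exists_cocycle_lhsMap A N γ f₁
  obtain ⟨f₃, h₃, e₃⟩ := exists_cocycle_lhsMap A N (γ * δ) f
  rw [LinearMap.comp_apply, e₁, e₂, e₃]
  congr 1
  refine cocycles₁_ext fun w => ?_
  rw [h₂, h₁, h₃, mul_inv_rev, map_mul MulAut.conjNormal, map_mul A.ρ]
  rfl

lemma lhsMap_of_mem (h : Γ) (hh : h ∈ N) : (lhsMap A N h).hom = LinearMap.id := by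
  ext x
  induction x using H1_induction_on with | h f =>
  obtain ⟨f', h', e'⟩ := exists_cocycle_lhsMap A N h f
  rw [e', LinearMap.id_apply, H1π_eq_iff]
  refine ⟨f ⟨h, hh⟩, funext fun w => ?_⟩
  have hf := (mem_cocycles₁_iff (f : N → A.V)).1 f.2
  have e : MulAut.conjNormal h⁻¹ w = (⟨h, hh⟩ : N)⁻¹ * (w * ⟨h, hh⟩) :=
    Subtype.ext (by simp [mul_assoc])
  have k := hf ⟨h, hh⟩ (MulAut.conjNormal h⁻¹ w)
  have k' := hf w ⟨h, hh⟩
  rw [e, mul_inv_cancel_left, k'] at k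
  have k'' : f' w = A.ρ h (f ((⟨h, hh⟩ : N)⁻¹ * (w * ⟨h, hh⟩))) := by rw [h', e]
  change A.ρ w (f ⟨h, hh⟩) - f ⟨h, hh⟩ = f' w - f w
  rw [k'', sub_eq_sub_iff_add_eq_add]
  exact k

/-- The representation of `Γ/N` on `H¹(N; A)` which appears in the `E₂`-page
`Hᵖ(Γ/N; H^q(N; A))` of the Lyndon–Hochschild–Serre spectral sequence of the `Γ`-module `A` and the
normal subgroup `N`. -/
def lhsAct : Representation ℝ (Γ ⧸ N) (H1 (Rep.res N.subtype A)) :=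
  QuotientGroup.lift N
    { toFun := fun γ => (lhsMap A N γ).hom
      map_one' := lhsMap_one A N
      map_mul' := lhsMap_mul A N }
    (lhsMap_of_mem A N)

end LHS

/-! ### Hyperbolic once-punctured torus bundles and their holonomy -/

section Bundle

/-- The fundamental group of the once-punctured torus, free on `a = of 0` and `b = of 1`. -/
abbrev F2 : Type := FreeGroup (Fin 2)

/-- The boundary loop `a b a⁻¹ b⁻¹` of the once-punctured torus. -/
def boundaryLoop : F2 :=
  FreeGroup.of 0 * FreeGroup.of 1 * (FreeGroup.of 0)⁻¹ * (FreeGroup.of 1)⁻¹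

/-- The exponent sum of the generator `i` in a word of `F2`. -/
def expSum (i : Fin 2) : F2 →* Multiplicative ℤ :=
  FreeGroup.lift (Pi.mulSingle i (Multiplicative.ofAdd 1))

/-- The matrix of the action of an automorphism of `F2` on `H₁ = ℤ²`. -/
def homologyMatrix (φ : MulAut F2) : Matrix (Fin 2) (Fin 2) ℤ :=
  Matrix.of fun i j => (expSum i (φ (FreeGroup.of j))).toAdd

/-- `φ` is the automorphism of `F2` induced by the monodromy of a hyperbolic once-punctured torus
bundle: it comes from an orientation preserving homeomorphism of the once-punctured torus, that is,
it preserves the conjugacy class of the boundary loop and its class on homology is in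
`SL(2, ℤ)`; and this class is hyperbolic, `|tr φ| > 2`. -/
structure IsHyperbolicMonodromy (φ : MulAut F2) : Prop where
  boundary : IsConj (φ boundaryLoop) boundaryLoop
  det : (homologyMatrix φ).det = 1
  trace : 2 < |(homologyMatrix φ).trace|

/-- The fundamental group `Γ = ⟨a, b, x | x a x⁻¹ = φ(a), x b x⁻¹ = φ(b)⟩ = F2 ⋊ ⟨x⟩` of the
once-punctured torus bundle with monodromy `φ`. -/
abbrev BundleGroup (φ : MulAut F2) : Type :=
  F2 ⋊[zpowersHom (MulAut F2) φ] Multiplicative ℤ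

variable (φ : MulAut F2)

/-- The generator `x` of `Γ` mapping to the generator of the fundamental group of the base circle. -/
def stableLetter : BundleGroup φ := SemidirectProduct.inr (Multiplicative.ofAdd 1)

lemma stableLetter_conj (w : F2) :
    stableLetter φ * SemidirectProduct.inl w * (stableLetter φ)⁻¹ =
      SemidirectProduct.inl (φ w) := by
  have h := SemidirectProduct.inl_aut (φ := zpowersHom (MulAut F2) φ) (Multiplicative.ofAdd 1) w
  rw [stableLetter, ← map_inv, ← h]
  simp

/-- The fundamental group of the fiber, as a subgroup of `Γ`. -/
def fiber : Subgroup (BundleGroup φ) := (SemidirectProduct.inl : F2 →* BundleGroup φ).range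

instance : (fiber φ).Normal := by
  rw [fiber, SemidirectProduct.range_inl_eq_ker_rightHom]
  infer_instance

/-- The identification of `F2` with the fiber group. -/
def fiberIncl : F2 →* fiber φ :=
  MonoidHom.codRestrict SemidirectProduct.inl (fiber φ) fun w => ⟨w, rfl⟩

lemma coe_fiberIncl (w : F2) : (fiberIncl φ w : BundleGroup φ) = SemidirectProduct.inl w := rfl

/-- The generator `x` acts on `Hom(F2, PGL(4, ℝ))` by `σ ↦ ρ(x) σ(φ⁻¹(·)) ρ(x)⁻¹`. -/
lemma repAct_stableLetter (ρ : BundleGroup φ →* PGL4) (σ : RepVariety (fiber φ)) (w : F2) :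
    repAct ρ (fiber φ) (stableLetter φ) σ (fiberIncl φ w) =
      ρ (stableLetter φ) * σ (fiberIncl φ (φ⁻¹ w)) * (ρ (stableLetter φ))⁻¹ := by
  have e : MulAut.conjNormal (stableLetter φ)⁻¹ (fiberIncl φ w) = fiberIncl φ (φ⁻¹ w) := by
    refine Subtype.ext ?_
    have h := stableLetter_conj φ (φ⁻¹ w)
    rw [MulAut.apply_inv_self] at h
    rw [MulAut.conjNormal_apply, inv_inv, coe_fiberIncl, coe_fiberIncl, ← h]
    group
  rw [repAct_apply, e]

/-- The free basis `a, b` of the fiber group. -/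
def fiberBasis : FreeGroupBasis (Fin 2) (fiber φ) :=
  FreeGroupBasis.ofRepr (MonoidHom.ofInjective SemidirectProduct.inl_injective).symm

lemma coe_fiberBasis (i : Fin 2) :
    (fiberBasis φ i : BundleGroup φ) = SemidirectProduct.inl (FreeGroup.of i) := rfl

/-- `ρ` is the holonomy representation `Γ → PSO(3, 1) ⊆ PGL(4, ℝ)` of the complete hyperbolic
structure: a discrete and faithful representation into `PSO(3, 1)`. -/
structure IsHolonomy (ρ : BundleGroup φ →* PGL4) : Prop where
  mem_PSO31 : ∀ γ, ρ γ ∈ PSO31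
  faithful : Function.Injective ρ
  discrete : DiscreteTopology ρ.range

end Bundle

/-! ### The tangent space of the character variety and `H¹` -/

section Tangent

open groupCohomology

variable {Γ : Type} [Group Γ] (ρ : Γ →* PGL4) (N : Subgroup Γ) [N.Normal]

/-- The `Γ`-module `𝔰𝔩(4, ℝ)_{Ad ρ}`. -/
abbrev adModule : Rep.{0} ℝ Γ := Rep.of (Ad.comp ρ)

/-- `H¹(N; 𝔰𝔩(4, ℝ)_{Ad ρ})`. -/
abbrev H1Ad : Type := H1 (Rep.res N.subtype (adModule ρ))

/-- The restriction of `ρ` to `N`. -/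
def restrict : RepVariety N := ρ.comp N.subtype

variable {N} in
/-- A smooth chart `ψ` at `[ρ|N]` identifies the tangent space of the character variety with `ℝⁿ`.
The identification `Θ` of `H¹(N; 𝔰𝔩(4, ℝ)_{Ad ρ})` with this tangent space is the one which sends the
class of a cocycle `f` to the derivative at `t = 0` of `ψ [ρ_t]`, where `ρ_t` is a path of
representations with `ρ_0 = ρ|N` and velocity `f(w) = d/dt ρ_t(w) ρ(w)⁻¹`. -/
def IsTangentIdentification (b : FreeGroupBasis (Fin 2) N) {n : ℕ}
    (ψ : OpenPartialHomeomorph (CharVariety N) (EuclideanSpace ℝ (Fin n)))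
    (Θ : H1Ad ρ N ≃ₗ[ℝ] EuclideanSpace ℝ (Fin n)) : Prop :=
  ∀ f : cocycles₁ (Rep.res N.subtype (adModule ρ)),
    Θ (H1π _ f) = fderiv ℝ (inCoord b ψ (restrict ρ N)) 0 (fun i => f (b i))

end Tangent

end TorusBundle

end

noncomputable section

namespace TorusBundle

attribute [local instance] Matrix.normedAddCommGroup Matrix.normedSpace

open Filter Topology

/-! ### Real `4 × 4` matrices as operators -/

/-! Everything rests on one algebraic fact about the holonomy of the fiber: a matrix that commutes
up to scalar factors with lifts of `ρ(a)` and `ρ(b)` is scalar (`exists_eq_smul_one_of_commute`).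
Infinitesimally this says that conjugation has trivial stabilizer in the Lie algebra at `ρ|F₂`.
Globally, after normalizing representatives and passing to a limit, it says that conjugate
representations close to `ρ|F₂` are conjugate by an element close to `1`.

The fact comes from the cusp. The boundary loop `c` and a suitable `y = d x` generate a discrete
`ℤ²` fixing a null line, so acting by similarities of a Euclidean plane. Discreteness forces both to
be translations, by independent vectors (`translations_of_discrete`). A matrix commuting with `ρ|F₂`
up to scalars commutes exactly with commutators, hence with all conjugates of `c` in the fiber
group. The square of a translation minus `1` has rank one with image the null line, so that line is
an eigenline. The fiber group moves this line, since a free group has no faithful representation by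
similarities, and translating the new line by `c` and `y` gives four independent null eigenvectors.
Comparing eigenvalues through the last row shows that they are equal.

With this, the inverse function theorem gives a slice for conjugation at `ρ|F₂`
(`exists_localSlice`), and the inverse of the slice parametrization is a smooth chart
(`LocalSlice.exists_chart`). In any smooth chart `ψ`, the kernel of the differential of `ψ ∘ π` is
exactly the tangent space of the orbit: one inclusion because `ψ ∘ π` is constant on orbits, the
other by comparison with the slice (`mem_range_orbitMap`). As `F₂` is free, a cocycle is an
arbitrary pair of values on the basis, and orbit directions are coboundaries; this gives `Θ`.

The action of `γ` fixes `ρ|F₂` itself, because `ρ` is defined on all of `Γ`. Differentiating word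
maps produces cocycles (`exists_hasFDerivAt_coordLift`), so the differential of the action in
exponential coordinates is `f ↦ Ad(ρ(γ)) f(γ⁻¹ · γ)`. A local right inverse of `ψ ∘ π` carries this
to the chart (`exists_tangentIdentification`). -/

/-- The space of real `4 × 4` matrices. -/
abbrev Mat4 : Type := Matrix (Fin 4) (Fin 4) ℝ

/-- The normed algebra of operators of `ℝ⁴`. -/
abbrev Op : Type := (Fin 4 → ℝ) →L[ℝ] (Fin 4 → ℝ)

/-- Real `4 × 4` matrices as a normed algebra of operators. -/
def op : Mat4 ≃ₐ[ℝ] Op := Matrix.toLinAlgEquiv'.trans (Module.End.toContinuousLinearMap (Fin 4 → ℝ))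

lemma continuous_op : Continuous op :=
  op.toLinearEquiv.toContinuousLinearEquiv.continuous

lemma continuous_op_symm : Continuous op.symm :=
  op.toLinearEquiv.toContinuousLinearEquiv.symm.continuous

lemma map_op_nhds (A : Mat4) : map op (𝓝 A) = 𝓝 (op A) :=
  op.toLinearEquiv.toContinuousLinearEquiv.toHomeomorph.map_nhds_eq A

/-- `Op` has a submultiplicative norm, which the entrywise sup norm of matrices is not, so the
calculus of the exponential is done there. A linear isomorphism in finite dimension is continuous,
so `op` carries one exponential series to the other term by term. -/
lemma op_exp (A : Mat4) : op (NormedSpace.exp A) = NormedSpace.exp (op A) := by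
  rw [NormedSpace.exp_eq_tsum ℝ, NormedSpace.exp_eq_tsum ℝ]
  change op.toLinearEquiv.toContinuousLinearEquiv (∑' n : ℕ, ((n.factorial : ℝ))⁻¹ • A ^ n) = _
  rw [ContinuousLinearEquiv.map_tsum]
  refine tsum_congr fun n => ?_
  rw [map_smul]
  congr 1
  exact map_pow op A n

/-- A traceless matrix as an operator. -/
def slOp : sl4 →L[ℝ] Op :=
  LinearMap.toContinuousLinearMap (op.toLinearEquiv.toLinearMap ∘ₗ sl4.subtype)

lemma slOp_apply (X : sl4) : slOp X = op X.1 := rfl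

lemma slOp_injective : Function.Injective slOp := fun _ _ h => Subtype.ext (op.injective h)

/-- The traceless part of an operator. -/
def tracelessPart : Op →L[ℝ] sl4 :=
  LinearMap.toContinuousLinearMap
    (LinearMap.codRestrict sl4
      (LinearMap.id - (LinearMap.toSpanSingleton ℝ Mat4 1) ∘ₗ
        ((1 / 4 : ℝ) • Matrix.traceLinearMap (Fin 4) ℝ ℝ))
      (fun A => by
        rw [mem_sl4]
        simp
        ring) ∘ₗ op.symm.toLinearEquiv.toLinearMap)

lemma coe_tracelessPart (A : Mat4) :
    (tracelessPart (op A) : Mat4) = A - (A.trace / 4) • (1 : Mat4) := by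
  change op.symm (op A) - ((1 / 4 : ℝ) * (op.symm (op A)).trace) • (1 : Mat4) = _
  rw [one_div, inv_mul_eq_div, AlgEquiv.symm_apply_apply]

lemma tracelessPart_slOp (X : sl4) : tracelessPart (slOp X) = X :=
  Subtype.ext (by rw [slOp_apply, coe_tracelessPart, (mem_sl4 _).1 X.2]; simp)

lemma tracelessPart_smul_one (t : ℝ) : tracelessPart (t • (1 : Op)) = 0 := by
  rw [← map_one op, ← map_smul]
  exact Subtype.ext (by rw [coe_tracelessPart]; simp)

lemma tracelessPart_add_smul_one (X : sl4) (t : ℝ) :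
    tracelessPart (slOp X + t • (1 : Op)) = X := by
  rw [map_add, tracelessPart_slOp, tracelessPart_smul_one, add_zero]

lemma exists_slOp_tracelessPart (A : Op) : ∃ t : ℝ, A = slOp (tracelessPart A) + t • (1 : Op) := by
  obtain ⟨A, rfl⟩ := op.surjective A
  refine ⟨A.trace / 4, ?_⟩
  rw [slOp_apply, coe_tracelessPart, ← map_one op, ← map_smul, ← map_add, sub_add_cancel]

lemma exp_add_smul_one (A : Op) (t : ℝ) :
    NormedSpace.exp (A + t • (1 : Op)) = Real.exp t • NormedSpace.exp A := by
  let := NormedAlgebra.restrictScalars ℚ ℝ Op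
  rw [NormedSpace.exp_add_of_commute ((Commute.one_right A).smul_right t)]
  have : NormedSpace.exp (t • (1 : Op)) = Real.exp t • (1 : Op) := by
    rw [← Algebra.algebraMap_eq_smul_one, ← Algebra.algebraMap_eq_smul_one, Real.exp_eq_exp_ℝ]
    exact (NormedSpace.algebraMap_exp_comm t).symm
  rw [this, mul_smul_comm, mul_one]

lemma exp_neg_mul_exp (A : Op) : NormedSpace.exp (-A) * NormedSpace.exp A = 1 := by
  let := NormedAlgebra.restrictScalars ℚ ℝ Op
  rw [← NormedSpace.exp_add_of_commute (Commute.refl A).neg_left, neg_add_cancel,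
    NormedSpace.exp_zero]

lemma contDiff_exp : ContDiff ℝ ω (NormedSpace.exp : Op → Op) :=
  contDiff_iff_contDiffAt.2 fun x => (NormedSpace.exp_analytic (𝕂 := ℝ) x).contDiffAt

/-! ### The group `PGL(4, ℝ)` -/

instance : IsTopologicalGroup PGL4 :=
  inferInstanceAs (IsTopologicalGroup (GL (Fin 4) ℝ ⧸ Subgroup.center (GL (Fin 4) ℝ)))

/-- The class of an invertible matrix in `PGL(4, ℝ)`. -/
abbrev toPGL : GL (Fin 4) ℝ →* PGL4 := Matrix.ProjGenLinGroup.mk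

lemma toPGL_surjective : Function.Surjective toPGL := Matrix.ProjGenLinGroup.mk_surjective

lemma continuous_toPGL : Continuous toPGL := continuous_coinduced_rng

lemma isOpenMap_toPGL : IsOpenMap toPGL :=
  QuotientGroup.isOpenMap_coe (N := Subgroup.center (GL (Fin 4) ℝ))

/-- An invertible matrix as an operator. -/
def glOp : GL (Fin 4) ℝ →* Op := (op : Mat4 →* Op).comp (Units.coeHom Mat4)

lemma glOp_apply (A : GL (Fin 4) ℝ) : glOp A = op A.1 := rfl

lemma glOp_injective : Function.Injective glOp := fun _ _ h => Units.ext (op.injective h)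

lemma continuous_glOp : Continuous glOp := continuous_op.comp Units.continuous_val

lemma glOp_mul_inv (A : GL (Fin 4) ℝ) : glOp A * glOp A⁻¹ = 1 := by
  rw [← map_mul, mul_inv_cancel, map_one]

lemma glOp_inv_mul (A : GL (Fin 4) ℝ) : glOp A⁻¹ * glOp A = 1 := by
  rw [← map_mul, inv_mul_cancel, map_one]

lemma glOp_ne_zero (A : GL (Fin 4) ℝ) : glOp A ≠ 0 := by
  intro h
  have := glOp_mul_inv A
  rw [h, zero_mul] at this
  exact zero_ne_one this

lemma exists_glOp_eq {A B : Op} (h : A * B = 1) : ∃ g : GL (Fin 4) ℝ, glOp g = A := by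
  have h' : op.symm A * op.symm B = 1 := by rw [← map_mul, h, map_one]
  refine ⟨⟨op.symm A, op.symm B, h', mul_eq_one_comm.1 h'⟩, ?_⟩
  rw [glOp_apply, AlgEquiv.apply_symm_apply]

lemma toPGL_eq_of_smul {A B : GL (Fin 4) ℝ} {c : ℝ} (h : glOp A = c • glOp B) :
    toPGL A = toPGL B := by
  have hc : c ≠ 0 := by
    rintro rfl
    rw [zero_smul] at h
    exact glOp_ne_zero A h
  rw [glOp_apply, glOp_apply, ← map_smul] at h
  rw [eq_comm, Matrix.ProjGenLinGroup.mk_eq_mk_iff]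
  refine ⟨Units.mk0 c hc, Units.ext ?_⟩
  rw [op.injective h]
  simp [Matrix.scalar_apply, ← Matrix.smul_one_eq_diagonal]

lemma exists_smul_of_toPGL_eq {A B : GL (Fin 4) ℝ} (h : toPGL A = toPGL B) :
    ∃ c : ℝ, c ≠ 0 ∧ A.1 = c • B.1 := by
  rw [eq_comm, Matrix.ProjGenLinGroup.mk_eq_mk_iff] at h
  obtain ⟨u, rfl⟩ := h
  refine ⟨u, u.ne_zero, ?_⟩
  simp [Matrix.scalar_apply, ← Matrix.smul_one_eq_diagonal]

lemma exists_glOp_smul_of_toPGL_eq {A B : GL (Fin 4) ℝ} (h : toPGL A = toPGL B) :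
    ∃ c : ℝ, c ≠ 0 ∧ glOp A = c • glOp B := by
  obtain ⟨c, hc, e⟩ := exists_smul_of_toPGL_eq h
  exact ⟨c, hc, by rw [glOp_apply, e, map_smul, glOp_apply]⟩

/-- The exponential of a matrix, as an invertible matrix. -/
def expGL (X : Mat4) : GL (Fin 4) ℝ := (Matrix.isUnit_exp X).unit

lemma glOp_expGL (X : Mat4) : glOp (expGL X) = NormedSpace.exp (op X) := op_exp X

lemma glOp_expGL_inv (X : Mat4) : glOp (expGL X)⁻¹ = NormedSpace.exp (-op X) := by
  have h := exp_neg_mul_exp (op X)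
  rw [← glOp_expGL] at h
  rw [← one_mul (glOp (expGL X)⁻¹), ← h, mul_assoc, glOp_mul_inv, mul_one]

lemma toPGL_expGL (X : sl4) : toPGL (expGL X) = expPGL X := rfl

/-- The trace part of `A` is central and contributes only a positive factor to the exponential,
which is trivial in `PGL(4, ℝ)`. -/
lemma toPGL_expGL_eq (A : Mat4) : toPGL (expGL A) = expPGL (tracelessPart (op A)) := by
  rw [← toPGL_expGL]
  obtain ⟨t, ht⟩ := exists_slOp_tracelessPart (op A)
  refine toPGL_eq_of_smul (c := Real.exp t) ?_
  rw [glOp_expGL, glOp_expGL, ← exp_add_smul_one, ← slOp_apply, ← ht]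

/-! ### The local logarithm of `PGL(4, ℝ)` -/

lemma hasFDerivAt_exp_zero_equiv : HasFDerivAt (NormedSpace.exp : Op → Op)
    (ContinuousLinearEquiv.refl ℝ Op : Op →L[ℝ] Op) 0 :=
  hasFDerivAt_exp_zero (𝕂 := ℝ)

/-- The exponential as a homeomorphism from a neighbourhood of `0` to a neighbourhood of `1`. -/
def expHomeo : OpenPartialHomeomorph Op Op :=
  contDiff_exp.contDiffAt.toOpenPartialHomeomorph NormedSpace.exp hasFDerivAt_exp_zero_equiv
    (by simp)

lemma expHomeo_apply (A : Op) : expHomeo A = NormedSpace.exp A := rfl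

lemma zero_mem_expHomeo_source : (0 : Op) ∈ expHomeo.source :=
  ContDiffAt.mem_toOpenPartialHomeomorph_source _ _ _

lemma one_mem_expHomeo_target : (1 : Op) ∈ expHomeo.target := by
  have := expHomeo.map_source zero_mem_expHomeo_source
  rwa [expHomeo_apply, NormedSpace.exp_zero] at this

lemma expHomeo_symm_one : expHomeo.symm (1 : Op) = 0 := by
  have := expHomeo.left_inv zero_mem_expHomeo_source
  rwa [expHomeo_apply, NormedSpace.exp_zero] at this

/-- The traceless part of the local logarithm. -/
def plog (A : Op) : sl4 := tracelessPart (expHomeo.symm A)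

lemma contDiffAt_plog : ContDiffAt ℝ ω plog 1 := by
  refine tracelessPart.contDiff.contDiffAt.comp _
    (expHomeo.contDiffAt_symm one_mem_expHomeo_target (f₀' := ContinuousLinearEquiv.refl ℝ Op)
    ?_ contDiff_exp.contDiffAt)
  rw [expHomeo_symm_one]
  exact hasFDerivAt_exp_zero_equiv

lemma hasFDerivAt_plog : HasFDerivAt plog tracelessPart 1 := by
  have h : HasFDerivAt expHomeo.symm
      ((ContinuousLinearEquiv.refl ℝ Op).symm : Op →L[ℝ] Op) 1 := by
    refine expHomeo.hasFDerivAt_symm one_mem_expHomeo_target ?_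
    rw [expHomeo_symm_one]
    exact hasFDerivAt_exp_zero_equiv
  exact tracelessPart.hasFDerivAt.comp (1 : Op) h

lemma plog_one : plog 1 = 0 := by rw [plog, expHomeo_symm_one, map_zero]

lemma eventually_toPGL_eq_expPGL_plog : ∀ᶠ A in 𝓝 (1 : Op), ∀ B : GL (Fin 4) ℝ, glOp B = A →
    toPGL B = expPGL (plog A) := by
  filter_upwards [expHomeo.open_target.mem_nhds one_mem_expHomeo_target] with A hA B hB
  obtain ⟨L, hL⟩ := op.surjective (expHomeo.symm A)
  rw [plog, ← hL, ← toPGL_expGL_eq]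
  congr 1
  refine glOp_injective ?_
  rw [hB, glOp_expGL, hL, ← expHomeo_apply, expHomeo.right_inv hA]

/-- A factor `c` near `1` adds `log c • 1` to the logarithm, which the traceless part removes. Thus
`plog` does not see the ambiguity of a representative in `GL(4, ℝ)`. -/
lemma eventually_plog_smul_exp : ∀ᶠ p : ℝ × sl4 in 𝓝 (1, 0),
    plog (p.1 • NormedSpace.exp (slOp p.2)) = p.2 := by
  have hc : ContinuousAt (fun p : ℝ × sl4 => slOp p.2 + Real.log p.1 • (1 : Op)) (1, 0) := by
    refine ContinuousAt.add (by fun_prop)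
      (ContinuousAt.smul (f := fun p : ℝ × sl4 => Real.log p.1) ?_ continuousAt_const)
    exact ContinuousAt.comp' (Real.continuousAt_log one_ne_zero) continuousAt_fst
  have h1 : ∀ᶠ p : ℝ × sl4 in 𝓝 (1, 0),
      slOp p.2 + Real.log p.1 • (1 : Op) ∈ expHomeo.source :=
    hc.eventually_mem (expHomeo.open_source.mem_nhds (by simpa using zero_mem_expHomeo_source))
  have h2 : ∀ᶠ p : ℝ × sl4 in 𝓝 (1, 0), 0 < p.1 :=
    continuousAt_fst.eventually_mem (lt_mem_nhds one_pos)
  filter_upwards [h1, h2] with p hp hp'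
  have := expHomeo.left_inv hp
  rw [expHomeo_apply, exp_add_smul_one, Real.exp_log hp'] at this
  rw [plog, this, tracelessPart_add_smul_one]

lemma eventually_plog_exp : ∀ᶠ X : sl4 in 𝓝 0, plog (NormedSpace.exp (slOp X)) = X := by
  have hc : Tendsto (fun X : sl4 => ((1 : ℝ), X)) (𝓝 0) (𝓝 (1, 0)) :=
    (continuous_const.prodMk continuous_id).tendsto _
  filter_upwards [hc.eventually eventually_plog_smul_exp] with X hX
  simpa using hX

lemma continuous_of_continuous_glOp {V : Type*} [TopologicalSpace V] {f : V → GL (Fin 4) ℝ}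
    (h : Continuous fun v => glOp (f v)) (h' : Continuous fun v => glOp (f v)⁻¹) :
    Continuous f := by
  have e : ∀ g : GL (Fin 4) ℝ, op.symm (glOp g) = g.1 := fun g => op.symm_apply_apply g.1
  refine Units.continuous_iff.2 ⟨?_, ?_⟩
  · exact (continuous_op_symm.comp h).congr fun v => e _
  · exact (continuous_op_symm.comp h').congr fun v => e _

lemma continuous_exp : Continuous (NormedSpace.exp : Op → Op) := contDiff_exp.continuous

/-- Openness of `expPGL` at points near `0`, in filter form. The matrix exponential is open there by
the inverse function theorem, `toPGL` is open, and the composite factors through the traceless part.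
-/
lemma eventually_nhds_expPGL_le :
    ∀ᶠ X : sl4 in 𝓝 0, 𝓝 (expPGL X) ≤ map expPGL (𝓝 X) := by
  have h : ∀ᶠ X : sl4 in 𝓝 0, slOp X ∈ expHomeo.source :=
    slOp.continuous.continuousAt.eventually_mem
      (expHomeo.open_source.mem_nhds (by simpa using zero_mem_expHomeo_source))
  filter_upwards [h] with X hX
  have h2 : 𝓝 (expGL X) ≤ map expGL (𝓝 (X : Mat4)) := by
    have e : (glOp ∘ expGL : Mat4 → Op) = NormedSpace.exp ∘ op := funext glOp_expGL
    rw [← Filter.map_le_map_iff glOp_injective, Filter.map_map, e, ← Filter.map_map,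
      map_op_nhds, ← slOp_apply]
    have h1 := expHomeo.map_nhds_eq hX
    change map NormedSpace.exp (𝓝 (slOp X)) = 𝓝 (NormedSpace.exp (slOp X)) at h1
    rw [h1, slOp_apply, ← glOp_expGL]
    exact continuous_glOp.continuousAt
  calc 𝓝 (expPGL X) ≤ map toPGL (𝓝 (expGL X)) := isOpenMap_toPGL.nhds_le (expGL X)
    _ ≤ map toPGL (map expGL (𝓝 (X : Mat4))) := map_mono h2
    _ = map expPGL (map tracelessPart (map op (𝓝 (X : Mat4)))) := by
        rw [map_map, map_map, map_map]
        congr 1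
        exact funext toPGL_expGL_eq
    _ ≤ map expPGL (𝓝 X) := by
        refine map_mono ?_
        rw [map_op_nhds]
        have := tracelessPart.continuous.continuousAt (x := slOp X)
        rwa [ContinuousAt, tracelessPart_slOp] at this

/-! ### Lorentz matrices and discrete groups -/

lemma lorentz_mul_self : lorentz * lorentz = 1 := by
  rw [lorentz, Matrix.diagonal_mul_diagonal, ← Matrix.diagonal_one]
  congr 1
  ext i
  fin_cases i <;> simp

lemma transpose_mul_lorentz_mul_apply (A B : Mat4) (i j : Fin 4) :
    (A.transpose * lorentz * B) i j =
      A 0 i * B 0 j + A 1 i * B 1 j + A 2 i * B 2 j - A 3 i * B 3 j := by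
  simp [lorentz, Matrix.mul_apply, Fin.sum_univ_four, Matrix.diagonal_apply]
  ring

namespace IsSO31

variable {A B : GL (Fin 4) ℝ}

/-- The inverse is polynomial in the entries, so limits of Lorentz matrices pass to inverses. -/
lemma coe_inv (hA : IsSO31 A) : (A⁻¹).1 = lorentz * A.1.transpose * lorentz := by
  have h : lorentz * A.1.transpose * lorentz * A.1 = 1 := by
    rw [mul_assoc, mul_assoc, ← mul_assoc A.1.transpose, hA.form, lorentz_mul_self]
  calc (A⁻¹).1 = lorentz * A.1.transpose * lorentz * A.1 * (A⁻¹).1 := by rw [h, one_mul]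
    _ = _ := by rw [mul_assoc, ← Units.val_mul, mul_inv_cancel, Units.val_one, mul_one]

lemma mul_lorentz_transpose (hA : IsSO31 A) : A.1 * lorentz * A.1.transpose = lorentz := by
  have h : A.1 * (lorentz * A.1.transpose * lorentz) = 1 := by
    rw [← hA.coe_inv, ← Units.val_mul, mul_inv_cancel, Units.val_one]
  calc A.1 * lorentz * A.1.transpose
      = A.1 * (lorentz * A.1.transpose * lorentz) * lorentz := by
        simp only [mul_assoc, lorentz_mul_self, mul_one]
    _ = _ := by rw [h, one_mul]

lemma last_row (hA : IsSO31 A) :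
    A.1 3 3 ^ 2 = 1 + (A.1 3 0 ^ 2 + A.1 3 1 ^ 2 + A.1 3 2 ^ 2) := by
  have h := congrFun (congrFun hA.mul_lorentz_transpose 3) 3
  simp [lorentz, Matrix.mul_apply, Fin.sum_univ_four, Matrix.diagonal_apply] at h
  linear_combination -h

lemma last_col (hA : IsSO31 A) :
    A.1 3 3 ^ 2 = 1 + (A.1 0 3 ^ 2 + A.1 1 3 ^ 2 + A.1 2 3 ^ 2) := by
  have h := congrFun (congrFun hA.form 3) 3
  rw [transpose_mul_lorentz_mul_apply] at h
  simp [lorentz] at h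
  linear_combination -h

/-- The last row of a matrix in `SO⁰(3, 1)` pairs positively with the forward timelike and
null vectors. -/
lemma last_row_pos (hA : IsSO31 A) {x y z t : ℝ} (ht : 0 < t) (h : x ^ 2 + y ^ 2 + z ^ 2 ≤ t ^ 2) :
    0 < A.1 3 0 * x + A.1 3 1 * y + A.1 3 2 * z + A.1 3 3 * t := by
  have h1 := hA.last_row
  have h2 := hA.sheet
  set a := A.1 3 0
  set b := A.1 3 1
  set c := A.1 3 2
  set d := A.1 3 3
  -- Cauchy–Schwarz through Lagrange's identity. Strictness enters below because `a ^ 2 + b ^ 2 + c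
  -- ^ 2` is `d ^ 2 - 1` and not `d ^ 2`.
  have h3 : (a * x + b * y + c * z) ^ 2 ≤ (a ^ 2 + b ^ 2 + c ^ 2) * (x ^ 2 + y ^ 2 + z ^ 2) := by
    nlinarith [sq_nonneg (a * y - b * x), sq_nonneg (a * z - c * x), sq_nonneg (b * z - c * y)]
  have h4 : (a ^ 2 + b ^ 2 + c ^ 2) * (x ^ 2 + y ^ 2 + z ^ 2) ≤ (d ^ 2 - 1) * t ^ 2 := by
    have e : d ^ 2 - 1 = a ^ 2 + b ^ 2 + c ^ 2 := by linear_combination h1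
    rw [e]
    exact mul_le_mul_of_nonneg_left h (by positivity)
  have h5 : (a * x + b * y + c * z) ^ 2 < (d * t) ^ 2 := by
    have : 0 < t ^ 2 := by positivity
    nlinarith
  have h6 := (abs_lt_of_sq_lt_sq h5 (by positivity))
  rw [abs_lt] at h6
  linarith

lemma mul (hA : IsSO31 A) (hB : IsSO31 B) : IsSO31 (A * B) where
  form := by
    rw [Units.val_mul, Matrix.transpose_mul]
    calc B.1.transpose * A.1.transpose * lorentz * (A.1 * B.1)
        = B.1.transpose * (A.1.transpose * lorentz * A.1) * B.1 := by simp only [mul_assoc]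
      _ = _ := by rw [hA.form, hB.form]
  det := by rw [Units.val_mul, Matrix.det_mul, hA.det, hB.det, one_mul]
  sheet := by
    have h := hA.last_row_pos hB.sheet (x := B.1 0 3) (y := B.1 1 3) (z := B.1 2 3) (by
      rw [hB.last_col]; linarith)
    rwa [Units.val_mul, Matrix.mul_apply, Fin.sum_univ_four]

lemma one : IsSO31 1 where
  form := by simp
  det := by simp
  sheet := by simp

/-- The form forces the ratio `c` to satisfy `c ^ 2 = 1`, and the sheet condition forces `c > 0`.
Lifts to `SO⁰(3, 1)` are therefore unique, hence multiplicative. -/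
lemma eq_of_toPGL_eq (hA : IsSO31 A) (hB : IsSO31 B) (h : toPGL A = toPGL B) : A = B := by
  obtain ⟨c, -, e⟩ := exists_smul_of_toPGL_eq h
  have h1 := congrFun (congrFun hA.form 3) 3
  have h2 := congrFun (congrFun hB.form 3) 3
  rw [transpose_mul_lorentz_mul_apply] at h1 h2
  have e' : ∀ i j, A.1 i j = c * B.1 i j := fun i j => by rw [e]; simp
  simp only [e'] at h1
  have h3 : c ^ 2 = 1 := by
    have : lorentz 3 3 = -1 := by simp [lorentz]
    rw [this] at h1 h2
    linear_combination -h1 + c ^ 2 * h2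
  have h4 : 0 < c := by
    have := hA.sheet
    rw [e'] at this
    exact pos_of_mul_pos_left this hB.sheet.le
  have h5 : c = 1 := by nlinarith
  refine Units.ext ?_
  rw [e, h5, one_smul]

end IsSO31

/-! ### Lifting the holonomy to `SO⁰(3, 1)`, and finiteness of its bounded subsets. -/

section Lift

variable {Γ : Type} [Group Γ] {ρ : Γ →* PGL4}

lemma exists_lift_SO31 (h : ∀ γ, ρ γ ∈ PSO31) :
    ∃ τ : Γ →* GL (Fin 4) ℝ, (∀ γ, toPGL (τ γ) = ρ γ) ∧ ∀ γ, IsSO31 (τ γ) := by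
  choose f hf hf' using h
  refine ⟨⟨⟨f, ?_⟩, fun γ δ => ?_⟩, hf', hf⟩
  · refine (hf 1).eq_of_toPGL_eq IsSO31.one ?_
    rw [hf', map_one, map_one]
  · refine (hf _).eq_of_toPGL_eq ((hf γ).mul (hf δ)) ?_
    rw [hf', map_mul, map_mul, hf', hf']

lemma exists_matrix_subseq_tendsto {C : ℝ} (f : ℕ → Mat4) (h : ∀ n i j, |f n i j| ≤ C) :
    ∃ (A : Mat4) (s : ℕ → ℕ), StrictMono s ∧ ∀ i j,
      Tendsto (fun n => f (s n) i j) atTop (𝓝 (A i j)) := by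
  have hK : IsCompact (Set.univ.pi fun _ : Fin 4 => Set.univ.pi fun _ : Fin 4 => Set.Icc (-C) C) :=
    isCompact_univ_pi fun _ => isCompact_univ_pi fun _ => isCompact_Icc
  obtain ⟨A, -, s, hs, hA⟩ := hK.tendsto_subseq (x := fun n i j => f n i j)
    fun n i _ j _ => abs_le.1 (h n i j)
  refine ⟨A, s, hs, fun i j => ?_⟩
  exact tendsto_pi_nhds.1 (tendsto_pi_nhds.1 hA i) j

lemma tendsto_matrix {f : ℕ → Mat4} {A : Mat4}
    (h : ∀ i j, Tendsto (fun n => f n i j) atTop (𝓝 (A i j))) : Tendsto f atTop (𝓝 A) :=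
  tendsto_pi_nhds.2 fun i => tendsto_pi_nhds.2 fun j => h i j

/-- Infinitely many elements with bounded matrices would contain a convergent sequence of distinct
ones. Its limit is again Lorentz, hence invertible, so quotients of consecutive terms tend to `1`;
discreteness makes them equal to `1` eventually, a contradiction. -/
lemma finite_setOf_abs_le (hρ : Function.Injective ρ) (hd : DiscreteTopology ρ.range)
    {τ : Γ →* GL (Fin 4) ℝ} (hτ : ∀ γ, toPGL (τ γ) = ρ γ) (hτ' : ∀ γ, IsSO31 (τ γ)) (C : ℝ) :
    {γ | ∀ i j, |(τ γ).1 i j| ≤ C}.Finite := by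
  by_contra hinf
  let e := Set.Infinite.natEmbedding _ hinf
  obtain ⟨A, s, hs, hA⟩ := exists_matrix_subseq_tendsto (fun n => (τ (e n).1).1) fun n => (e n).2
  have hA := tendsto_matrix hA
  have hA1 : Tendsto (fun n => (τ (e (s (n + 1))).1).1) atTop (𝓝 A) :=
    hA.comp (tendsto_add_atTop_nat 1)
  have hform : A.transpose * lorentz * A = lorentz := by
    have hc : Continuous fun B : Mat4 => B.transpose * lorentz * B := by fun_prop
    refine tendsto_nhds_unique ((hc.tendsto A).comp hA) ?_
    refine tendsto_const_nhds.congr fun n => ?_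
    exact (hτ' _).form.symm
  have hc : Continuous fun B : Mat4 × Mat4 => lorentz * B.1.transpose * lorentz * B.2 := by fun_prop
  have hlim : lorentz * A.transpose * lorentz * A = 1 := by
    rw [mul_assoc, mul_assoc, ← mul_assoc A.transpose, hform, lorentz_mul_self]
  set γ : ℕ → Γ := fun n => (e (s n)).1⁻¹ * (e (s (n + 1))).1 with hγ
  have ht : Tendsto (fun n => τ (γ n)) atTop (𝓝 1) := by
    rw [Units.isEmbedding_embedProduct.tendsto_nhds_iff]
    refine Tendsto.prodMk_nhds ?_ ((MulOpposite.continuous_op.tendsto _).comp ?_)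
    · have := (hc.tendsto (A, A)).comp (hA.prodMk_nhds hA1)
      rw [hlim] at this
      refine this.congr fun n => ?_
      simp only [Function.comp, hγ, map_mul, map_inv, Units.val_mul, (hτ' _).coe_inv]
    · have := (hc.tendsto (A, A)).comp (hA1.prodMk_nhds hA)
      rw [hlim] at this
      refine this.congr fun n => ?_
      simp only [Function.comp, hγ, map_mul, map_inv, Units.val_mul, mul_inv_rev, inv_inv,
        (hτ' _).coe_inv]
  have ht2 : Tendsto (fun n => ρ (γ n)) atTop (𝓝 1) := by
    have := (continuous_toPGL.tendsto 1).comp ht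
    rw [map_one] at this
    exact this.congr fun n => hτ _
  have ht3 : Tendsto (fun n => (⟨ρ (γ n), γ n, rfl⟩ : ρ.range)) atTop (𝓝 1) :=
    tendsto_subtype_rng.2 ht2
  rw [nhds_discrete, tendsto_pure] at ht3
  obtain ⟨n, hn⟩ := ht3.exists
  have h1 : γ n = 1 := hρ (by rw [map_one]; exact congrArg Subtype.val hn)
  rw [hγ, inv_mul_eq_one] at h1
  have := hs.injective (e.injective (Subtype.ext h1))
  omega

end Lift

/-! ### Null vectors -/

/-- The Lorentzian form. -/
def lorentzForm (u v : Fin 4 → ℝ) : ℝ := u 0 * v 0 + u 1 * v 1 + u 2 * v 2 - u 3 * v 3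

/-- In signature `(3, 1)` a totally isotropic subspace is at most a line. Concretely, the squared
Euclidean length of `u 3 • v - v 3 • u` is a combination of the three values of the form. -/
lemma null_collinear {u v : Fin 4 → ℝ} (hu : lorentzForm u u = 0) (hv : lorentzForm v v = 0)
    (huv : lorentzForm u v = 0) : u 3 • v = v 3 • u := by
  simp only [lorentzForm] at *
  have h : (u 3 * v 0 - v 3 * u 0) ^ 2 + (u 3 * v 1 - v 3 * u 1) ^ 2 +
      (u 3 * v 2 - v 3 * u 2) ^ 2 = 0 := by
    linear_combination (u 3) ^ 2 * hv + (v 3) ^ 2 * hu - 2 * u 3 * v 3 * huv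
  have h0 : u 3 * v 0 - v 3 * u 0 = 0 := by nlinarith [sq_nonneg (u 3 * v 0 - v 3 * u 0), sq_nonneg (u 3 * v 1 - v 3 * u 1), sq_nonneg (u 3 * v 2 - v 3 * u 2)]
  have h1 : u 3 * v 1 - v 3 * u 1 = 0 := by nlinarith [sq_nonneg (u 3 * v 0 - v 3 * u 0), sq_nonneg (u 3 * v 1 - v 3 * u 1), sq_nonneg (u 3 * v 2 - v 3 * u 2)]
  have h2 : u 3 * v 2 - v 3 * u 2 = 0 := by nlinarith [sq_nonneg (u 3 * v 0 - v 3 * u 0), sq_nonneg (u 3 * v 1 - v 3 * u 1), sq_nonneg (u 3 * v 2 - v 3 * u 2)]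
  ext i
  fin_cases i <;> simp <;> linarith

lemma null_last_ne_zero {u : Fin 4 → ℝ} (hu : lorentzForm u u = 0) (h : u ≠ 0) : u 3 ≠ 0 := by
  intro h3
  simp only [lorentzForm, h3] at hu
  refine h (funext fun i => ?_)
  have h0 : u 0 = 0 := by nlinarith [sq_nonneg (u 0), sq_nonneg (u 1), sq_nonneg (u 2)]
  have h1 : u 1 = 0 := by nlinarith [sq_nonneg (u 0), sq_nonneg (u 1), sq_nonneg (u 2)]
  have h2 : u 2 = 0 := by nlinarith [sq_nonneg (u 0), sq_nonneg (u 1), sq_nonneg (u 2)]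
  fin_cases i <;> assumption

lemma abs_apply_le_norm (A : Mat4) (i j : Fin 4) : |A i j| ≤ ‖A‖ :=
  Matrix.norm_entry_le_entrywise_sup_norm A

/-- An unbounded family of Lorentz matrices has a null vector which is an eigenvector of all
matrices commuting with the family. -/
lemma exists_null_eigenvector {S : Set Mat4}
    (hS : ∀ C : ℝ, ∃ A ∈ S, ∃ i j, C < |A i j|)
    (hform : ∀ A ∈ S, A.transpose * lorentz * A = lorentz) :
    ∃ u : Fin 4 → ℝ, u 3 = 1 ∧ lorentzForm u u = 0 ∧
      ∀ B : Mat4, B.transpose * lorentz * B = lorentz → (∀ A ∈ S, A * B = B * A) →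
        ∃ t : ℝ, B.mulVec u = t • u := by
  choose f hf i j hij using fun n : ℕ => hS n
  have hpos : ∀ n, 0 < ‖f n‖ := fun n =>
    ((Nat.cast_nonneg n).trans_lt (hij n)).trans_le (abs_apply_le_norm _ _ _)
  have hbig : Tendsto (fun n => ‖f n‖⁻¹) atTop (𝓝 0) := by
    refine tendsto_inv_atTop_zero.comp (tendsto_atTop_mono (fun n => ?_) tendsto_natCast_atTop_atTop)
    exact (hij n).le.trans (abs_apply_le_norm _ _ _)
  -- `L` is a limit of the matrices rescaled to norm one. Dividing the form relation by the square
  -- of the norm leaves `Lᵀ J L = 0`, so the image of `L` is a null line, and whatever commutes with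
  -- the family commutes with `L` and preserves that line.
  obtain ⟨L, s, hs, hL⟩ := exists_matrix_subseq_tendsto (C := 1) (fun n => ‖f n‖⁻¹ • f n)
    fun n i j => by
      rw [Matrix.smul_apply, smul_eq_mul, abs_mul, abs_of_pos (inv_pos.2 (hpos n)),
        inv_mul_le_one₀ (hpos n)]
      exact abs_apply_le_norm _ _ _
  have hL := tendsto_matrix hL
  have hL0 : L ≠ 0 := by
    rintro rfl
    have h1 : Tendsto (fun n => ‖‖f (s n)‖⁻¹ • f (s n)‖) atTop (𝓝 ‖(0 : Mat4)‖) :=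
      (continuous_norm.tendsto (0 : Mat4)).comp hL
    have h2 : ∀ n, ‖‖f (s n)‖⁻¹ • f (s n)‖ = 1 := fun n => by
      rw [norm_smul, norm_inv, norm_norm, inv_mul_cancel₀ (hpos _).ne']
    simp only [h2, norm_zero] at h1
    exact one_ne_zero (tendsto_nhds_unique tendsto_const_nhds h1)
  have hLform : L.transpose * lorentz * L = 0 := by
    have hc : Continuous fun B : Mat4 => B.transpose * lorentz * B := by fun_prop
    refine tendsto_nhds_unique ((hc.tendsto L).comp hL) ?_
    have h1 : Tendsto (fun n => (‖f (s n)‖⁻¹ * ‖f (s n)‖⁻¹) • lorentz) atTop (𝓝 0) := by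
      have h2 := hbig.comp hs.tendsto_atTop
      have h3 := (h2.mul h2).smul_const lorentz
      rw [mul_zero, zero_smul] at h3
      exact h3
    refine h1.congr fun n => ?_
    simp only [Function.comp, Matrix.transpose_smul, Matrix.smul_mul, Matrix.mul_smul,
      hform _ (hf _), smul_smul]
  have hcomm : ∀ B : Mat4, (∀ A ∈ S, A * B = B * A) → L * B = B * L := by
    intro B hB
    have hc : Continuous fun A : Mat4 => A * B - B * A := by fun_prop
    rw [← sub_eq_zero]
    refine tendsto_nhds_unique ((hc.tendsto L).comp hL) ?_
    refine tendsto_const_nhds.congr fun n => ?_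
    simp only [Function.comp, Matrix.smul_mul, Matrix.mul_smul, hB _ (hf _), sub_self]
  have hq : ∀ v w : Fin 4 → ℝ, lorentzForm (L.mulVec v) (L.mulVec w) = 0 := by
    intro v w
    have h1 : ∀ A : Mat4, lorentzForm (A.mulVec v) (A.mulVec w) =
        v ⬝ᵥ (A.transpose * lorentz * A).mulVec w := by
      intro A
      rw [← Matrix.mulVec_mulVec, ← Matrix.mulVec_mulVec, Matrix.dotProduct_mulVec,
        Matrix.vecMul_transpose]
      simp [lorentzForm, lorentz, dotProduct, Fin.sum_univ_four, Matrix.mulVec_diagonal]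
      ring
    rw [h1, hLform, Matrix.zero_mulVec, dotProduct_zero]
  obtain ⟨w, hw⟩ : ∃ w, L.mulVec w ≠ 0 := by
    by_contra! h
    exact hL0 (Matrix.ext_of_mulVec_single fun i => by rw [h, Matrix.zero_mulVec])
  have h3 := null_last_ne_zero (hq w w) hw
  refine ⟨((L.mulVec w) 3)⁻¹ • L.mulVec w, by simp [h3], ?_, fun B hB hS' => ?_⟩
  · rw [← Matrix.mulVec_smul]
    exact hq _ _
  · have h4 : B.mulVec (L.mulVec w) = L.mulVec (B.mulVec w) := by
      rw [Matrix.mulVec_mulVec, Matrix.mulVec_mulVec, hcomm B hS']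
    have h5 := null_collinear (hq w w) (hq (B.mulVec w) (B.mulVec w)) (hq w (B.mulVec w))
    refine ⟨((L.mulVec w) 3)⁻¹ * (L.mulVec (B.mulVec w)) 3, ?_⟩
    rw [Matrix.mulVec_smul, h4, mul_smul, smul_comm _ _ (L.mulVec w), ← h5, smul_smul, smul_smul,
      inv_mul_cancel_right₀ h3]

/-! ### The stabilizer of a null line -/

/-- The Gram matrix of a basis `u, e₁, e₂, f` with `u, f` null and `⟨u, f⟩ = 1`. -/
def nullGram : Mat4 := !![0, 0, 0, 1; 0, 1, 0, 0; 0, 0, 1, 0; 1, 0, 0, 0]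

lemma nullGram_mul_self : nullGram * nullGram = 1 := by
  ext i j
  fin_cases i <;> fin_cases j <;> simp [nullGram, Matrix.mul_apply, Fin.sum_univ_four]

lemma exists_null_basis {u : Fin 4 → ℝ} (h3 : u 3 = 1) (hu : lorentzForm u u = 0) :
    ∃ P Q : Mat4, P * Q = 1 ∧ Q * P = 1 ∧ P.transpose * lorentz * P = nullGram ∧
      P.mulVec (Pi.single 0 1) = u := by
  suffices h : ∃ P : Mat4, P.transpose * lorentz * P = nullGram ∧ ∀ i, P i 0 = u i by
    obtain ⟨P, hP, hu⟩ := h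
    have h1 : nullGram * P.transpose * lorentz * P = 1 := by
      rw [mul_assoc, mul_assoc, ← mul_assoc P.transpose, hP, nullGram_mul_self]
    refine ⟨P, nullGram * P.transpose * lorentz, mul_eq_one_comm.1 h1, h1, hP, ?_⟩
    rw [Matrix.mulVec_single_one]
    exact funext hu
  simp only [lorentzForm, h3] at hu
  by_cases h : u 2 = 1
  · rw [h] at hu
    have h0 : u 0 = 0 := by nlinarith [sq_nonneg (u 0), sq_nonneg (u 1)]
    have h1 : u 1 = 0 := by nlinarith [sq_nonneg (u 0), sq_nonneg (u 1)]
    refine ⟨!![0, 1, 0, 0; 0, 0, 1, 0; 1, 0, 0, 1 / 2; 1, 0, 0, -1 / 2], ?_, fun i => ?_⟩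
    · ext i j
      rw [transpose_mul_lorentz_mul_apply]
      fin_cases i <;> fin_cases j <;> simp [nullGram] <;> norm_num
    · fin_cases i <;> simp [h, h0, h1, h3]
  · have h' : 1 - u 2 ≠ 0 := sub_ne_zero.2 (Ne.symm h)
    obtain ⟨r, hr⟩ : ∃ r, r * (1 - u 2) = 1 := ⟨_, inv_mul_cancel₀ h'⟩
    set p := u 0
    set q := u 1
    set s := u 2
    have hr2 : r * (p ^ 2 + q ^ 2) = 1 + s := by linear_combination r * hu + (1 + s) * hr
    -- The reflection of `ℝ³` exchanging `(0, 0, 1)` and `(p, q, s)` takes the first two coordinate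
    -- vectors to the spatial parts of the middle columns. The last column is half of `u` with its
    -- last coordinate reversed. The reflection degenerates when `s = 1`, hence the separate case.
    refine ⟨!![p, 1 - r * p ^ 2, -(r * p * q), p / 2; q, -(r * p * q), 1 - r * q ^ 2, q / 2;
      s, p, q, s / 2; 1, 0, 0, -1 / 2], ?_, fun i => ?_⟩
    · ext i j
      rw [transpose_mul_lorentz_mul_apply]
      fin_cases i <;> fin_cases j <;> simp [nullGram] <;>
      first
      | linear_combination hu
      | linear_combination -p * hr2
      | linear_combination -q * hr2
      | linear_combination hu / 2
      | linear_combination p ^ 2 * (r * hr2 - hr)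
      | linear_combination q ^ 2 * (r * hr2 - hr)
      | linear_combination p * q * (r * hr2 - hr)
      | linear_combination -p / 2 * hr2
      | linear_combination -q / 2 * hr2
      | linear_combination hu / 4
    · fin_cases i <;> simp [p, q, s, h3]

/-- The matrices which act on the Euclidean plane `u^⊥ / u` by orientation preserving
similarities, in a basis with Gram matrix `nullGram`. -/
structure IsSim (B : Mat4) : Prop where
  pos : 0 < B 0 0
  h10 : B 1 0 = 0
  h20 : B 2 0 = 0
  h30 : B 3 0 = 0
  h31 : B 3 1 = 0
  h32 : B 3 2 = 0
  h33 : B 0 0 * B 3 3 = 1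
  h22 : B 2 2 = B 1 1
  h12 : B 1 2 = -B 2 1
  unit : B 1 1 ^ 2 + B 2 1 ^ 2 = 1
  h01 : B 0 1 = -(B 0 0 * (B 1 1 * B 1 3 + B 2 1 * B 2 3))
  h02 : B 0 2 = -(B 0 0 * (B 1 2 * B 1 3 + B 2 2 * B 2 3))
  h03 : B 0 3 = -(B 0 0 * (B 1 3 ^ 2 + B 2 3 ^ 2)) / 2

lemma transpose_mul_nullGram_mul_apply (A B : Mat4) (i j : Fin 4) :
    (A.transpose * nullGram * B) i j =
      A 0 i * B 3 j + A 1 i * B 1 j + A 2 i * B 2 j + A 3 i * B 0 j := by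
  simp [nullGram, Matrix.mul_apply, Fin.sum_univ_four]
  ring

lemma isSim_of_form {B : Mat4} (hB : B.transpose * nullGram * B = nullGram) (hdet : B.det = 1)
    (h0 : 0 < B 0 0) (h1 : B 1 0 = 0) (h2 : B 2 0 = 0) (h3 : B 3 0 = 0) : IsSim B := by
  have e : ∀ i j, B 0 i * B 3 j + B 1 i * B 1 j + B 2 i * B 2 j + B 3 i * B 0 j =
      nullGram i j := fun i j => by rw [← transpose_mul_nullGram_mul_apply, hB]
  have e01 := e 0 1
  have e02 := e 0 2
  have e03 := e 0 3
  have e11 := e 1 1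
  have e12 := e 1 2
  have e22 := e 2 2
  have e13 := e 1 3
  have e23 := e 2 3
  have e33 := e 3 3
  simp [nullGram, h1, h2, h3, h0.ne'] at e01 e02 e03 e11 e12 e13 e22 e23 e33
  rw [e01] at e11 e12 e13
  rw [e02] at e12 e22 e23
  have hd : B 1 1 * B 2 2 - B 1 2 * B 2 1 = 1 := by
    rw [Matrix.det_succ_column_zero] at hdet
    simp [Fin.sum_univ_succ, Matrix.det_fin_three, h1, h2, h3, Fin.succAbove, e01, e02] at hdet
    linear_combination hdet - (B 1 1 * B 2 2 - B 1 2 * B 2 1) * e03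
  -- The middle block is orthogonal with determinant one, and these relations combine into a
  -- vanishing sum of squares: the block is a rotation.
  have hz : (B 2 2 - B 1 1) ^ 2 + (B 1 2 + B 2 1) ^ 2 = 0 := by
    linear_combination e11 + e22 - 2 * hd
  have h22 : B 2 2 = B 1 1 := by
    nlinarith [sq_nonneg (B 2 2 - B 1 1), sq_nonneg (B 1 2 + B 2 1)]
  have h12 : B 1 2 = -B 2 1 := by
    nlinarith [sq_nonneg (B 2 2 - B 1 1), sq_nonneg (B 1 2 + B 2 1)]
  refine ⟨h0, h1, h2, h3, e01, e02, e03, h22, h12, by linear_combination e11, ?_, ?_, ?_⟩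
  · linear_combination B 0 0 * e13 - B 0 1 * e03
  · linear_combination B 0 0 * e23 - B 0 2 * e03
  · linear_combination B 0 0 / 2 * e33 - B 0 3 * e03

/-- The multiplier `a` of the similarity `z ↦ a z + x`. -/
def simRatio (B : Mat4) : ℂ := ⟨B 0 0 * B 1 1, B 0 0 * B 2 1⟩

/-- The translation part `x` of the similarity `z ↦ a z + x`. -/
def simShift (B : Mat4) : ℂ := ⟨B 0 0 * B 1 3, B 0 0 * B 2 3⟩

namespace IsSim

variable {A B : Mat4}

lemma ratio_mul (hA : IsSim A) (hB : IsSim B) :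
    simRatio (A * B) = simRatio A * simRatio B := by
  apply Complex.ext <;>
    simp [simRatio, Matrix.mul_apply, Fin.sum_univ_four, hA.h10, hA.h20, hA.h22, hA.h12, hB.h10,
      hB.h20, hB.h30, hB.h31] <;> ring

lemma shift_mul (hA : IsSim A) (hB : IsSim B) :
    simShift (A * B) = simShift A + simRatio A * simShift B := by
  apply Complex.ext
  · simp [simRatio, simShift, Matrix.mul_apply, Fin.sum_univ_four, hA.h10, hA.h20, hA.h22, hA.h12,
      hB.h10, hB.h20, hB.h30]
    linear_combination A 0 0 * A 1 3 * hB.h33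
  · simp [simRatio, simShift, Matrix.mul_apply, Fin.sum_univ_four, hA.h10, hA.h20, hA.h22, hA.h12,
      hB.h10, hB.h20, hB.h30]
    linear_combination A 0 0 * A 2 3 * hB.h33

lemma norm_ratio (hA : IsSim A) : ‖simRatio A‖ = A 0 0 := by
  rw [← sq_eq_sq₀ (norm_nonneg _) hA.pos.le, ← Complex.normSq_eq_norm_sq, Complex.normSq_apply]
  simp only [simRatio]
  linear_combination A 0 0 ^ 2 * hA.unit

lemma ratio_ne_zero (hA : IsSim A) : simRatio A ≠ 0 := by
  rw [← norm_ne_zero_iff, hA.norm_ratio]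
  exact hA.pos.ne'

lemma ext (hA : IsSim A) (hB : IsSim B) (h : simRatio A = simRatio B)
    (h' : simShift A = simShift B) : A = B := by
  have h00 : A 0 0 = B 0 0 := by rw [← hA.norm_ratio, ← hB.norm_ratio, h]
  have h11 := congrArg Complex.re h
  have h21 := congrArg Complex.im h
  have h13 := congrArg Complex.re h'
  have h23 := congrArg Complex.im h'
  simp [simRatio, simShift, h00, hB.pos.ne'] at h11 h21 h13 h23
  have h33 : A 3 3 = B 3 3 := mul_left_cancel₀ hA.pos.ne' (by rw [hA.h33, h00, hB.h33])
  ext i j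
  fin_cases i <;> fin_cases j <;>
    simp [hA.h10, hA.h20, hA.h30, hA.h31, hA.h32, hA.h22, hA.h12, hA.h01, hA.h02, hA.h03, hB.h10,
      hB.h20, hB.h30, hB.h31, hB.h32, hB.h22, hB.h12, hB.h01, hB.h02, hB.h03, h00, h11, h21, h13,
      h23, h33]

/-- Ratio, inverse ratio and shift control all entries. The exponent comes from `A 0 3`, a factor at
most `D` times squares of entries at most `D ^ 2`; the factor `2` is needed for `A 0 1` and `A 0 2`.
-/
lemma abs_apply_le (hA : IsSim A) {D : ℝ} (hD : 1 ≤ D) (h1 : A 0 0 ≤ D) (h2 : 1 ≤ D * A 0 0)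
    (h3 : ‖simShift A‖ ≤ D) (i j : Fin 4) : |A i j| ≤ 2 * D ^ 5 := by
  have hpos := hA.pos
  have h33 : A 3 3 ≤ D := by
    have h5 : A 3 3 = A 3 3 * 1 := (mul_one _).symm
    have h6 : 0 < A 3 3 := pos_of_mul_pos_right (by rw [hA.h33]; exact one_pos) hpos.le
    nlinarith [hA.h33]
  have h33' : 0 < A 3 3 := pos_of_mul_pos_right (by rw [hA.h33]; exact one_pos) hpos.le
  have D5 : D ≤ D ^ 5 := le_self_pow₀ hD (by norm_num)
  have D25 : D ^ 2 ≤ D ^ 5 := pow_le_pow_right₀ hD (by norm_num)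
  have hx : |A 0 0 * A 1 3| ≤ D := (Complex.abs_re_le_norm (simShift A)).trans h3
  have hy : |A 0 0 * A 2 3| ≤ D := (Complex.abs_im_le_norm (simShift A)).trans h3
  have b11 : |A 1 1| ≤ 1 := abs_le_one_iff_mul_self_le_one.2 (by nlinarith [hA.unit, sq_nonneg (A 2 1)])
  have b21 : |A 2 1| ≤ 1 := abs_le_one_iff_mul_self_le_one.2 (by nlinarith [hA.unit, sq_nonneg (A 1 1)])
  have key : ∀ t : ℝ, |A 0 0 * t| ≤ D → |t| ≤ D ^ 2 := by
    intro t ht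
    have : t = A 3 3 * (A 0 0 * t) := by linear_combination -t * hA.h33
    rw [this, abs_mul, abs_of_pos h33', sq]
    exact mul_le_mul h33 ht (abs_nonneg _) (by linarith)
  have b13 := key _ hx
  have b23 := key _ hy
  have prod : ∀ s t : ℝ, |s| ≤ 1 → |t| ≤ D → |s * t| ≤ D := by
    intro s t hs ht
    rw [abs_mul]
    nlinarith [abs_nonneg s, abs_nonneg t]
  have b01 : |A 0 1| ≤ 2 * D := by
    have e : A 0 1 = -(A 1 1 * (A 0 0 * A 1 3) + A 2 1 * (A 0 0 * A 2 3)) := by rw [hA.h01]; ring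
    rw [e, abs_neg]
    linarith [abs_add_le (A 1 1 * (A 0 0 * A 1 3)) (A 2 1 * (A 0 0 * A 2 3)), prod _ _ b11 hx,
      prod _ _ b21 hy]
  have b02 : |A 0 2| ≤ 2 * D := by
    have e : A 0 2 = A 2 1 * (A 0 0 * A 1 3) + -(A 1 1 * (A 0 0 * A 2 3)) := by
      rw [hA.h02, hA.h12, hA.h22]; ring
    rw [e]
    have := abs_neg (A 1 1 * (A 0 0 * A 2 3))
    linarith [abs_add_le (A 2 1 * (A 0 0 * A 1 3)) (-(A 1 1 * (A 0 0 * A 2 3))), prod _ _ b21 hx,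
      prod _ _ b11 hy]
  have b03 : |A 0 3| ≤ D ^ 5 := by
    rw [hA.h03, abs_div, abs_neg, abs_mul, abs_of_pos hpos, abs_two, div_le_iff₀ two_pos]
    have e1 : |A 1 3 ^ 2 + A 2 3 ^ 2| ≤ 2 * D ^ 4 := by
      rw [abs_of_nonneg (by positivity), ← sq_abs, ← sq_abs (A 2 3)]
      have e2 := pow_le_pow_left₀ (abs_nonneg _) b13 2
      have e3 := pow_le_pow_left₀ (abs_nonneg _) b23 2
      nlinarith
    calc A 0 0 * |A 1 3 ^ 2 + A 2 3 ^ 2| ≤ D * (2 * D ^ 4) :=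
          mul_le_mul h1 e1 (abs_nonneg _) (by linarith)
      _ = D ^ 5 * 2 := by ring
  have b00 : |A 0 0| ≤ D := by rwa [abs_of_pos hpos]
  have b33 : |A 3 3| ≤ D := by rwa [abs_of_pos h33']
  fin_cases i <;> fin_cases j <;>
    simp only [Fin.zero_eta, Fin.mk_one, Fin.reduceFinMk, hA.h10, hA.h20, hA.h30, hA.h31, hA.h32,
      hA.h22, hA.h12, abs_zero, abs_neg] <;> linarith

end IsSim

/-- A linear form with real coefficients takes small values at infinitely many integer points. -/
lemma infinite_setOf_abs_le (s t : ℝ) : {p : ℤ × ℤ | |p.1 * s + p.2 * t| ≤ |s|}.Infinite := by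
  by_cases hs : s = 0
  · refine (Set.infinite_range_of_injective (f := fun m : ℤ => ((m, 0) : ℤ × ℤ))
      fun m n h => by simpa using h).mono ?_
    rintro _ ⟨m, rfl⟩
    simp [hs]
  -- Given `n`, the first coordinate is chosen so that the value is `s` times the fractional part of
  -- `n t / s`.
  · refine (Set.infinite_range_of_injective (f := fun n : ℤ => ((-⌊n * t / s⌋, n) : ℤ × ℤ))
      fun m n h => (Prod.ext_iff.1 h).2).mono ?_
    rintro _ ⟨n, rfl⟩
    have e : ((-⌊n * t / s⌋ : ℤ) : ℝ) * s + n * t = Int.fract (n * t / s) * s := by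
      rw [Int.fract]
      push_cast
      field_simp
      ring
    rw [Set.mem_ofPred_eq, e, abs_mul, abs_of_nonneg (Int.fract_nonneg _)]
    exact mul_le_of_le_one_left (abs_nonneg _) (Int.fract_lt_one _).le

/-! ### Discrete rank two abelian groups of similarities of the plane. -/

section Parabolic

variable {Γ : Type} [Group Γ] {σ : Γ →* Mat4}

lemma simRatio_zpow_mul_zpow {c y : Γ} (h : ∀ m n : ℤ, IsSim (σ (c ^ m * y ^ n))) (m n : ℤ) :
    simRatio (σ (c ^ m * y ^ n)) = simRatio (σ c) ^ m * simRatio (σ y) ^ n := by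
  have hc : ∀ m : ℤ, IsSim (σ (c ^ m)) := fun m => by simpa using h m 0
  have hy : ∀ n : ℤ, IsSim (σ (y ^ n)) := fun n => by simpa using h 0 n
  have one : simRatio (σ 1) = 1 := by
    rw [map_one]; apply Complex.ext <;> simp [simRatio]
  have key : ∀ g : Γ, (∀ n : ℤ, IsSim (σ (g ^ n))) → ∀ n : ℤ,
      simRatio (σ (g ^ n)) = simRatio (σ g) ^ n := by
    intro g hg n
    have hg1 : IsSim (σ g) := by simpa using hg 1
    have step : ∀ n : ℤ, simRatio (σ (g ^ (n + 1))) = simRatio (σ (g ^ n)) * simRatio (σ g) := by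
      intro n
      rw [zpow_add_one, map_mul, (hg n).ratio_mul hg1]
    induction n with
    | zero => rw [zpow_zero, zpow_zero, one]
    | succ n ih => rw [step, ih, zpow_add_one₀ hg1.ratio_ne_zero]
    | pred n ih =>
      have := step (-n - 1)
      rw [sub_add_cancel, ih] at this
      rw [zpow_sub_one₀ hg1.ratio_ne_zero, this, mul_inv_cancel_right₀ hg1.ratio_ne_zero]
  rw [map_mul, (hc m).ratio_mul (hy n), key c hc, key y hy]

lemma simShift_zpow_mul_zpow {c y : Γ} (h : ∀ m n : ℤ, IsSim (σ (c ^ m * y ^ n)))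
    (hc1 : simRatio (σ c) = 1) (hy1 : simRatio (σ y) = 1) (m n : ℤ) :
    simShift (σ (c ^ m * y ^ n)) = m * simShift (σ c) + n * simShift (σ y) := by
  have hc : ∀ m : ℤ, IsSim (σ (c ^ m)) := fun m => by simpa using h m 0
  have hy : ∀ n : ℤ, IsSim (σ (y ^ n)) := fun n => by simpa using h 0 n
  have one : simShift (σ 1) = 0 := by
    rw [map_one]; apply Complex.ext <;> simp [simShift]
  have key : ∀ g : Γ, (∀ n : ℤ, IsSim (σ (g ^ n))) → simRatio (σ g) = 1 → ∀ n : ℤ,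
      simShift (σ (g ^ n)) = n * simShift (σ g) := by
    intro g hg hg1 n
    have step : ∀ n : ℤ, simShift (σ (g ^ (1 + n))) = simShift (σ g) + simShift (σ (g ^ n)) := by
      intro n
      rw [zpow_one_add, map_mul, IsSim.shift_mul (by simpa using hg 1) (hg n), hg1, one_mul]
    induction n with
    | zero => rw [zpow_zero, one]; simp
    | succ n ih => rw [add_comm, step, ih]; push_cast; ring
    | pred n ih =>
      have := step (-n - 1)
      rw [add_sub_cancel, ih] at this
      push_cast at this ⊢
      linear_combination -this
  have hcm : simRatio (σ (c ^ m)) = 1 := by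
    have := simRatio_zpow_mul_zpow h m 0
    simpa [hc1] using this
  rw [map_mul, (hc m).shift_mul (hy n), key c hc hc1, key y hy hy1, hcm, one_mul]

/-- A discrete free abelian group of rank two in the stabilizer of a null line consists of
translations, and it acts cocompactly on the plane. -/
theorem translations_of_discrete (hfin : ∀ C : ℝ, {γ | ∀ i j, |σ γ i j| ≤ C}.Finite) {c y : Γ}
    (hcomm : Commute c y) (hinj : Function.Injective fun p : ℤ × ℤ => c ^ p.1 * y ^ p.2)
    (h : ∀ m n : ℤ, IsSim (σ (c ^ m * y ^ n))) :
    simRatio (σ c) = 1 ∧ simRatio (σ y) = 1 ∧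
      (simShift (σ c)).re * (simShift (σ y)).im - (simShift (σ c)).im * (simShift (σ y)).re ≠ 0 := by
  have hcs : IsSim (σ c) := by simpa using h 1 0
  have hys : IsSim (σ y) := by simpa using h 0 1
  -- no infinite family can be bounded
  have key : ∀ (D s t : ℝ), 1 ≤ D → ¬ ∀ p : ℤ × ℤ, |p.1 * s + p.2 * t| ≤ |s| →
      ‖simRatio (σ (c ^ p.1 * y ^ p.2))‖ ≤ D ∧ 1 ≤ D * ‖simRatio (σ (c ^ p.1 * y ^ p.2))‖ ∧
        ‖simShift (σ (c ^ p.1 * y ^ p.2))‖ ≤ D := by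
    intro D s t hD hall
    refine ((infinite_setOf_abs_le s t).image hinj.injOn) ((hfin (2 * D ^ 5)).subset ?_)
    rintro _ ⟨p, hp, rfl⟩ i j
    obtain ⟨h1, h2, h3⟩ := hall p hp
    rw [(h _ _).norm_ratio] at h1 h2
    exact (h _ _).abs_apply_le hD h1 h2 h3 i j
  -- A similarity of ratio different from `1` has a unique fixed point `z`, which is then fixed by
  -- everything commuting with it. The shift is thus determined by the ratio, and infinitely many
  -- `p` keep the logarithm of the ratio's modulus within `|s|`, which `key` excludes.
  have fixed : ∀ γ, IsSim (σ γ) → (∀ m n : ℤ, Commute γ (c ^ m * y ^ n)) →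
      simRatio (σ γ) = 1 := by
    intro γ hγ hγc
    by_contra hne
    have hne' : 1 - simRatio (σ γ) ≠ 0 := sub_ne_zero.2 (Ne.symm hne)
    set z := simShift (σ γ) / (1 - simRatio (σ γ)) with hz
    have hshift : ∀ m n : ℤ, simShift (σ (c ^ m * y ^ n)) =
        (1 - simRatio (σ (c ^ m * y ^ n))) * z := by
      intro m n
      have e := congrArg (fun g => simShift (σ g)) (hγc m n).eq
      simp only [map_mul σ] at e
      rw [← map_mul σ, hγ.shift_mul (h m n), (h m n).shift_mul hγ] at e
      rw [hz, mul_div_assoc', eq_div_iff hne']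
      linear_combination -e
    set s := Real.log ‖simRatio (σ c)‖
    set t := Real.log ‖simRatio (σ y)‖
    have hE : 1 ≤ Real.exp |s| := Real.one_le_exp (abs_nonneg s)
    -- The two summands bound the modulus of the ratio and the shift `(1 - ratio) * z`.
    refine key (Real.exp |s| + (1 + Real.exp |s|) * ‖z‖) s t ?_ fun p hp => ?_
    · nlinarith [norm_nonneg z]
    have hn : ‖simRatio (σ (c ^ p.1 * y ^ p.2))‖ = Real.exp (p.1 * s + p.2 * t) := by
      rw [simRatio_zpow_mul_zpow h, norm_mul, norm_zpow, norm_zpow, Real.exp_add, mul_comm _ s,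
        mul_comm _ t, Real.exp_mul, Real.exp_mul, Real.exp_log (norm_pos_iff.2 hcs.ratio_ne_zero),
        Real.exp_log (norm_pos_iff.2 hys.ratio_ne_zero), Real.rpow_intCast, Real.rpow_intCast]
    have h1 : ‖simRatio (σ (c ^ p.1 * y ^ p.2))‖ ≤ Real.exp |s| := by
      rw [hn]
      exact Real.exp_le_exp.2 ((le_abs_self _).trans hp)
    have h2 : 1 ≤ Real.exp |s| * ‖simRatio (σ (c ^ p.1 * y ^ p.2))‖ := by
      rw [hn, ← Real.exp_add]
      exact Real.one_le_exp (by linarith [neg_abs_le ((p.1 : ℝ) * s + p.2 * t)])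
    have hz0 : 0 ≤ (1 + Real.exp |s|) * ‖z‖ := by positivity
    refine ⟨by linarith, h2.trans ?_, ?_⟩
    · exact mul_le_mul_of_nonneg_right (by linarith) (norm_nonneg _)
    · rw [hshift, norm_mul]
      have h4 : ‖1 - simRatio (σ (c ^ p.1 * y ^ p.2))‖ ≤ 1 + Real.exp |s| :=
        (norm_sub_le _ _).trans (by rw [norm_one]; linarith)
      have := mul_le_mul_of_nonneg_right h4 (norm_nonneg z)
      linarith
  have hc1 : simRatio (σ c) = 1 := fixed c hcs fun m n =>
    ((Commute.refl c).zpow_right m).mul_right (hcomm.zpow_right n)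
  have hy1 : simRatio (σ y) = 1 := fixed y hys fun m n =>
    (hcomm.symm.zpow_right m).mul_right ((Commute.refl y).zpow_right n)
  refine ⟨hc1, hy1, fun hdet => ?_⟩
  -- If the determinant vanishes, both translations are real multiples of one vector, and infinitely
  -- many integer combinations stay bounded.
  obtain ⟨w, s, t, hs, ht⟩ : ∃ (w : ℂ) (s t : ℝ), simShift (σ c) = s * w ∧ simShift (σ y) = t * w := by
    by_cases h0 : simShift (σ c) = 0
    · exact ⟨simShift (σ y), 0, 1, by simp [h0], by simp⟩
    · by_cases hre : (simShift (σ c)).re = 0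
      · have him : (simShift (σ c)).im ≠ 0 := fun him => h0 (Complex.ext hre him)
        refine ⟨simShift (σ c), 1, (simShift (σ y)).im / (simShift (σ c)).im, by simp, ?_⟩
        apply Complex.ext
        · simp; field_simp; linear_combination -hdet
        · simp; field_simp
      · refine ⟨simShift (σ c), 1, (simShift (σ y)).re / (simShift (σ c)).re, by simp, ?_⟩
        apply Complex.ext
        · simp; field_simp
        · simp; field_simp; linear_combination hdet
  refine key (1 + |s| * ‖w‖) s t (by linarith [mul_nonneg (abs_nonneg s) (norm_nonneg w)])
    fun p hp => ?_
  have hr : ‖simRatio (σ (c ^ p.1 * y ^ p.2))‖ = 1 := by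
    rw [simRatio_zpow_mul_zpow h, hc1, hy1]; simp
  have h0 : 0 ≤ |s| * ‖w‖ := by positivity
  rw [hr]
  refine ⟨by linarith, by linarith, ?_⟩
  have e : simShift (σ (c ^ p.1 * y ^ p.2)) = ((p.1 * s + p.2 * t : ℝ) : ℂ) * w := by
    rw [simShift_zpow_mul_zpow h hc1 hy1, hs, ht]
    push_cast
    ring
  rw [e, norm_mul, Complex.norm_real, Real.norm_eq_abs]
  have := mul_le_mul_of_nonneg_right hp (norm_nonneg w)
  linarith

end Parabolic

/-! ### The commutant of the fiber group -/

lemma IsSO31.conj_form {A : GL (Fin 4) ℝ} (hA : IsSO31 A) {P Q : Mat4} (hPQ : P * Q = 1)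
    (hP : P.transpose * lorentz * P = nullGram) :
    (Q * A.1 * P).transpose * nullGram * (Q * A.1 * P) = nullGram := by
  have h1 : Q.transpose * nullGram * Q = lorentz := by
    rw [← hP]
    calc Q.transpose * (P.transpose * lorentz * P) * Q
        = (P * Q).transpose * lorentz * (P * Q) := by
          rw [Matrix.transpose_mul]; simp only [mul_assoc]
      _ = lorentz := by rw [hPQ]; simp
  calc (Q * A.1 * P).transpose * nullGram * (Q * A.1 * P)
      = P.transpose * (A.1.transpose * (Q.transpose * nullGram * Q) * A.1) * P := by
        rw [Matrix.transpose_mul, Matrix.transpose_mul]; simp only [mul_assoc]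
    _ = nullGram := by rw [h1, hA.form, hP]

lemma isSim_of_eigenvector {A : GL (Fin 4) ℝ} (hA : IsSO31 A) {u : Fin 4 → ℝ} (h3 : u 3 = 1)
    (hu : lorentzForm u u = 0) {P Q : Mat4} (hPQ : P * Q = 1) (hQP : Q * P = 1)
    (hP : P.transpose * lorentz * P = nullGram) (hPu : P.mulVec (Pi.single 0 1) = u) {t : ℝ}
    (ht : A.1.mulVec u = t • u) : IsSim (Q * A.1 * P) := by
  have e : (Q * A.1 * P).mulVec (Pi.single 0 1) = t • Pi.single 0 1 := by
    rw [← Matrix.mulVec_mulVec, hPu, ← Matrix.mulVec_mulVec, ht, Matrix.mulVec_smul, ← hPu,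
      Matrix.mulVec_mulVec, hQP, Matrix.one_mulVec]
  have e' : ∀ i, (Q * A.1 * P) i 0 = t * Pi.single (M := fun _ => ℝ) 0 1 i := by
    intro i
    have := congrFun e i
    rwa [Matrix.mulVec_single_one, Pi.smul_apply, smul_eq_mul] at this
  -- As `u 3 = 1`, the eigenvalue is the last coordinate of the image of a forward null vector.
  have tpos : 0 < t := by
    have h1 := congrFun ht 3
    rw [Pi.smul_apply, h3, smul_eq_mul, mul_one] at h1
    rw [← h1]
    simp only [lorentzForm] at hu
    have := hA.last_row_pos (x := u 0) (y := u 1) (z := u 2) (t := u 3) (by rw [h3]; exact one_pos)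
      (by nlinarith)
    simpa [Matrix.mulVec, dotProduct, Fin.sum_univ_four] using this
  refine isSim_of_form (hA.conj_form hPQ hP) ?_ ?_ ?_ ?_ ?_
  · rw [Matrix.det_mul, Matrix.det_mul, hA.det, mul_one, ← Matrix.det_mul, hQP, Matrix.det_one]
  · rw [e']; simpa using tpos
  · rw [e']; simp
  · rw [e']; simp
  · rw [e']; simp

/-- If `A` commutes with a nontrivial translation, then the null direction is an eigenvector of
both `A` and its transpose, with the same eigenvalue. -/
lemma IsSim.of_commute_translation {M A : Mat4} (hM : IsSim M) (h1 : simRatio M = 1)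
    (h0 : simShift M ≠ 0) (hA : A * M = M * A) :
    A 1 0 = 0 ∧ A 2 0 = 0 ∧ A 3 0 = 0 ∧ A 3 1 = 0 ∧ A 3 2 = 0 ∧ A 3 3 = A 0 0 := by
  have h00 : M 0 0 = 1 := by rw [← hM.norm_ratio, h1, norm_one]
  have h11 := congrArg Complex.re h1
  have h21 := congrArg Complex.im h1
  simp [simRatio, h00] at h11 h21
  have h33 := hM.h33
  rw [h00, one_mul] at h33
  set q := M 1 3 ^ 2 + M 2 3 ^ 2 with hq
  have hq0 : q ≠ 0 := by
    intro h
    refine h0 (Complex.ext ?_ ?_)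
    · simp only [simShift, h00, one_mul, Complex.zero_re]; nlinarith [sq_nonneg (M 1 3), sq_nonneg (M 2 3)]
    · simp only [simShift, h00, one_mul, Complex.zero_im]; nlinarith [sq_nonneg (M 1 3), sq_nonneg (M 2 3)]
  -- This square is a nonzero multiple of the elementary matrix at `(0, 3)`. Commuting with that
  -- matrix kills column `0` and row `3` off the diagonal and identifies their diagonal entries.
  have hN : (M - 1) * (M - 1) = Matrix.single 0 3 (-q) := by
    ext i j
    fin_cases i <;> fin_cases j <;>
      simp [Matrix.mul_apply, Fin.sum_univ_four, Matrix.single, hM.h10, hM.h20, hM.h30, hM.h31,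
        hM.h32, hM.h22, hM.h12, hM.h01, hM.h02, h00, h11, h21, h33]
    rw [hq]; ring
  have hc : A * Matrix.single 0 3 (-q) = Matrix.single 0 3 (-q) * A := by
    rw [← hN]
    have e : A * (M - 1) = (M - 1) * A := by rw [mul_sub, sub_mul, hA, mul_one, one_mul]
    rw [← mul_assoc, e, mul_assoc, e, mul_assoc]
  have e : ∀ i j, (A * Matrix.single 0 3 (-q) : Mat4) i j = (Matrix.single 0 3 (-q) * A : Mat4) i j :=
    fun i j => by rw [hc]
  have e13 := e 1 3
  have e23 := e 2 3
  have e33 := e 3 3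
  have e00 := e 0 0
  have e01 := e 0 1
  have e02 := e 0 2
  have e03 := e 0 3
  simp [Matrix.mul_apply, Matrix.single, hq0] at e13 e23 e33 e00 e01 e02 e03
  refine ⟨e13, e23, ‹_›, e01, e02, ?_⟩
  exact mul_left_cancel₀ hq0 (by linear_combination -e03)

section Bundle

variable {φ : MulAut F2}

/-- Conjugation by `x` carries the boundary loop to its image under `φ`, and `d` carries it back. So
`d x` is the second generator of the peripheral subgroup. -/
lemma exists_commute_boundaryLoop (hφ : IsConj (φ boundaryLoop) boundaryLoop) :
    ∃ d : F2, Commute (SemidirectProduct.inl boundaryLoop : BundleGroup φ)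
      (SemidirectProduct.inl d * stableLetter φ) := by
  obtain ⟨d, hd⟩ := isConj_iff.1 hφ
  refine ⟨d, ?_⟩
  have h := stableLetter_conj φ boundaryLoop
  rw [mul_inv_eq_iff_eq_mul] at h
  rw [mul_inv_eq_iff_eq_mul] at hd
  rw [commute_iff_eq, mul_assoc, h, ← mul_assoc, ← mul_assoc, ← map_mul, ← map_mul, hd]

/-- The projection to `ℤ` recovers the second exponent, and torsion-freeness of the free group
recovers the first. -/
lemma injective_zpow_mul_zpow (d : F2) :
    Function.Injective fun p : ℤ × ℤ => (SemidirectProduct.inl boundaryLoop : BundleGroup φ) ^ p.1 *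
      (SemidirectProduct.inl d * stableLetter φ) ^ p.2 := by
  have hb : boundaryLoop ≠ 1 := by decide
  rintro ⟨m, n⟩ ⟨m', n'⟩ h
  have h2 := congrArg SemidirectProduct.rightHom h
  simp only [map_mul, map_zpow, SemidirectProduct.rightHom_inl, stableLetter,
    SemidirectProduct.rightHom_inr, one_zpow, one_mul] at h2
  have hn : n = n' := by
    have := congrArg Multiplicative.toAdd h2
    simpa using this
  subst hn
  have h3 := mul_right_cancel h
  rw [← map_zpow, ← map_zpow] at h3
  have h4 := SemidirectProduct.inl_injective h3
  have hm : m = m' := injective_zpow_iff_not_isOfFinOrder.2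
    (fun ho => hb ((isOfFinOrder_iff_eq_one _).1 ho)) h4
  rw [hm]

/-- A free group of rank two has no faithful representation by similarities of the plane. -/
lemma not_forall_isSim {σ : F2 →* Mat4} (hσ : Function.Injective σ) : ¬ ∀ w, IsSim (σ w) := by
  intro h
  let a : F2 := FreeGroup.of 0
  let b : F2 := FreeGroup.of 1
  have hr : ∀ v w : F2, simRatio (σ (v * w)) = simRatio (σ v) * simRatio (σ w) := fun v w => by
    rw [map_mul, (h v).ratio_mul (h w)]
  -- Commutators of similarities are translations, and translations commute. But `[a, b]` and `[a²,
  -- b]` do not commute in the free group.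
  have hcomm : ∀ v w : F2, simRatio (σ (v * w * v⁻¹ * w⁻¹)) = 1 := by
    intro v w
    have h1 : v * w * v⁻¹ * w⁻¹ * (w * v) = v * w := by group
    have h2 := congrArg (fun g => simRatio (σ g)) h1
    simp only [hr (v * w * v⁻¹ * w⁻¹)] at h2
    refine mul_right_cancel₀ (h (w * v)).ratio_ne_zero ?_
    rw [h2, one_mul, hr, hr, mul_comm]
  have key : ∀ p q : F2, simRatio (σ p) = 1 → simRatio (σ q) = 1 → p * q = q * p := by
    intro p q hp hq
    refine hσ ((h _).ext (h _) ?_ ?_)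
    · rw [hr, hr, mul_comm]
    · rw [map_mul, map_mul, (h p).shift_mul (h q), (h q).shift_mul (h p), hp, hq]
      ring
  have := key _ _ (hcomm a b) (hcomm (a * a) b)
  revert this
  decide

/-- The centralizer, up to sign, of the holonomy of the fiber of a once-punctured torus bundle
consists of the scalar matrices. -/
theorem exists_eq_smul_one_of_commute (hφ : IsConj (φ boundaryLoop) boundaryLoop)
    {ρ : BundleGroup φ →* PGL4} (hρ : IsHolonomy φ ρ) {R : Fin 2 → GL (Fin 4) ℝ}
    (hR : ∀ i, toPGL (R i) = ρ (SemidirectProduct.inl (FreeGroup.of i))) {g : Mat4} {ε : Fin 2 → ℝ}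
    (hε : ∀ i, ε i ≠ 0) (hg : ∀ i, g * (R i).1 = ε i • ((R i).1 * g)) : ∃ t : ℝ, g = t • 1 := by
  obtain ⟨τ, hτ, hτ'⟩ := exists_lift_SO31 hρ.mem_PSO31
  have hfin := finite_setOf_abs_le hρ.faithful hρ.discrete hτ hτ'
  have hτinj : Function.Injective τ := fun γ δ h => hρ.faithful (by rw [← hτ, ← hτ, h])
  obtain ⟨d, hcomm⟩ := exists_commute_boundaryLoop hφ
  set c : BundleGroup φ := SemidirectProduct.inl boundaryLoop with hc
  set y : BundleGroup φ := SemidirectProduct.inl d * stableLetter φ with hy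
  have hinj := injective_zpow_mul_zpow (φ := φ) d
  rw [← hc, ← hy] at hinj
  -- a common null eigenvector of `c` and `y`
  obtain ⟨u, h3, hu, hB⟩ := exists_null_eigenvector
    (S := Set.range fun n : ℤ => (τ (y ^ n)).1) (by
      by_contra! hcon
      obtain ⟨C, hC⟩ := hcon
      refine Set.infinite_range_of_injective (f := fun n : ℤ => y ^ n) (fun m n hmn => ?_)
        ((hfin C).subset ?_)
      · have := @hinj (0, m) (0, n) (by simpa using hmn)
        simpa using this
      · rintro _ ⟨n, rfl⟩
        exact hC _ ⟨n, rfl⟩) (by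
      rintro _ ⟨n, rfl⟩
      exact (hτ' _).form)
  obtain ⟨P, Q, hPQ, hQP, hP, hPu⟩ := exists_null_basis h3 hu
  have hstab : ∀ γ : BundleGroup φ, Commute γ y → ∃ t : ℝ, (τ γ).1.mulVec u = t • u := by
    intro γ hγ
    refine hB _ (hτ' γ).form ?_
    rintro _ ⟨n, rfl⟩
    change (τ (y ^ n)).1 * (τ γ).1 = (τ γ).1 * (τ (y ^ n)).1
    rw [← Units.val_mul, ← Units.val_mul, ← map_mul, ← map_mul, (hγ.symm.zpow_left n).eq]
  -- the conjugated representation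
  let σ : BundleGroup φ →* Mat4 :=
    { toFun := fun γ => Q * (τ γ).1 * P
      map_one' := by simp [hQP]
      map_mul' := fun γ δ => by
        calc Q * (τ (γ * δ)).1 * P = Q * (τ γ).1 * 1 * (τ δ).1 * P := by
              rw [map_mul, Units.val_mul]; simp only [mul_assoc, one_mul]
          _ = Q * (τ γ).1 * P * (Q * (τ δ).1 * P) := by rw [← hPQ]; simp only [mul_assoc] }
  have hσ : ∀ γ, σ γ = Q * (τ γ).1 * P := fun _ => rfl
  have hτσ : ∀ γ, (τ γ).1 = P * σ γ * Q := fun γ => by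
    calc (τ γ).1 = P * Q * (τ γ).1 * (P * Q) := by rw [hPQ, one_mul, mul_one]
      _ = _ := by rw [hσ]; simp only [mul_assoc]
  have hσinj : Function.Injective σ := fun γ δ h =>
    hτinj (Units.ext (by rw [hτσ, hτσ, h]))
  have hσfin : ∀ C : ℝ, {γ | ∀ i j, |σ γ i j| ≤ C}.Finite := by
    intro C
    refine (hfin (16 * (‖P‖ * C * ‖Q‖))).subset fun γ hγ i j => ?_
    rw [hτσ, Matrix.mul_apply]
    -- The factor `16` counts the terms of the double sum expressing an entry of `P * σ γ * Q`.
    have hterm : ∀ k l, |P i k * σ γ k l * Q l j| ≤ ‖P‖ * C * ‖Q‖ := by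
      intro k l
      have hC : 0 ≤ C := (abs_nonneg _).trans (hγ k l)
      rw [abs_mul, abs_mul]
      exact mul_le_mul (mul_le_mul (abs_apply_le_norm _ _ _) (hγ k l) (abs_nonneg _)
        (norm_nonneg _)) (abs_apply_le_norm _ _ _) (abs_nonneg _)
        (mul_nonneg (norm_nonneg _) hC)
    calc |∑ l, (P * σ γ) i l * Q l j| = |∑ l, ∑ k, P i k * σ γ k l * Q l j| := by
          simp only [Matrix.mul_apply, Finset.sum_mul]
      _ ≤ ∑ l, ∑ k, |P i k * σ γ k l * Q l j| :=
          (Finset.abs_sum_le_sum_abs _ _).trans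
            (Finset.sum_le_sum fun l _ => Finset.abs_sum_le_sum_abs _ _)
      _ ≤ ∑ l : Fin 4, ∑ k : Fin 4, ‖P‖ * C * ‖Q‖ :=
          Finset.sum_le_sum fun l _ => Finset.sum_le_sum fun k _ => hterm k l
      _ = 16 * (‖P‖ * C * ‖Q‖) := by simp; ring
  have hsim : ∀ γ, (∃ t : ℝ, (τ γ).1.mulVec u = t • u) → IsSim (σ γ) := by
    rintro γ ⟨t, ht⟩
    exact isSim_of_eigenvector (hτ' γ) h3 hu hPQ hQP hP hPu ht
  obtain ⟨hc1, hy1, hdet⟩ := translations_of_discrete hσfin hcomm hinj fun m n =>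
    hsim _ (hstab _ ((hcomm.zpow_left m).mul_left ((Commute.refl y).zpow_left n)))
  have hcs : IsSim (σ c) := hsim _ (hstab _ hcomm)
  have hys : IsSim (σ y) := hsim _ (hstab _ (Commute.refl y))
  have hc0 : simShift (σ c) ≠ 0 := by
    intro h0
    rw [h0] at hdet
    simp at hdet
  -- the fiber does not fix the null line
  obtain ⟨w, hw⟩ : ∃ w : F2, ¬ ∃ t : ℝ, (τ (SemidirectProduct.inl w)).1.mulVec u = t • u := by
    by_contra! hcon
    exact not_forall_isSim (σ := σ.comp SemidirectProduct.inl)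
      (hσinj.comp SemidirectProduct.inl_injective) fun w => hsim _ (hcon w)
  set n : Fin 4 → ℝ := fun i => σ (SemidirectProduct.inl w) i 0 with hn
  -- The vector `n` is null, being the image of the fixed null direction; if `n 3 = 0` it would be
  -- proportional to it, against the choice of `w`.
  have hn3 : n 3 ≠ 0 := by
    intro h0
    have h1 := congrFun (congrFun ((hτ' (SemidirectProduct.inl w)).conj_form hPQ hP) 0) 0
    rw [transpose_mul_nullGram_mul_apply] at h1
    change n 0 * n 3 + n 1 * n 1 + n 2 * n 2 + n 3 * n 0 = 0 at h1
    rw [h0] at h1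
    have h11 : n 1 = 0 := by nlinarith [sq_nonneg (n 1), sq_nonneg (n 2)]
    have h12 : n 2 = 0 := by nlinarith [sq_nonneg (n 1), sq_nonneg (n 2)]
    refine hw ⟨n 0, ?_⟩
    have h2 : (σ (SemidirectProduct.inl w)).mulVec (Pi.single 0 1) = n 0 • Pi.single 0 1 := by
      rw [Matrix.mulVec_single_one]
      funext i
      change n i = _
      fin_cases i <;> simp [h0, h11, h12]
    have h4 : Q.mulVec u = Pi.single 0 1 := by
      rw [← hPu, Matrix.mulVec_mulVec, hQP, Matrix.one_mulVec]
    rw [hτσ, ← Matrix.mulVec_mulVec, ← Matrix.mulVec_mulVec, h4, h2, Matrix.mulVec_smul, hPu]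
  -- the given matrix commutes with the conjugates of the boundary loop
  have hgτ : ∀ i, g * (τ (SemidirectProduct.inl (FreeGroup.of i))).1 =
      ε i • ((τ (SemidirectProduct.inl (FreeGroup.of i))).1 * g) := by
    intro i
    obtain ⟨k, -, hk⟩ := exists_smul_of_toPGL_eq ((hτ _).trans (hR i).symm)
    rw [hk, Matrix.mul_smul, hg, Matrix.smul_mul, smul_comm]
  -- The factors `ε` extend to a character, which is trivial on commutators. Conjugates of the
  -- boundary loop therefore commute with `g` exactly.
  let E : F2 →* ℝˣ := FreeGroup.lift fun i => Units.mk0 (ε i) (hε i)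
  have hgE : ∀ v : F2, g * (τ (SemidirectProduct.inl v)).1 =
      (E v : ℝ) • ((τ (SemidirectProduct.inl v)).1 * g) := by
    intro v
    induction v using FreeGroup.induction_on with
    | C1 => simp
    | of i => rw [hgτ]; simp [E]
    | inv_of i ih =>
      set A := τ (SemidirectProduct.inl (FreeGroup.of i)) with hA
      have e1 : (A⁻¹).1 * (g * A.1) * (A⁻¹).1 = (E (FreeGroup.of i) : ℝ) • (g * (A⁻¹).1) := by
        rw [ih, Matrix.mul_smul, Matrix.smul_mul, ← mul_assoc, ← Units.val_mul, inv_mul_cancel,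
          Units.val_one, one_mul]
      have e2 : (A⁻¹).1 * (g * A.1) * (A⁻¹).1 = (A⁻¹).1 * g := by
        rw [mul_assoc, mul_assoc, ← Units.val_mul, mul_inv_cancel, Units.val_one, mul_one]
      rw [map_inv, map_inv, map_inv, ← hA, ← e2, e1, smul_smul, ← Units.val_mul, inv_mul_cancel,
        Units.val_one, one_smul]
    | mul v w hv hw =>
      rw [map_mul, map_mul, map_mul, Units.val_mul, ← mul_assoc, hv, Matrix.smul_mul, mul_assoc,
        hw, Matrix.mul_smul, smul_smul, Units.val_mul, mul_assoc]
  have hgc : ∀ v : F2, g * (τ (SemidirectProduct.inl (v * boundaryLoop * v⁻¹))).1 =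
      (τ (SemidirectProduct.inl (v * boundaryLoop * v⁻¹))).1 * g := by
    intro v
    have hE : E (v * boundaryLoop * v⁻¹) = 1 := by
      simp only [boundaryLoop, map_mul, map_inv]
      rw [mul_inv_eq_one]
      rw [mul_inv_eq_iff_eq_mul.2 (mul_inv_eq_iff_eq_mul.2 ?_), mul_one]
      rw [one_mul, mul_comm]
    rw [hgE, hE, Units.val_one, one_smul]
  set G := Q * g * P with hG
  have hgG : g = P * G * Q := by
    calc g = P * Q * g * (P * Q) := by rw [hPQ, one_mul, mul_one]
      _ = _ := by rw [hG]; simp only [mul_assoc]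
  have hGγ : ∀ (γ : BundleGroup φ) (v : F2),
      γ * c * γ⁻¹ = SemidirectProduct.inl (v * boundaryLoop * v⁻¹) →
      (σ γ⁻¹ * G * σ γ) * σ c = σ c * (σ γ⁻¹ * G * σ γ) := by
    intro γ v hγ
    have h1 : G * σ (γ * c * γ⁻¹) = σ (γ * c * γ⁻¹) * G := by
      have e := hgc v
      rw [← hγ, hτσ, hgG] at e
      have e2 := congrArg (fun X => Q * X * P) e
      calc G * σ (γ * c * γ⁻¹)
          = (Q * P) * G * (Q * P) * σ (γ * c * γ⁻¹) * (Q * P) := by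
            rw [hQP, one_mul, mul_one, mul_one]
        _ = Q * (P * G * Q * (P * σ (γ * c * γ⁻¹) * Q)) * P := by simp only [mul_assoc]
        _ = Q * (P * σ (γ * c * γ⁻¹) * Q * (P * G * Q)) * P := e2
        _ = (Q * P) * σ (γ * c * γ⁻¹) * (Q * P) * G * (Q * P) := by simp only [mul_assoc]
        _ = σ (γ * c * γ⁻¹) * G := by rw [hQP, one_mul, mul_one, mul_one]
    calc (σ γ⁻¹ * G * σ γ) * σ c = σ γ⁻¹ * (G * σ (γ * c * γ⁻¹)) * σ γ := by
          have : σ γ * σ c = σ (γ * c * γ⁻¹) * σ γ := by rw [← map_mul, ← map_mul]; congr 1; group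
          simp only [mul_assoc, this]
      _ = σ c * (σ γ⁻¹ * G * σ γ) := by
          have : σ c * σ γ⁻¹ = σ γ⁻¹ * σ (γ * c * γ⁻¹) := by rw [← map_mul, ← map_mul]; congr 1; group
          rw [h1]
          simp only [← mul_assoc, this]
  have hG1 := hcs.of_commute_translation hc1 hc0 (hGγ 1 1 (by simp [hc]))
  rw [inv_one, map_one, one_mul, mul_one] at hG1
  obtain ⟨g10, g20, g30, g31, g32, g33⟩ := hG1
  -- The matrix `G` preserves the line fixed by `γ c γ⁻¹`, spanned by column `0` of `σ γ`. Row `3`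
  -- of `G` is `G 0 0` times a coordinate form, so a nonzero last coordinate forces the eigenvalue
  -- to be `G 0 0`.
  have heig : ∀ (γ : BundleGroup φ) (v : F2),
      γ * c * γ⁻¹ = SemidirectProduct.inl (v * boundaryLoop * v⁻¹) → σ γ 3 0 ≠ 0 →
      ∀ i, G i 0 * σ γ 0 0 + G i 1 * σ γ 1 0 + G i 2 * σ γ 2 0 + G i 3 * σ γ 3 0 =
        G 0 0 * σ γ i 0 := by
    intro γ v hγ h30
    obtain ⟨k10, k20, k30, -, -, -⟩ := hcs.of_commute_translation hc1 hc0 (hGγ γ v hγ)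
    set k := σ γ⁻¹ * G * σ γ with hk
    have e : σ γ * k = G * σ γ := by
      rw [hk, ← mul_assoc, ← mul_assoc, ← map_mul, mul_inv_cancel, map_one, one_mul]
    have e' : ∀ i, G i 0 * σ γ 0 0 + G i 1 * σ γ 1 0 + G i 2 * σ γ 2 0 + G i 3 * σ γ 3 0 =
        σ γ i 0 * k 0 0 := by
      intro i
      have := congrFun (congrFun e i) 0
      rw [Matrix.mul_apply, Matrix.mul_apply, Fin.sum_univ_four, Fin.sum_univ_four, k10, k20,
        k30] at this
      linear_combination -this
    have h3 := e' 3
    rw [g30, g31, g32, g33] at h3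
    have h4 : G 0 0 = k 0 0 := mul_right_cancel₀ h30 (by linear_combination h3)
    intro i
    rw [e', h4, mul_comm]
  have m00 : ∀ {M : Mat4}, IsSim M → simRatio M = 1 → M 0 0 = 1 ∧ M 1 1 = 1 ∧ M 2 1 = 0 := by
    intro M hM h1
    have h00 : M 0 0 = 1 := by rw [← hM.norm_ratio, h1, norm_one]
    have h11 := congrArg Complex.re h1
    have h21 := congrArg Complex.im h1
    simp [simRatio, h00] at h11 h21
    exact ⟨h00, h11, h21⟩
  -- A translation moves the null vector `n` by `n 3` times its shift in the two plane coordinates.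
  have hcol : ∀ γ : BundleGroup φ, IsSim (σ γ) → simRatio (σ γ) = 1 →
      σ (γ * SemidirectProduct.inl w) 1 0 = n 1 + σ γ 1 3 * n 3 ∧
      σ (γ * SemidirectProduct.inl w) 2 0 = n 2 + σ γ 2 3 * n 3 ∧
      σ (γ * SemidirectProduct.inl w) 3 0 = n 3 := by
    intro γ hM h1
    obtain ⟨h00, h11, h21⟩ := m00 hM h1
    have h33 := hM.h33
    rw [h00, one_mul] at h33
    simp [map_mul, Matrix.mul_apply, Fin.sum_univ_four, hM.h10, hM.h20, hM.h30, hM.h31, hM.h32,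
      hM.h22, hM.h12, h11, h21, h33, hn]
  obtain ⟨c1, c2, c3⟩ := hcol c hcs hc1
  obtain ⟨y1, y2, y3⟩ := hcol y hys hy1
  have hdw := heig (SemidirectProduct.inl w) w (by simp [hc]) hn3
  have hdc := heig (c * SemidirectProduct.inl w) (boundaryLoop * w) (by simp [hc, mul_assoc])
    (by rw [c3]; exact hn3)
  have hyc : y⁻¹ * c = c * y⁻¹ := hcomm.symm.inv_left.eq
  -- Since `y` commutes with `c`, conjugating `c` by `y w` is the same as conjugating it by `y w
  -- y⁻¹`, which lies in the fiber group.
  obtain ⟨v, hv⟩ : ∃ v : F2, SemidirectProduct.inl v = y * SemidirectProduct.inl w * y⁻¹ := by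
    refine ⟨d * φ w * d⁻¹, ?_⟩
    rw [map_mul, map_mul, ← stableLetter_conj, hy, map_inv]
    group
  have hdy := heig (y * SemidirectProduct.inl w) v (by
      rw [map_mul, map_mul, map_inv, hv, ← hc]
      calc y * SemidirectProduct.inl w * c * (y * SemidirectProduct.inl w)⁻¹
          = y * SemidirectProduct.inl w * (c * y⁻¹ * y) * (y * SemidirectProduct.inl w)⁻¹ := by
            group
        _ = _ := by rw [← hyc]; group)
    (by rw [y3]; exact hn3)
  rw [c1, c2, c3] at hdc
  rw [y1, y2, y3] at hdy
  simp only [simShift, (m00 hcs hc1).1, (m00 hys hy1).1, one_mul] at hdet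
  -- Modulo the fixed null direction, `n` and its translates by `c` and `y` are independent, because
  -- the shifts are independent and `n 3 ≠ 0`.
  have lin : ∀ a b e : ℝ, a * n 1 + b * n 2 + e * n 3 = 0 →
      a * (n 1 + σ c 1 3 * n 3) + b * (n 2 + σ c 2 3 * n 3) + e * n 3 = 0 →
      a * (n 1 + σ y 1 3 * n 3) + b * (n 2 + σ y 2 3 * n 3) + e * n 3 = 0 →
      a = 0 ∧ b = 0 ∧ e = 0 := by
    intro a b e h1 h2 h3
    have h4 : a * σ c 1 3 + b * σ c 2 3 = 0 :=
      mul_right_cancel₀ hn3 (by linear_combination h2 - h1)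
    have h5 : a * σ y 1 3 + b * σ y 2 3 = 0 :=
      mul_right_cancel₀ hn3 (by linear_combination h3 - h1)
    have ha : a = 0 := mul_right_cancel₀ hdet (by linear_combination σ y 2 3 * h4 - σ c 2 3 * h5)
    have hb : b = 0 := mul_right_cancel₀ hdet (by linear_combination σ c 1 3 * h5 - σ y 1 3 * h4)
    refine ⟨ha, hb, mul_right_cancel₀ hn3 ?_⟩
    rw [ha, hb] at h1
    linear_combination h1
  change ∀ i, G i 0 * n 0 + G i 1 * n 1 + G i 2 * n 2 + G i 3 * n 3 = G 0 0 * n i at hdw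
  have r0 := lin (G 0 1) (G 0 2) (G 0 3) (by linear_combination hdw 0)
    (by linear_combination hdc 0) (by linear_combination hdy 0)
  have hdc1 := hdc 1
  have hdc2 := hdc 2
  have hdy1 := hdy 1
  have hdy2 := hdy 2
  rw [c1] at hdc1
  rw [c2] at hdc2
  rw [y1] at hdy1
  rw [y2] at hdy2
  have r1 := lin (G 1 1 - G 0 0) (G 1 2) (G 1 3) (by linear_combination hdw 1 - n 0 * g10)
    (by linear_combination hdc1 - σ (c * SemidirectProduct.inl w) 0 0 * g10)
    (by linear_combination hdy1 - σ (y * SemidirectProduct.inl w) 0 0 * g10)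
  have r2 := lin (G 2 1) (G 2 2 - G 0 0) (G 2 3) (by linear_combination hdw 2 - n 0 * g20)
    (by linear_combination hdc2 - σ (c * SemidirectProduct.inl w) 0 0 * g20)
    (by linear_combination hdy2 - σ (y * SemidirectProduct.inl w) 0 0 * g20)
  have hGs : G = G 0 0 • (1 : Mat4) := by
    ext i j
    fin_cases i <;> fin_cases j <;>
      simp [g10, g20, g30, g31, g32, g33, r0, r1, r2, sub_eq_zero.1 r1.1, sub_eq_zero.1 r2.2.1]
  refine ⟨G 0 0, ?_⟩
  rw [hgG, hGs, Matrix.mul_smul, Matrix.smul_mul, mul_one, hPQ]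
  simp

end Bundle

/-! ### The adjoint action -/

lemma Ad_toPGL (A : GL (Fin 4) ℝ) (X : sl4) :
    slOp (Ad (toPGL A) X) = glOp A * slOp X * glOp A⁻¹ := by
  change op (A.1 * X.1 * (A⁻¹).1) = _
  rw [map_mul, map_mul]
  rfl

/-- The adjoint action of an element of `PGL(4, ℝ)`, as a continuous linear map. -/
def adL (g : PGL4) : sl4 →L[ℝ] sl4 := LinearMap.toContinuousLinearMap (Ad g)

lemma adL_apply (g : PGL4) (X : sl4) : adL g X = Ad g X := rfl

lemma slOp_adL (A : GL (Fin 4) ℝ) (X : sl4) :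
    slOp (adL (toPGL A) X) = glOp A * slOp X * glOp A⁻¹ := Ad_toPGL A X

lemma adL_mul (g h : PGL4) (X : sl4) : adL (g * h) X = adL g (adL h X) := by
  rw [adL_apply, map_mul]
  rfl

lemma adL_one (X : sl4) : adL 1 X = X := by
  rw [adL_apply, map_one]
  rfl

lemma exp_conj (A : GL (Fin 4) ℝ) (T : Op) :
    NormedSpace.exp (glOp A * T * glOp A⁻¹) = glOp A * NormedSpace.exp T * glOp A⁻¹ := by
  let := NormedAlgebra.restrictScalars ℚ ℝ Op
  let U : Opˣ := ⟨glOp A, glOp A⁻¹, glOp_mul_inv A, glOp_inv_mul A⟩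
  exact NormedSpace.exp_units_conj U T

lemma expPGL_adL (g : PGL4) (X : sl4) : expPGL (adL g X) = g * expPGL X * g⁻¹ := by
  obtain ⟨A, rfl⟩ := toPGL_surjective g
  rw [← toPGL_expGL, ← toPGL_expGL, ← map_inv, ← map_mul, ← map_mul]
  congr 1
  refine glOp_injective ?_
  rw [map_mul, map_mul, glOp_expGL, glOp_expGL, ← slOp_apply, slOp_adL, exp_conj, slOp_apply]

lemma expPGL_neg (X : sl4) : expPGL (-X) = (expPGL X)⁻¹ := by
  rw [← toPGL_expGL, ← toPGL_expGL, ← map_inv]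
  congr 1
  refine glOp_injective ?_
  rw [glOp_expGL, glOp_expGL_inv]
  congr 1
  exact map_neg op X.1

lemma expPGL_zero : expPGL 0 = 1 := by
  rw [← toPGL_expGL, ← map_one toPGL]
  congr 1
  refine glOp_injective ?_
  rw [glOp_expGL, map_one, ← slOp_apply, map_zero, NormedSpace.exp_zero]

/-! ### Free groups -/

section FreeBasis

variable {F : Type} [Group F] (b : FreeGroupBasis (Fin 2) F)

lemma basis_lift_apply {H : Type} [Group H] (f : Fin 2 → H) (i : Fin 2) : b.lift f (b i) = f i :=
  congrFun (b.lift.symm_apply_apply f) i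

lemma basis_induction {C : F → Prop} (one : C 1) (of : ∀ i, C (b i)) (inv_of : ∀ i, C (b i)⁻¹)
    (mul : ∀ v w, C v → C w → C (v * w)) (w : F) : C w := by
  have h : ∀ x : FreeGroup (Fin 2), C (b.repr.symm x) := by
    intro x
    have e : ∀ i, b.repr.symm (FreeGroup.of i) = b i := fun i => by
      rw [← b.repr_apply_coe, MulEquiv.symm_apply_apply]
    induction x using FreeGroup.induction_on with
    | C1 => rwa [map_one]
    | of i => rw [e]; exact of i
    | inv_of i _ => rw [map_inv, e]; exact inv_of i
    | mul x y hx hy => rw [map_mul]; exact mul _ _ hx hy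
  simpa using h (b.repr w)

lemma expCoord_basis (σ : RepVariety F) (X : Fin 2 → sl4) (i : Fin 2) :
    expCoord b σ X (b i) = expPGL (X i) * σ (b i) := basis_lift_apply b _ i

lemma expCoord_zero (σ : RepVariety F) : expCoord b σ 0 = σ := by
  refine b.ext_hom _ _ fun i => ?_
  rw [expCoord_basis, Pi.zero_apply, expPGL_zero, one_mul]

lemma charClass_eq_iff {σ τ : RepVariety F} :
    charClass σ = charClass τ ↔ ∃ g : PGL4, ∀ w, τ w = g * σ w * g⁻¹ :=
  Quotient.eq (r := conjSetoid F)

include b in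
lemma charClass_eq_of_basis {σ τ : RepVariety F} {g : PGL4}
    (h : ∀ i, τ (b i) = g * σ (b i) * g⁻¹) : charClass σ = charClass τ := by
  refine charClass_eq_iff.2 ⟨g, fun w => ?_⟩
  have : τ = (MulAut.conj g).toMonoidHom.comp σ := b.ext_hom _ _ h
  rw [this]
  rfl

/-! ### Smoothness of word maps -/

variable (R : Fin 2 → GL (Fin 4) ℝ)

/-- The lift of `expCoord` to `GL(4, ℝ)`. -/
def coordLift (X : Fin 2 → sl4) : F →* GL (Fin 4) ℝ := b.lift fun i => expGL (X i) * R i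

lemma coordLift_basis (X : Fin 2 → sl4) (i : Fin 2) :
    coordLift b R X (b i) = expGL (X i) * R i := basis_lift_apply b _ i

lemma glOp_coordLift_basis (X : Fin 2 → sl4) (i : Fin 2) :
    glOp (coordLift b R X (b i)) = NormedSpace.exp (slOp (X i)) * glOp (R i) := by
  rw [coordLift_basis, map_mul, glOp_expGL, slOp_apply]

lemma glOp_coordLift_basis_inv (X : Fin 2 → sl4) (i : Fin 2) :
    glOp (coordLift b R X (b i)⁻¹) = glOp (R i)⁻¹ * NormedSpace.exp (-slOp (X i)) := by
  rw [map_inv, coordLift_basis, mul_inv_rev, map_mul, glOp_expGL_inv, slOp_apply]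

variable {R} in
lemma toPGL_coordLift {σ : RepVariety F} (hR : ∀ i, toPGL (R i) = σ (b i)) (X : Fin 2 → sl4)
    (w : F) : toPGL (coordLift b R X w) = expCoord b σ X w := by
  have : toPGL.comp (coordLift b R X) = expCoord b σ X := b.ext_hom _ _ fun i => by
    rw [MonoidHom.comp_apply, coordLift_basis, expCoord_basis, map_mul, toPGL_expGL, hR]
  rw [← this]
  rfl

lemma contDiff_coordLift (w : F) : ContDiff ℝ ω fun X => glOp (coordLift b R X w) := by
  induction w using basis_induction b with
  | one => simpa using contDiff_const
  | of i =>
    simp_rw [glOp_coordLift_basis]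
    exact (contDiff_exp.comp (slOp.contDiff.comp (contDiff_apply ℝ sl4 i))).mul contDiff_const
  | inv_of i =>
    simp_rw [glOp_coordLift_basis_inv]
    exact contDiff_const.mul (contDiff_exp.comp (slOp.contDiff.comp (contDiff_apply ℝ sl4 i)).neg)
  | mul v w hv hw =>
    simp_rw [map_mul]
    exact hv.mul hw

lemma hasFDerivAt_exp_comp {V : Type*} [NormedAddCommGroup V] [NormedSpace ℝ V] (T : V →L[ℝ] Op) :
    HasFDerivAt (fun v => NormedSpace.exp (T v)) T 0 := by
  have h : HasFDerivAt (NormedSpace.exp : Op → Op) (1 : Op →L[ℝ] Op) (T 0) := by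
    rw [map_zero]
    exact hasFDerivAt_exp_zero (𝕂 := ℝ)
  exact h.comp (0 : V) T.hasFDerivAt

variable {R} in
/-- The derivatives at `0` of the word maps are given by a family of cocycles. -/
theorem exists_hasFDerivAt_coordLift {σ : RepVariety F} (hR : ∀ i, toPGL (R i) = σ (b i)) :
    ∃ D : F → ((Fin 2 → sl4) →L[ℝ] sl4),
      (∀ w, HasFDerivAt (fun X => glOp (coordLift b R X w))
        ((ContinuousLinearMap.mul ℝ Op).flip (glOp (coordLift b R 0 w)) ∘L slOp ∘L D w) 0) ∧
      (∀ i X, D (b i) X = X i) ∧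
      ∀ v w X, D (v * w) X = D v X + adL (σ v) (D w X) := by
  have hσ : ∀ w, toPGL (coordLift b R 0 w) = σ w := fun w => by
    rw [toPGL_coordLift b hR, expCoord_zero]
  -- Derivatives are trivialized by right multiplication, which turns the product rule into the
  -- cocycle rule.
  have hmul : ∀ (v w : F) (Dv Dw : (Fin 2 → sl4) →L[ℝ] sl4),
      HasFDerivAt (fun X => glOp (coordLift b R X v))
        ((ContinuousLinearMap.mul ℝ Op).flip (glOp (coordLift b R 0 v)) ∘L slOp ∘L Dv) 0 →
      HasFDerivAt (fun X => glOp (coordLift b R X w))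
        ((ContinuousLinearMap.mul ℝ Op).flip (glOp (coordLift b R 0 w)) ∘L slOp ∘L Dw) 0 →
      HasFDerivAt (fun X => glOp (coordLift b R X (v * w)))
        ((ContinuousLinearMap.mul ℝ Op).flip (glOp (coordLift b R 0 (v * w))) ∘L slOp ∘L
          (Dv + adL (σ v) ∘L Dw)) 0 := by
    intro v w Dv Dw hv hw
    have h := hv.mul' hw
    simp_rw [map_mul]
    refine h.congr_fderiv (ContinuousLinearMap.ext fun X => ?_)
    have e : glOp (coordLift b R 0 v)⁻¹ * (glOp (coordLift b R 0 v) * glOp (coordLift b R 0 w)) =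
        glOp (coordLift b R 0 w) := by rw [← mul_assoc, glOp_inv_mul, one_mul]
    change glOp (coordLift b R 0 v) * (slOp (Dw X) * glOp (coordLift b R 0 w)) +
      slOp (Dv X) * glOp (coordLift b R 0 v) * glOp (coordLift b R 0 w) =
      slOp (Dv X + adL (σ v) (Dw X)) * (glOp (coordLift b R 0 v) * glOp (coordLift b R 0 w))
    rw [map_add, ← hσ, slOp_adL, add_mul, mul_assoc _ (glOp (coordLift b R 0 v)⁻¹), e, add_comm,
      mul_assoc, mul_assoc]
  have hof : ∀ i, HasFDerivAt (fun X => glOp (coordLift b R X (b i)))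
      ((ContinuousLinearMap.mul ℝ Op).flip (glOp (coordLift b R 0 (b i))) ∘L slOp ∘L
        ContinuousLinearMap.proj i) 0 := by
    intro i
    have h := (hasFDerivAt_exp_comp (slOp ∘L (ContinuousLinearMap.proj i :
      (Fin 2 → sl4) →L[ℝ] sl4))).mul_const' (glOp (R i))
    rw [glOp_coordLift_basis]
    simp_rw [glOp_coordLift_basis]
    refine h.congr_fderiv (ContinuousLinearMap.ext fun X => ?_)
    rw [Pi.zero_apply, map_zero, NormedSpace.exp_zero, one_mul]
    rfl
  have hex : ∀ w, ∃ Dw : (Fin 2 → sl4) →L[ℝ] sl4, HasFDerivAt (fun X => glOp (coordLift b R X w))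
      ((ContinuousLinearMap.mul ℝ Op).flip (glOp (coordLift b R 0 w)) ∘L slOp ∘L Dw) 0 := by
    intro w
    induction w using basis_induction b with
    | one =>
      refine ⟨0, ?_⟩
      simp only [map_one, ContinuousLinearMap.comp_zero]
      exact hasFDerivAt_const _ _
    | of i => exact ⟨_, hof i⟩
    | inv_of i =>
      refine ⟨-(adL (toPGL (R i)⁻¹) ∘L ContinuousLinearMap.proj i), ?_⟩
      have h := (hasFDerivAt_exp_comp (-(slOp ∘L (ContinuousLinearMap.proj i :
        (Fin 2 → sl4) →L[ℝ] sl4)))).const_mul (glOp (R i)⁻¹)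
      rw [glOp_coordLift_basis_inv]
      simp_rw [glOp_coordLift_basis_inv]
      refine h.congr_fderiv (ContinuousLinearMap.ext fun X => ?_)
      have e : glOp (R i) * glOp (R i)⁻¹ = 1 := glOp_mul_inv _
      rw [Pi.zero_apply, map_zero, neg_zero, NormedSpace.exp_zero, mul_one]
      change glOp (R i)⁻¹ * -(slOp (X i)) =
        slOp (-(adL (toPGL (R i)⁻¹) (X i))) * glOp (R i)⁻¹
      have key : ∀ {A : Type} [Ring A] {c d x : A}, c * d = 1 → d * -x = -(d * x * c) * d := by
        intro A _ c d x h
        rw [neg_mul, mul_neg, mul_assoc, h, mul_one]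
      rw [map_neg, slOp_adL, inv_inv]
      exact key e
    | mul v w hv hw =>
      obtain ⟨Dv, hv⟩ := hv
      obtain ⟨Dw, hw⟩ := hw
      exact ⟨_, hmul v w Dv Dw hv hw⟩
  choose D hD using hex
  -- The induction gives only the existence of a derivative for each word. Uniqueness of derivatives
  -- yields the cocycle identity for the chosen family.
  have huniq : ∀ (w : F) (D' : (Fin 2 → sl4) →L[ℝ] sl4),
      HasFDerivAt (fun X => glOp (coordLift b R X w))
        ((ContinuousLinearMap.mul ℝ Op).flip (glOp (coordLift b R 0 w)) ∘L slOp ∘L D') 0 →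
      D w = D' := by
    intro w D' h
    have e := (hD w).unique h
    ext1 X
    have e' := DFunLike.congr_fun e X
    refine slOp_injective ?_
    simp only [ContinuousLinearMap.comp_apply, ContinuousLinearMap.flip_apply,
      ContinuousLinearMap.mul_apply'] at e'
    have e2 := congrArg (· * glOp (coordLift b R 0 w)⁻¹) e'
    simpa only [mul_assoc, glOp_mul_inv, mul_one] using e2
  refine ⟨D, hD, fun i X => ?_, fun v w X => ?_⟩
  · rw [huniq _ _ (hof i)]
    rfl
  · rw [huniq _ _ (hmul v w _ _ (hD v) (hD w))]
    rfl

/-! ### Topology of the representation and character varieties -/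

include b in
lemma mem_nhds_of_basis {σ : RepVariety F} {N : Fin 2 → Set PGL4} (hN : ∀ i, N i ∈ 𝓝 (σ (b i))) :
    {τ : RepVariety F | ∀ i, τ (b i) ∈ N i} ∈ 𝓝 σ := by
  have hc : Continuous fun (τ : RepVariety F) (w : F) => τ w := continuous_induced_dom
  have : ∀ i, ∀ᶠ τ : RepVariety F in 𝓝 σ, τ (b i) ∈ N i := fun i =>
    ((continuous_apply (b i)).comp hc).continuousAt.eventually_mem (hN i)
  exact eventually_all.2 this

lemma continuous_expCoord (σ : RepVariety F) : Continuous (expCoord b σ) := by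
  choose R hR using fun i => toPGL_surjective (σ (b i))
  refine continuous_induced_rng.2 (continuous_pi fun w => ?_)
  change Continuous fun X => expCoord b σ X w
  simp_rw [← toPGL_coordLift b hR]
  refine continuous_toPGL.comp (continuous_of_continuous_glOp (contDiff_coordLift b R w).continuous ?_)
  simp_rw [← map_inv]
  exact (contDiff_coordLift b R w⁻¹).continuous

lemma continuous_charClass : Continuous (charClass : RepVariety F → CharVariety F) :=
  continuous_quotient_mk'

/-- Conjugation of representations by an element of `PGL(4, ℝ)`. -/
def conjRep (g : PGL4) (σ : RepVariety F) : RepVariety F := (MulAut.conj g).toMonoidHom.comp σ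

lemma continuous_conjRep (g : PGL4) : Continuous (conjRep g : RepVariety F → RepVariety F) := by
  refine continuous_induced_rng.2 (continuous_pi fun w => ?_)
  have hc : Continuous fun (τ : RepVariety F) (w : F) => τ w := continuous_induced_dom
  exact (continuous_const.mul ((continuous_apply w).comp hc)).mul continuous_const

lemma isOpenMap_charClass : IsOpenMap (charClass : RepVariety F → CharVariety F) := by
  intro U hU
  refine isOpen_coinduced.2 ?_
  have e : charClass ⁻¹' (charClass '' U) = ⋃ g : PGL4, conjRep g ⁻¹' U := by
    ext σ
    simp only [Set.mem_preimage, Set.mem_image, Set.mem_iUnion]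
    constructor
    · rintro ⟨τ, hτ, h⟩
      obtain ⟨g, hg⟩ := charClass_eq_iff.1 h.symm
      refine ⟨g, ?_⟩
      have : conjRep g σ = τ := MonoidHom.ext fun w => (hg w).symm
      rwa [this]
    · rintro ⟨g, hg⟩
      exact ⟨_, hg, (charClass_eq_iff.2 ⟨g, fun w => rfl⟩).symm⟩
  change IsOpen (charClass ⁻¹' (charClass '' U))
  rw [e]
  exact isOpen_iUnion fun g => hU.preimage (continuous_conjRep g)

/-- Openness near `0` of exponential coordinates followed by the projection: freeness lets the
values on the basis vary independently, and the projection is open. -/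
lemma eventually_nhds_charClass_le (σ : RepVariety F) :
    ∀ᶠ X : Fin 2 → sl4 in 𝓝 0,
      𝓝 (charClass (expCoord b σ X)) ≤ map (fun Y => charClass (expCoord b σ Y)) (𝓝 X) := by
  have h : ∀ᶠ X : Fin 2 → sl4 in 𝓝 0, ∀ i, 𝓝 (expPGL (X i)) ≤ map expPGL (𝓝 (X i)) :=
    eventually_all.2 fun i =>
      ((continuous_apply i).tendsto (0 : Fin 2 → sl4)).eventually eventually_nhds_expPGL_le
  filter_upwards [h] with X hX
  have h1 : 𝓝 (expCoord b σ X) ≤ map (expCoord b σ) (𝓝 X) := by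
    intro S hS
    rw [mem_map, nhds_pi, mem_pi'] at hS
    obtain ⟨I, N, hN, hsub⟩ := hS
    have hN' : ∀ i, (fun g => g * σ (b i)) '' (expPGL '' N i) ∈ 𝓝 (expCoord b σ X (b i)) := by
      intro i
      have h2 : expPGL '' N i ∈ 𝓝 (expPGL (X i)) := hX i (image_mem_map (hN i))
      rw [expCoord_basis]
      exact (Homeomorph.mulRight (σ (b i))).isOpenMap.image_mem_nhds h2
    refine mem_of_superset (mem_nhds_of_basis b hN') ?_
    intro τ hτ
    choose g hg hg' using hτ
    choose Y hY hY' using hg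
    have e : τ = expCoord b σ Y := b.ext_hom _ _ fun i => by
      rw [expCoord_basis, hY', ← hg']
    rw [e]
    exact hsub fun i _ => hY i
  calc 𝓝 (charClass (expCoord b σ X)) ≤ map charClass (𝓝 (expCoord b σ X)) :=
        isOpenMap_charClass.nhds_le _
    _ ≤ map charClass (map (expCoord b σ) (𝓝 X)) := map_mono h1
    _ = _ := map_map

end FreeBasis

/-! ### Products of exponentials -/

/-- The logarithm of the product of two exponentials. -/
def bch (p : sl4 × sl4) : sl4 := plog (NormedSpace.exp (slOp p.1) * NormedSpace.exp (slOp p.2))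

lemma contDiff_exp_mul_exp : ContDiff ℝ ω fun p : sl4 × sl4 =>
    NormedSpace.exp (slOp p.1) * NormedSpace.exp (slOp p.2) :=
  (contDiff_exp.comp (slOp.contDiff.comp contDiff_fst)).mul
    (contDiff_exp.comp (slOp.contDiff.comp contDiff_snd))

lemma exp_slOp_zero : NormedSpace.exp (slOp 0) = 1 := by
  rw [map_zero, NormedSpace.exp_zero]

lemma tendsto_exp_mul_exp : Tendsto (fun p : sl4 × sl4 =>
    NormedSpace.exp (slOp p.1) * NormedSpace.exp (slOp p.2)) (𝓝 0) (𝓝 1) := by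
  have h := contDiff_exp_mul_exp.continuous.tendsto 0
  simp only [Prod.fst_zero, Prod.snd_zero] at h
  rwa [exp_slOp_zero, one_mul] at h

lemma bch_zero : bch 0 = 0 := by
  rw [bch, Prod.fst_zero, Prod.snd_zero, exp_slOp_zero, one_mul, plog_one]

lemma contDiffAt_bch : ContDiffAt ℝ ω bch 0 := by
  refine ContDiffAt.comp (0 : sl4 × sl4) ?_ contDiff_exp_mul_exp.contDiffAt
  simp only [Prod.fst_zero, Prod.snd_zero]
  rw [exp_slOp_zero, one_mul]
  exact contDiffAt_plog

lemma hasFDerivAt_bch :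
    HasFDerivAt bch (ContinuousLinearMap.fst ℝ sl4 sl4 + ContinuousLinearMap.snd ℝ sl4 sl4) 0 := by
  have h := (hasFDerivAt_exp_comp (slOp ∘L ContinuousLinearMap.fst ℝ sl4 sl4)).mul'
    (hasFDerivAt_exp_comp (slOp ∘L ContinuousLinearMap.snd ℝ sl4 sl4))
  have h' : HasFDerivAt plog tracelessPart
      (NormedSpace.exp ((slOp ∘L ContinuousLinearMap.fst ℝ sl4 sl4) 0) *
        NormedSpace.exp ((slOp ∘L ContinuousLinearMap.snd ℝ sl4 sl4) 0)) := by
    rw [map_zero, map_zero, NormedSpace.exp_zero, one_mul]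
    exact hasFDerivAt_plog
  refine (h'.comp (0 : sl4 × sl4) h).congr_fderiv (ContinuousLinearMap.ext fun p => ?_)
  rw [map_zero, map_zero, NormedSpace.exp_zero]
  change tracelessPart (1 * slOp p.2 + slOp p.1 * 1) = p.1 + p.2
  rw [one_mul, mul_one, map_add, tracelessPart_slOp, tracelessPart_slOp, add_comm]

lemma eventually_expPGL_bch :
    ∀ᶠ p : sl4 × sl4 in 𝓝 0, expPGL (bch p) = expPGL p.1 * expPGL p.2 := by
  filter_upwards [tendsto_exp_mul_exp.eventually eventually_toPGL_eq_expPGL_plog] with p hp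
  rw [bch, ← hp (expGL p.1 * expGL p.2) (by rw [map_mul, glOp_expGL, glOp_expGL]; rfl), map_mul,
    toPGL_expGL, toPGL_expGL]

lemma eventually_bch_zero_left : ∀ᶠ X : sl4 in 𝓝 0, bch (0, X) = X := by
  filter_upwards [eventually_plog_exp] with X hX
  rw [bch, exp_slOp_zero, one_mul, hX]

lemma eventually_bch_zero_right : ∀ᶠ X : sl4 in 𝓝 0, bch (X, 0) = X := by
  filter_upwards [eventually_plog_exp] with X hX
  rw [bch, exp_slOp_zero, mul_one, hX]

/-- A functional equal to `1` at `B` recovers the scalar `c` near the limit. This controls the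
unknown factors in relations lifted from `PGL(4, ℝ)`. -/
lemma exists_eq_smul_of_tendsto {α V : Type*} [NormedAddCommGroup V] [NormedSpace ℝ V]
    {l : Filter α} {c : α → ℝ} {A : α → V} {B C : V} (hA : Tendsto A l (𝓝 B)) (hB : B ≠ 0)
    (hC : Tendsto (fun x => c x • A x) l (𝓝 C)) [l.NeBot] :
    ∃ t, Tendsto c l (𝓝 t) ∧ C = t • B := by
  obtain ⟨f, hf⟩ := SeparatingDual.exists_eq_one (R := ℝ) hB
  have h1 : Tendsto (fun x => f (A x)) l (𝓝 1) := hf ▸ (f.continuous.tendsto B).comp hA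
  have h2 : Tendsto (fun x => f (c x • A x)) l (𝓝 (f C)) := (f.continuous.tendsto C).comp hC
  have h3 : Tendsto c l (𝓝 (f C)) := by
    have h4 := h2.div h1 one_ne_zero
    rw [div_one] at h4
    refine h4.congr' ?_
    filter_upwards [h1.eventually_ne one_ne_zero] with x hx
    rw [Pi.div_apply, map_smul, smul_eq_mul, mul_div_cancel_right₀ _ hx]
  exact ⟨f C, h3, tendsto_nhds_unique hC (h3.smul hA)⟩

/-- The exponential map of `PGL(4, ℝ)` is injective near `0`. -/
lemma eventually_expPGL_injective :
    ∀ᶠ p : sl4 × sl4 in 𝓝 0, expPGL p.1 = expPGL p.2 → p.1 = p.2 := by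
  -- Equality in `PGL(4, ℝ)` is equality of exponentials up to a scalar. The functional `f` writes
  -- this scalar as a quotient tending to `1`, and `plog` ignores such a scalar.
  obtain ⟨f, hf⟩ := SeparatingDual.exists_eq_one (R := ℝ) (one_ne_zero (α := Op))
  have h1 : Tendsto (fun p : sl4 × sl4 => f (NormedSpace.exp (slOp p.1))) (𝓝 0) (𝓝 1) := by
    have : Continuous fun p : sl4 × sl4 => f (NormedSpace.exp (slOp p.1)) :=
      f.continuous.comp (continuous_exp.comp (slOp.continuous.comp continuous_fst))
    have h := this.tendsto 0
    rwa [Prod.fst_zero, exp_slOp_zero, hf] at h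
  have h2 : Tendsto (fun p : sl4 × sl4 => f (NormedSpace.exp (slOp p.2))) (𝓝 0) (𝓝 1) := by
    have : Continuous fun p : sl4 × sl4 => f (NormedSpace.exp (slOp p.2)) :=
      f.continuous.comp (continuous_exp.comp (slOp.continuous.comp continuous_snd))
    have h := this.tendsto 0
    rwa [Prod.snd_zero, exp_slOp_zero, hf] at h
  have h3 := h1.div h2 one_ne_zero
  rw [div_one] at h3
  have h4 : Tendsto (fun p : sl4 × sl4 => p.2) (𝓝 0) (𝓝 0) := continuous_snd.tendsto (0 : sl4 × sl4)
  have h5 : Tendsto (fun p : sl4 × sl4 => p.1) (𝓝 0) (𝓝 0) := continuous_fst.tendsto (0 : sl4 × sl4)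
  filter_upwards [(h3.prodMk_nhds h4).eventually eventually_plog_smul_exp,
    h5.eventually eventually_plog_exp, h2.eventually_ne one_ne_zero] with p hp hp' hne h
  rw [← toPGL_expGL, ← toPGL_expGL] at h
  obtain ⟨c, -, hc⟩ := exists_glOp_smul_of_toPGL_eq h
  rw [glOp_expGL, glOp_expGL, ← slOp_apply, ← slOp_apply] at hc
  rw [← hp', ← hp]
  congr 1
  rw [Pi.div_apply, hc, map_smul, smul_eq_mul, mul_div_cancel_right₀ _ hne]

/-! ### Conjugation in exponential coordinates -/

section Slice

variable {F : Type} [Group F] (b : FreeGroupBasis (Fin 2) F) (σ : RepVariety F)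

/-- Conjugation of the representation with exponential coordinates `p.2` by `exp p.1`. -/
def conjMap (p : sl4 × (Fin 2 → sl4)) : Fin 2 → sl4 :=
  fun i => bch (p.1, bch (p.2 i, -adL (σ (b i)) p.1))

/-- The linear map whose range is the tangent space of the conjugacy class of `σ`. -/
def orbitMap : sl4 →L[ℝ] (Fin 2 → sl4) :=
  ContinuousLinearMap.pi fun i => ContinuousLinearMap.id ℝ sl4 - adL (σ (b i))

lemma orbitMap_apply (Z : sl4) (i : Fin 2) : orbitMap b σ Z i = Z - adL (σ (b i)) Z := rfl

/-- The linear part of the argument of the inner `bch` in `conjMap`. -/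
def conjArg (i : Fin 2) : sl4 × (Fin 2 → sl4) →L[ℝ] sl4 × sl4 :=
  (ContinuousLinearMap.proj i ∘L ContinuousLinearMap.snd ℝ sl4 (Fin 2 → sl4)).prod
    (-(adL (σ (b i)) ∘L ContinuousLinearMap.fst ℝ sl4 (Fin 2 → sl4)))

lemma conjMap_apply (p : sl4 × (Fin 2 → sl4)) (i : Fin 2) :
    conjMap b σ p i = bch (p.1, bch (conjArg b σ i p)) := rfl

lemma contDiffAt_conjMap : ContDiffAt ℝ ω (conjMap b σ) 0 := by
  refine contDiffAt_pi.2 fun i => ?_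
  have h1 : ContDiffAt ℝ ω (fun p => bch (conjArg b σ i p)) 0 := by
    refine ContDiffAt.comp (g := bch) (0 : sl4 × (Fin 2 → sl4)) ?_
      (conjArg b σ i).contDiff.contDiffAt
    rw [map_zero]
    exact contDiffAt_bch
  refine ContDiffAt.comp (g := bch) (0 : sl4 × (Fin 2 → sl4)) ?_ (contDiffAt_fst.prodMk h1)
  change ContDiffAt ℝ ω bch ((0 : sl4), bch (conjArg b σ i 0))
  rw [map_zero, bch_zero]
  exact contDiffAt_bch

lemma hasFDerivAt_conjMap : HasFDerivAt (conjMap b σ)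
    (orbitMap b σ ∘L ContinuousLinearMap.fst ℝ sl4 (Fin 2 → sl4) +
      ContinuousLinearMap.snd ℝ sl4 (Fin 2 → sl4)) 0 := by
  refine hasFDerivAt_pi'.2 fun i => ?_
  have h0 : HasFDerivAt bch (ContinuousLinearMap.fst ℝ sl4 sl4 + ContinuousLinearMap.snd ℝ sl4 sl4)
      (conjArg b σ i 0) := by
    rw [map_zero]
    exact hasFDerivAt_bch
  have h1 := h0.comp (0 : sl4 × (Fin 2 → sl4)) (conjArg b σ i).hasFDerivAt
  have h2 := (hasFDerivAt_fst (𝕜 := ℝ) (p := (0 : sl4 × (Fin 2 → sl4)))).prodMk h1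
  have h3 : HasFDerivAt bch (ContinuousLinearMap.fst ℝ sl4 sl4 + ContinuousLinearMap.snd ℝ sl4 sl4)
      ((0 : sl4 × (Fin 2 → sl4)).1, (bch ∘ conjArg b σ i) 0) := by
    rw [Function.comp_apply, map_zero, bch_zero]
    exact hasFDerivAt_bch
  refine (h3.comp (0 : sl4 × (Fin 2 → sl4)) h2).congr_fderiv (ContinuousLinearMap.ext fun p => ?_)
  change p.1 + (p.2 i + -(adL (σ (b i)) p.1)) = (p.1 - adL (σ (b i)) p.1) + p.2 i
  abel

lemma tendsto_conjArg (i : Fin 2) : Tendsto (conjArg b σ i) (𝓝 0) (𝓝 0) := by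
  simpa using (conjArg b σ i).continuous.tendsto 0

lemma tendsto_conjMap : Tendsto (conjMap b σ) (𝓝 0) (𝓝 0) := by
  have h := (contDiffAt_conjMap b σ).continuousAt.tendsto
  have e : conjMap b σ 0 = 0 := funext fun i => by
    rw [conjMap_apply, map_zero, bch_zero]
    exact bch_zero
  rwa [e] at h

/-- Moving `exp(-Z)` to the left across `σ(b i)` turns it into the exponential of `-Ad(σ(b i)) Z`.
This is the source of the nested `bch` in `conjMap`. -/
lemma eventually_expPGL_conjMap : ∀ᶠ p in 𝓝 (0 : sl4 × (Fin 2 → sl4)), ∀ i,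
    expPGL (conjMap b σ p i) = expPGL p.1 * expPGL (p.2 i) * (σ (b i) * (expPGL p.1)⁻¹ * (σ (b i))⁻¹) := by
  refine eventually_all.2 fun i => ?_
  have h1 := (tendsto_conjArg b σ i).eventually eventually_expPGL_bch
  have h2 : Tendsto (fun p => (p.1, bch (conjArg b σ i p))) (𝓝 (0 : sl4 × (Fin 2 → sl4)))
      (𝓝 (0 : sl4 × sl4)) := by
    have h3 : Tendsto bch (𝓝 0) (𝓝 0) := by
      have h := contDiffAt_bch.continuousAt.tendsto
      rw [bch_zero] at h
      exact h
    exact (continuous_fst.tendsto _).prodMk_nhds (h3.comp (tendsto_conjArg b σ i))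
  filter_upwards [h1, h2.eventually eventually_expPGL_bch] with p hp hp'
  rw [conjMap_apply, hp', hp]
  change expPGL p.1 * (expPGL (p.2 i) * expPGL (-(adL (σ (b i)) p.1))) = _
  rw [expPGL_neg, expPGL_adL, mul_assoc, mul_inv_rev, mul_inv_rev, inv_inv, mul_assoc,
    mul_assoc]

lemma eventually_charClass_conjMap : ∀ᶠ p in 𝓝 (0 : sl4 × (Fin 2 → sl4)),
    charClass (expCoord b σ (conjMap b σ p)) = charClass (expCoord b σ p.2) := by
  filter_upwards [eventually_expPGL_conjMap b σ] with p hp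
  refine (charClass_eq_of_basis b (g := expPGL p.1) fun i => ?_).symm
  rw [expCoord_basis, expCoord_basis, hp]
  group

lemma eventually_conjMap_zero_left : ∀ᶠ X in 𝓝 (0 : Fin 2 → sl4), conjMap b σ (0, X) = X := by
  have h : ∀ᶠ X in 𝓝 (0 : Fin 2 → sl4), ∀ i, bch (X i, 0) = X i ∧ bch (0, X i) = X i :=
    eventually_all.2 fun i => ((continuous_apply i).tendsto (0 : Fin 2 → sl4)).eventually
      (eventually_bch_zero_right.and eventually_bch_zero_left)
  filter_upwards [h] with X hX
  funext i
  change bch (0, bch (X i, -(adL (σ (b i)) 0))) = X i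
  rw [map_zero, neg_zero, (hX i).1, (hX i).2]

/-! ### Slices -/

/-- A slice at `σ` for the conjugation action on the representation variety. -/
structure LocalSlice (V : Type) [NormedAddCommGroup V] [NormedSpace ℝ V] where
  /-- The inclusion of the slice. -/
  incl : V →L[ℝ] (Fin 2 → sl4)
  /-- The projection onto the slice along conjugacy classes. -/
  proj : (Fin 2 → sl4) → V
  contDiffAt_proj : ContDiffAt ℝ ω proj 0
  proj_zero : proj 0 = 0
  proj_incl : ∀ᶠ v in 𝓝 0, proj (incl v) = v
  charClass_incl_proj : ∀ᶠ X in 𝓝 0,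
    charClass (expCoord b σ (incl (proj X))) = charClass (expCoord b σ X)
  charClass_injective : ∀ᶠ p in 𝓝 (0 : V × V),
    charClass (expCoord b σ (incl p.1)) = charClass (expCoord b σ (incl p.2)) → p.1 = p.2
  exists_eq_add : ∀ X, ∃ Z v, X = orbitMap b σ Z + incl v

/-- Representations close to `σ` that are conjugate are conjugate by an element close to `1`. -/
lemma exists_tendsto_conj {α : Type} {l : Ultrafilter α} {R : Fin 2 → GL (Fin 4) ℝ}
    (hR : ∀ i, toPGL (R i) = σ (b i))
    (hc : ∀ (G : Op) (ε : Fin 2 → ℝ), (∀ i, ε i ≠ 0) →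
      (∀ i, G * glOp (R i) = ε i • (glOp (R i) * G)) → ∃ t : ℝ, G = t • (1 : Op))
    {X Y : α → Fin 2 → sl4} (hX : Tendsto X l (𝓝 0)) (hY : Tendsto Y l (𝓝 0))
    (h : ∀ᶠ n in (l : Filter α),
      charClass (expCoord b σ (X n)) = charClass (expCoord b σ (Y n))) :
    ∃ Z : α → sl4, Tendsto Z l (𝓝 0) ∧ ∀ᶠ n in (l : Filter α), ∀ i,
      expCoord b σ (Y n) (b i) = expPGL (Z n) * expCoord b σ (X n) (b i) * (expPGL (Z n))⁻¹ := by
  -- Representatives of norm one accumulate on the compact unit sphere. The limit `G` could be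
  -- singular a priori, but the limiting relations and `hc` make it a nonzero scalar, so dividing by
  -- it gives conjugators tending to `1`.
  have hA : ∀ n, ∃ A : GL (Fin 4) ℝ, ‖glOp A‖ = 1 ∧
      (charClass (expCoord b σ (X n)) = charClass (expCoord b σ (Y n)) →
        ∀ w, expCoord b σ (Y n) w = toPGL A * expCoord b σ (X n) w * (toPGL A)⁻¹) := by
    intro n
    have h1 : ∃ A : GL (Fin 4) ℝ,
      (charClass (expCoord b σ (X n)) = charClass (expCoord b σ (Y n)) →
        ∀ w, expCoord b σ (Y n) w = toPGL A * expCoord b σ (X n) w * (toPGL A)⁻¹) := by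
      by_cases hn : charClass (expCoord b σ (X n)) = charClass (expCoord b σ (Y n))
      · obtain ⟨g, hg⟩ := charClass_eq_iff.1 hn
        obtain ⟨A, rfl⟩ := toPGL_surjective g
        exact ⟨A, fun _ => hg⟩
      · exact ⟨1, fun h => absurd h hn⟩
    obtain ⟨A, hA⟩ := h1
    have hpos : 0 < ‖glOp A‖ := norm_pos_iff.2 (glOp_ne_zero A)
    have e : (‖glOp A‖⁻¹ • glOp A) * (‖glOp A‖ • glOp A⁻¹) = 1 := by
      rw [smul_mul_smul_comm, inv_mul_cancel₀ hpos.ne', one_smul, glOp_mul_inv]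
    obtain ⟨A', hA'⟩ := exists_glOp_eq e
    refine ⟨A', ?_, ?_⟩
    · rw [hA', norm_smul, norm_inv, norm_norm, inv_mul_cancel₀ hpos.ne']
    · rw [toPGL_eq_of_smul hA']
      exact hA
  choose A hA1 hA2 using hA
  have hcpt : IsCompact (Metric.sphere (0 : Op) 1) := isCompact_sphere _ _
  obtain ⟨G, hG1, hG⟩ := hcpt.ultrafilter_le_nhds (l.map fun n => glOp (A n)) (by
    rw [le_principal_iff]
    exact Eventually.of_forall (f := (l : Filter α)) fun n => by simpa using hA1 n)
  replace hG : Tendsto (fun n => glOp (A n)) l (𝓝 G) := hG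
  have hG0 : G ≠ 0 := by
    rintro rfl
    simp at hG1
  have hlift : ∀ {X : α → Fin 2 → sl4}, Tendsto X l (𝓝 0) → ∀ i,
      Tendsto (fun n => glOp (coordLift b R (X n) (b i))) l (𝓝 (glOp (R i))) := by
    intro X hX i
    have h1 := ((contDiff_coordLift b R (b i)).continuous.tendsto 0).comp hX
    rw [glOp_coordLift_basis, Pi.zero_apply, exp_slOp_zero, one_mul] at h1
    exact h1
  have hrel : ∀ᶠ n in (l : Filter α), ∀ i, ∃ c : ℝ,
      glOp (A n) * glOp (coordLift b R (X n) (b i)) =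
        c • (glOp (coordLift b R (Y n) (b i)) * glOp (A n)) := by
    filter_upwards [h] with n hn i
    have h1 := hA2 n hn (b i)
    rw [← toPGL_coordLift b hR, ← toPGL_coordLift b hR, eq_mul_inv_iff_mul_eq, ← map_mul,
      ← map_mul] at h1
    obtain ⟨c, -, hc⟩ := exists_glOp_smul_of_toPGL_eq h1.symm
    exact ⟨c, by rw [← map_mul, ← map_mul, hc]⟩
  have hrel' : ∀ i, ∃ t : ℝ, t ≠ 0 ∧ G * glOp (R i) = t • (glOp (R i) * G) := by
    intro i
    have h2 : ∀ n, ∃ c : ℝ, (∃ c : ℝ, glOp (A n) * glOp (coordLift b R (X n) (b i)) =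
        c • (glOp (coordLift b R (Y n) (b i)) * glOp (A n))) →
        glOp (A n) * glOp (coordLift b R (X n) (b i)) =
        c • (glOp (coordLift b R (Y n) (b i)) * glOp (A n)) := fun n => by
      by_cases hn : ∃ c : ℝ, glOp (A n) * glOp (coordLift b R (X n) (b i)) =
        c • (glOp (coordLift b R (Y n) (b i)) * glOp (A n))
      · exact ⟨hn.choose, fun _ => hn.choose_spec⟩
      · exact ⟨0, fun h => absurd h hn⟩
    choose c hc using h2
    have hRG : glOp (R i) * G ≠ 0 := by
      intro h0
      apply hG0
      rw [← one_mul G, ← glOp_inv_mul (R i), mul_assoc, h0, mul_zero]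
    have hGR : G * glOp (R i) ≠ 0 := by
      intro h0
      apply hG0
      rw [← mul_one G, ← glOp_mul_inv (R i), ← mul_assoc, h0, zero_mul]
    obtain ⟨t, -, ht⟩ := exists_eq_smul_of_tendsto ((hlift hY i).mul hG) hRG
      (((hG.mul (hlift hX i))).congr' (hrel.mono fun n hn => hc n (hn i)))
    refine ⟨t, ?_, ht⟩
    rintro rfl
    exact hGR (by rw [ht, zero_smul])
  choose ε hε hrel' using hrel'
  obtain ⟨t, rfl⟩ := hc G ε hε hrel'
  have ht : t ≠ 0 := by
    rintro rfl
    exact hG0 (zero_smul _ _)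
  have hT : Tendsto (fun n => t⁻¹ • glOp (A n)) l (𝓝 (1 : Op)) := by
    have := hG.const_smul t⁻¹
    rwa [smul_smul, inv_mul_cancel₀ ht, one_smul] at this
  refine ⟨fun n => plog (t⁻¹ • glOp (A n)), ?_, ?_⟩
  · have := contDiffAt_plog.continuousAt.tendsto
    rw [plog_one] at this
    exact this.comp hT
  · filter_upwards [h, hT.eventually eventually_toPGL_eq_expPGL_plog] with n hn hn' i
    have e : (t⁻¹ • glOp (A n)) * (t • glOp (A n)⁻¹) = 1 := by
      rw [smul_mul_smul_comm, inv_mul_cancel₀ ht, one_smul, glOp_mul_inv]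
    obtain ⟨A', hA'⟩ := exists_glOp_eq e
    rw [← hn' A' hA', toPGL_eq_of_smul hA']
    exact hA2 n hn (b i)

/-- The map sending `(Z, v)` to the conjugate of `ι v` by `exp Z` has derivative `D` at `0`, so it
is a local diffeomorphism. The second component of its inverse projects to the slice along orbits.
-/
theorem exists_localSlice {V : Type} [NormedAddCommGroup V] [NormedSpace ℝ V]
    [FiniteDimensional ℝ V] {R : Fin 2 → GL (Fin 4) ℝ} (hR : ∀ i, toPGL (R i) = σ (b i))
    (hc : ∀ (G : Op) (ε : Fin 2 → ℝ), (∀ i, ε i ≠ 0) →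
      (∀ i, G * glOp (R i) = ε i • (glOp (R i) * G)) → ∃ t : ℝ, G = t • (1 : Op))
    (ι : V →L[ℝ] (Fin 2 → sl4)) (D : (sl4 × V) ≃L[ℝ] (Fin 2 → sl4))
    (hD : ∀ p, D p = orbitMap b σ p.1 + ι p.2) : ∃ s : LocalSlice b σ V, s.incl = ι := by
  let L : sl4 × V →L[ℝ] sl4 × (Fin 2 → sl4) := (ContinuousLinearMap.id ℝ sl4).prodMap ι
  let Φ : sl4 × V → (Fin 2 → sl4) := fun p => conjMap b σ (L p)
  have hL0 : Tendsto L (𝓝 0) (𝓝 0) := by simpa using L.continuous.tendsto 0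
  have hΦ : ContDiffAt ℝ ω Φ 0 := by
    refine ContDiffAt.comp (g := conjMap b σ) (f := L) (0 : sl4 × V) ?_ L.contDiff.contDiffAt
    rw [map_zero]
    exact contDiffAt_conjMap b σ
  have hΦ' : HasFDerivAt Φ (D : sl4 × V →L[ℝ] (Fin 2 → sl4)) 0 := by
    have h1 : HasFDerivAt (conjMap b σ)
        (orbitMap b σ ∘L ContinuousLinearMap.fst ℝ sl4 (Fin 2 → sl4) +
          ContinuousLinearMap.snd ℝ sl4 (Fin 2 → sl4)) (L 0) := by
      rw [map_zero]
      exact hasFDerivAt_conjMap b σ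
    exact (h1.comp (0 : sl4 × V) L.hasFDerivAt).congr_fderiv
      (ContinuousLinearMap.ext fun p => (hD p).symm)
  let H := hΦ.toOpenPartialHomeomorph Φ hΦ' (by simp)
  have hH0 : (0 : sl4 × V) ∈ H.source := hΦ.mem_toOpenPartialHomeomorph_source hΦ' (by simp)
  have hHΦ : ∀ p, H p = Φ p := fun p => rfl
  have hΦ0 : Φ 0 = 0 := funext fun i => by
    change conjMap b σ (L 0) i = 0
    rw [map_zero, conjMap_apply, map_zero, bch_zero]
    exact bch_zero
  have hH0' : (0 : Fin 2 → sl4) ∈ H.target := by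
    rw [← hΦ0]
    exact H.map_source hH0
  have hHs : H.symm 0 = 0 := by
    rw [← hΦ0]
    exact H.left_inv hH0
  have hleft : ∀ᶠ p in 𝓝 (0 : sl4 × V), H.symm (Φ p) = p := H.eventually_left_inverse hH0
  have hright : ∀ᶠ X in 𝓝 (0 : Fin 2 → sl4), Φ (H.symm X) = X := H.eventually_right_inverse hH0'
  have hι : Tendsto ι (𝓝 0) (𝓝 0) := by simpa using ι.continuous.tendsto 0
  have hsymm : Tendsto H.symm (𝓝 0) (𝓝 0) := by
    have := H.tendsto_symm hH0
    rwa [hHΦ, hΦ0] at this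
  refine ⟨⟨ι, fun X => (H.symm X).2, ?_, ?_, ?_, ?_, ?_, ?_⟩, rfl⟩
  · refine ContDiffAt.comp (0 : Fin 2 → sl4) contDiffAt_snd
      (H.contDiffAt_symm hH0' (f₀' := D) ?_ ?_)
    · rw [hHs]
      exact hΦ'
    · rw [hHs]
      exact hΦ
  · rw [hHs]
    rfl
  · have h1 : Tendsto (fun v : V => ((0 : sl4), v)) (𝓝 0) (𝓝 0) :=
      (continuous_const.prodMk continuous_id).tendsto (0 : V)
    filter_upwards [h1.eventually hleft, hι.eventually (eventually_conjMap_zero_left b σ)]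
      with v hv hv'
    have e : Φ (0, v) = ι v := hv'
    rw [← e, hv]
  · filter_upwards [hright,
      hsymm.eventually (hL0.eventually (eventually_charClass_conjMap b σ))] with X hX hX'
    change charClass (expCoord b σ (Φ (H.symm X))) = charClass (expCoord b σ (ι (H.symm X).2)) at hX'
    rw [← hX', hX]
  -- Failure near `0` gives an ultrafilter along which distinct slice points are conjugate. The
  -- conjugators can be taken as `exp (Z p)` with `Z p` tending to `0`, so `(Z p, p.1)` and `(0,
  -- p.2)` have the same image under `Φ`, against local injectivity.
  · by_contra hcon
    have hcon := Filter.frequently_iff_neBot.1 (not_eventually.1 hcon)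
    let l : Ultrafilter (V × V) := @Ultrafilter.of _ _ hcon
    have hl : (l : Filter (V × V)) ≤ _ := @Ultrafilter.of_le _ _ hcon
    have hl1 : (l : Filter (V × V)) ≤ 𝓝 0 := hl.trans inf_le_left
    have hl2 : ∀ᶠ p in (l : Filter (V × V)),
        ¬(charClass (expCoord b σ (ι p.1)) = charClass (expCoord b σ (ι p.2)) → p.1 = p.2) :=
      (hl.trans inf_le_right) (mem_principal_self _)
    have t1 : Tendsto (fun p : V × V => p.1) l (𝓝 0) :=
      (continuous_fst.tendsto (0 : V × V)).mono_left hl1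
    have t2 : Tendsto (fun p : V × V => p.2) l (𝓝 0) :=
      (continuous_snd.tendsto (0 : V × V)).mono_left hl1
    obtain ⟨Z, hZ, hZ'⟩ := exists_tendsto_conj b σ hR hc (hι.comp t1) (hι.comp t2)
      (hl2.mono fun p hp => (Classical.not_imp.1 hp).1)
    have t3 : Tendsto (fun p : V × V => (Z p, p.1)) l (𝓝 (0 : sl4 × V)) := hZ.prodMk_nhds t1
    have t4 : Tendsto (fun p : V × V => ((0 : sl4), p.2)) l (𝓝 (0 : sl4 × V)) :=
      tendsto_const_nhds.prodMk_nhds t2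
    have t5 : ∀ i, Tendsto (fun p : V × V => (Φ (Z p, p.1) i, ι p.2 i)) l
        (𝓝 (0 : sl4 × sl4)) := fun i =>
      ((((continuous_apply i).tendsto (0 : Fin 2 → sl4)).comp
        ((tendsto_conjMap b σ).comp (hL0.comp t3)))).prodMk_nhds
        ((((continuous_apply i).tendsto (0 : Fin 2 → sl4)).comp (hι.comp t2)))
    have hfin : ∀ᶠ p in (l : Filter (V × V)), False := by
      filter_upwards [hl2, hZ', t3.eventually hleft, t4.eventually hleft,
        (hι.comp t2).eventually (eventually_conjMap_zero_left b σ),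
        t3.eventually (hL0.eventually (eventually_expPGL_conjMap b σ)),
        eventually_all.2 fun i => (t5 i).eventually eventually_expPGL_injective]
        with p hp1 hp2 hp3 hp4 hp5 hp6 hp7
      apply (Classical.not_imp.1 hp1).2
      have e1 : Φ (0, p.2) = ι p.2 := hp5
      have e2 : Φ (Z p, p.1) = ι p.2 := by
        funext i
        refine hp7 i ?_
        change expPGL (conjMap b σ (L (Z p, p.1)) i) = expPGL (ι p.2 i)
        have h1 := hp2 i
        simp only [Function.comp_apply] at h1
        rw [expCoord_basis, expCoord_basis, ← eq_mul_inv_iff_mul_eq] at h1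
        rw [hp6 i, h1]
        change expPGL (Z p) * expPGL (ι p.1 i) * (σ (b i) * (expPGL (Z p))⁻¹ * (σ (b i))⁻¹) = _
        group
      rw [e2, ← e1, hp4] at hp3
      exact (congrArg Prod.snd hp3).symm
    exact hfin.exists.elim fun _ h => h
  · intro X
    refine ⟨(D.symm X).1, (D.symm X).2, ?_⟩
    rw [← hD, D.apply_symm_apply]

end Slice

/-! ### The chart of the character variety defined by a slice. -/

namespace LocalSlice

variable {F : Type} [Group F] {b : FreeGroupBasis (Fin 2) F} {σ : RepVariety F}
  {V : Type} [NormedAddCommGroup V] [NormedSpace ℝ V] (s : LocalSlice b σ V)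

/-- The slice, as a subset of the character variety. -/
def toChar (v : V) : CharVariety F := charClass (expCoord b σ (s.incl v))

/-- Multiplication of exponential coordinates on the right by a point of the slice. -/
def translate (p : V × (Fin 2 → sl4)) : Fin 2 → sl4 := fun i => bch (p.2 i, s.incl p.1 i)

/-- The arguments of `bch` in `translate`. -/
def translateArg (i : Fin 2) : V × (Fin 2 → sl4) →L[ℝ] sl4 × sl4 :=
  (ContinuousLinearMap.proj i ∘L ContinuousLinearMap.snd ℝ V (Fin 2 → sl4)).prod
    (ContinuousLinearMap.proj i ∘L s.incl ∘L ContinuousLinearMap.fst ℝ V (Fin 2 → sl4))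

lemma translate_apply (p : V × (Fin 2 → sl4)) (i : Fin 2) :
    s.translate p i = bch (s.translateArg i p) := rfl

lemma translate_zero : s.translate 0 = 0 := funext fun i => by
  rw [translate_apply, map_zero]
  exact bch_zero

lemma contDiffAt_translate : ContDiffAt ℝ ω s.translate 0 := by
  refine contDiffAt_pi.2 fun i => ?_
  refine ContDiffAt.comp (g := bch) (0 : V × (Fin 2 → sl4)) ?_
    (s.translateArg i).contDiff.contDiffAt
  change ContDiffAt ℝ ω bch (s.translateArg i 0)
  rw [map_zero]
  exact contDiffAt_bch

lemma contDiffAt_proj_translate : ContDiffAt ℝ ω (fun p => s.proj (s.translate p)) 0 := by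
  refine ContDiffAt.comp (g := s.proj) (0 : V × (Fin 2 → sl4)) ?_ s.contDiffAt_translate
  rw [translate_zero]
  exact s.contDiffAt_proj

lemma tendsto_incl : Tendsto s.incl (𝓝 0) (𝓝 0) := by
  simpa using s.incl.continuous.tendsto 0

lemma tendsto_translate : Tendsto s.translate (𝓝 0) (𝓝 0) := by
  have h := s.contDiffAt_translate.continuousAt.tendsto
  rwa [translate_zero] at h

lemma tendsto_translateArg (i : Fin 2) : Tendsto (s.translateArg i) (𝓝 0) (𝓝 0) := by
  simpa using (s.translateArg i).continuous.tendsto 0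

/-- A chart must be smooth and submersive in exponential coordinates at every point of its domain;
this rewrites those at a nearby slice point in terms of those at `σ`. -/
lemma eventually_charClass_translate : ∀ᶠ p in 𝓝 (0 : V × (Fin 2 → sl4)),
    charClass (expCoord b (expCoord b σ (s.incl p.1)) p.2) =
      s.toChar (s.proj (s.translate p)) := by
  have h : ∀ᶠ p in 𝓝 (0 : V × (Fin 2 → sl4)), ∀ i,
      expPGL (s.translate p i) = expPGL (p.2 i) * expPGL (s.incl p.1 i) :=
    eventually_all.2 fun i => (s.tendsto_translateArg i).eventually eventually_expPGL_bch
  filter_upwards [h, s.tendsto_translate.eventually s.charClass_incl_proj] with p hp hp'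
  rw [toChar, hp']
  congr 1
  refine b.ext_hom _ _ fun i => ?_
  rw [expCoord_basis, expCoord_basis, expCoord_basis, hp, mul_assoc]

lemma eventually_translate_zero : ∀ᶠ v in 𝓝 (0 : V), s.translate (v, 0) = s.incl v := by
  have h : ∀ᶠ v in 𝓝 (0 : V), ∀ i, bch (0, s.incl v i) = s.incl v i :=
    eventually_all.2 fun i => (((continuous_apply i).tendsto (0 : Fin 2 → sl4)).comp
      s.tendsto_incl).eventually eventually_bch_zero_left
  filter_upwards [h] with v hv
  exact funext hv

lemma eventually_translate_zero_left : ∀ᶠ X in 𝓝 (0 : Fin 2 → sl4), s.translate (0, X) = X := by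
  have h : ∀ᶠ X in 𝓝 (0 : Fin 2 → sl4), ∀ i, bch (X i, 0) = X i :=
    eventually_all.2 fun i => ((continuous_apply i).tendsto (0 : Fin 2 → sl4)).eventually
      eventually_bch_zero_right
  filter_upwards [h] with X hX
  funext i
  change bch (X i, s.incl 0 i) = X i
  rw [map_zero]
  exact hX i

lemma eventually_contDiffAt_proj_translate : ∀ᶠ v in 𝓝 (0 : V),
    ContDiffAt ℝ ω (fun X => s.proj (s.translate (v, X))) 0 := by
  have h1 : Tendsto (fun v : V => (v, (0 : Fin 2 → sl4))) (𝓝 0) (𝓝 0) :=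
    (continuous_id.prodMk continuous_const).tendsto (0 : V)
  filter_upwards [h1.eventually (s.contDiffAt_proj_translate.eventually (by simp))] with v hv
  exact ContDiffAt.comp (g := fun p => s.proj (s.translate p)) (0 : Fin 2 → sl4) hv
    (contDiffAt_const.prodMk contDiffAt_id)

/-- At `v = 0` the differential restricted to the slice is the identity. It varies continuously with
`v`, and invertibility is an open condition. -/
lemma eventually_surjective_fderiv [CompleteSpace V] : ∀ᶠ v in 𝓝 (0 : V),
    Function.Surjective (fderiv ℝ (fun X => s.proj (s.translate (v, X))) 0) := by
  let L : V × V →L[ℝ] V × (Fin 2 → sl4) := (ContinuousLinearMap.id ℝ V).prodMap s.incl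
  have h0 : ContDiffAt ℝ ω (fun p : V × V => s.proj (s.translate (L p))) 0 := by
    refine ContDiffAt.comp (g := fun p => s.proj (s.translate p)) (0 : V × V) ?_
      L.contDiff.contDiffAt
    change ContDiffAt ℝ ω (fun p => s.proj (s.translate p)) (L 0)
    rw [map_zero]
    exact s.contDiffAt_proj_translate
  have h1 : ContDiffAt ℝ 0 (fun v => fderiv ℝ (fun w => s.proj (s.translate (L (v, w)))) 0)
      (0 : V) :=
    ContDiffAt.fderiv (n := ω) (f := fun v w => s.proj (s.translate (L (v, w))))
      (g := fun _ => (0 : V)) h0 contDiffAt_const (by simp)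
  have e : fderiv ℝ (fun w => s.proj (s.translate (L (0, w)))) 0 = 1 := by
    have h2 : (fun w => s.proj (s.translate (L (0, w)))) =ᶠ[𝓝 0] id := by
      filter_upwards [s.tendsto_incl.eventually s.eventually_translate_zero_left, s.proj_incl]
        with w hw hw'
      change s.proj (s.translate (0, s.incl w)) = w
      rw [hw, hw']
    rw [h2.fderiv_eq]
    exact fderiv_id
  have h2 := h1.continuousAt.tendsto
  rw [e] at h2
  filter_upwards [h2.eventually_mem (Units.nhds 1), s.eventually_contDiffAt_proj_translate]
    with v hv hv'
  obtain ⟨u, hu⟩ := hv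
  have h3 : HasFDerivAt (fun X => s.proj (s.translate (v, X)))
      (fderiv ℝ (fun X => s.proj (s.translate (v, X))) 0) (s.incl 0) := by
    rw [map_zero]
    exact (hv'.differentiableAt (by simp)).hasFDerivAt
  have h4 := (h3.comp (0 : V) s.incl.hasFDerivAt).fderiv
  intro y
  refine ⟨s.incl ((↑u⁻¹ : V →L[ℝ] V) y), ?_⟩
  have h5 := DFunLike.congr_fun u.mul_inv y
  rw [hu] at h5
  have h6 := DFunLike.congr_fun h4 ((↑u⁻¹ : V →L[ℝ] V) y)
  exact h6.symm.trans h5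

lemma eventually_nhds_toChar_le : ∀ᶠ v in 𝓝 (0 : V), 𝓝 (s.toChar v) ≤ map s.toChar (𝓝 v) := by
  have h1 : ∀ᶠ X in 𝓝 (0 : Fin 2 → sl4), ContDiffAt ℝ ω s.proj X :=
    s.contDiffAt_proj.eventually (by simp)
  filter_upwards [s.tendsto_incl.eventually (eventually_nhds_charClass_le b σ),
    s.tendsto_incl.eventually (eventually_eventually_nhds.2 s.charClass_incl_proj),
    s.tendsto_incl.eventually h1, s.proj_incl] with v hv1 hv2 hv3 hv4
  have e : (fun Y => charClass (expCoord b σ Y)) =ᶠ[𝓝 (s.incl v)] s.toChar ∘ s.proj :=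
    hv2.mono fun Y hY => hY.symm
  have h := hv3.continuousAt.tendsto
  rw [hv4] at h
  calc 𝓝 (s.toChar v) ≤ map (fun Y => charClass (expCoord b σ Y)) (𝓝 (s.incl v)) := hv1
    _ = map s.toChar (map s.proj (𝓝 (s.incl v))) := by rw [Filter.map_congr e, map_map]
    _ ≤ map s.toChar (𝓝 v) := map_mono h

lemma continuous_toChar : Continuous s.toChar :=
  continuous_charClass.comp ((continuous_expCoord b σ).comp s.incl.continuous)

include s in
/-- The inverse of the parametrization by the slice is a smooth chart. -/
theorem exists_chart [CompleteSpace V] :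
    ∃ ψ : OpenPartialHomeomorph (CharVariety F) V, charClass σ ∈ ψ.source ∧
      ∀ τ : RepVariety F, charClass τ ∈ ψ.source → ContDiffAt ℝ ∞ (inCoord b ψ τ) 0 ∧
        Function.Surjective (fderiv ℝ (inCoord b ψ τ) 0) := by
  have hcurry : ∀ᶠ v in 𝓝 (0 : V), ∀ᶠ X in 𝓝 (0 : Fin 2 → sl4),
      charClass (expCoord b (expCoord b σ (s.incl v)) X) =
        s.toChar (s.proj (s.translate (v, X))) :=
    s.eventually_charClass_translate.curry_nhds
  have hinj := s.charClass_injective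
  rw [Prod.zero_eq_mk, nhds_prod_eq, eventually_prod_self_iff'] at hinj
  obtain ⟨W, hW, hinj⟩ := hinj
  obtain ⟨U, hU, hUo, hU0⟩ := eventually_nhds_iff.1 (s.eventually_contDiffAt_proj_translate.and (hcurry.and
    (s.eventually_surjective_fderiv.and (s.eventually_nhds_toChar_le.and
      (s.eventually_translate_zero.and (s.proj_incl.and hW))))))
  have hinjU : Set.InjOn s.toChar U := fun v hv v' hv' h =>
    hinj _ (hU v hv).2.2.2.2.2.2 _ (hU v' hv').2.2.2.2.2.2 h
  let e := hinjU.toPartialEquiv s.toChar U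
  have hopen : IsOpenMap (U.domRestrict s.toChar) := by
    refine IsOpenMap.of_nhds_le fun v => ?_
    refine ((hU v v.2).2.2.2.1).trans ?_
    rw [← map_nhds_subtype_coe_eq_nhds v.2 (hUo.mem_nhds v.2), map_map]
    rfl
  let ψ := (OpenPartialHomeomorph.ofContinuousOpenRestrict e s.continuous_toChar.continuousOn
    hopen hUo).symm
  have hψ : ∀ v ∈ U, ψ (s.toChar v) = v := fun v hv => e.left_inv hv
  refine ⟨ψ, ⟨0, hU0, ?_⟩, ?_⟩
  · change charClass (expCoord b σ (s.incl 0)) = _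
    rw [map_zero, expCoord_zero]
  rintro τ ⟨v, hv, hvτ⟩
  obtain ⟨h1, h2, h3, -, h5, h6, -⟩ := hU v hv
  obtain ⟨g, hg⟩ := charClass_eq_iff.1 hvτ
  -- The representation `τ` is only conjugate, by `g`, to a slice point. Changing the base point
  -- accordingly acts on exponential coordinates by the linear isomorphism `Ad g⁻¹`.
  let L : (Fin 2 → sl4) →L[ℝ] (Fin 2 → sl4) :=
    ContinuousLinearMap.pi fun i => adL g⁻¹ ∘L ContinuousLinearMap.proj i
  have hL0 : Tendsto L (𝓝 0) (𝓝 0) := by simpa using L.continuous.tendsto 0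
  have hLs : Function.Surjective L := fun X => ⟨fun i => adL g (X i), funext fun i => by
    change adL g⁻¹ (adL g (X i)) = X i
    rw [← adL_mul, inv_mul_cancel, adL_one]⟩
  have hKU : ∀ᶠ X in 𝓝 (0 : Fin 2 → sl4), s.proj (s.translate (v, X)) ∈ U := by
    refine h1.continuousAt.eventually_mem (hUo.mem_nhds ?_)
    rwa [h5, h6]
  have heq : inCoord b ψ τ =ᶠ[𝓝 0] (fun X => s.proj (s.translate (v, X))) ∘ L := by
    filter_upwards [hL0.eventually h2, hL0.eventually hKU] with X hX hX'
    rw [Function.comp_apply, ← hψ _ hX', ← hX, inCoord]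
    congr 1
    refine (charClass_eq_of_basis b (g := g) fun i => ?_).symm
    have e3 : expPGL (L X i) = g⁻¹ * expPGL (X i) * g := by
      change expPGL (adL g⁻¹ (X i)) = _
      rw [expPGL_adL, inv_inv]
    rw [expCoord_basis, expCoord_basis, hg, e3]
    group
  have hd : ContDiffAt ℝ ω (fun X => s.proj (s.translate (v, X))) (L 0) := by rwa [map_zero]
  constructor
  · exact ((hd.comp (0 : Fin 2 → sl4) L.contDiff.contDiffAt).congr_of_eventuallyEq heq).of_le
      (by simp)
  · have h4 := ((hd.differentiableAt (by simp)).hasFDerivAt.comp (0 : Fin 2 → sl4)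
      L.hasFDerivAt).congr_of_eventuallyEq heq
    rw [map_zero] at h4
    intro y
    obtain ⟨X, hX⟩ := (h3.comp hLs) y
    exact ⟨X, (DFunLike.congr_fun h4.fderiv X).trans hX⟩

end LocalSlice

/-- A linear section `r'` of the derivative makes `h ∘ r'` locally invertible, and `r'` composed
with its inverse is the required map. -/
lemma exists_local_right_inverse {E W : Type} [NormedAddCommGroup E] [NormedSpace ℝ E]
    [NormedAddCommGroup W] [NormedSpace ℝ W] [FiniteDimensional ℝ W] {h : E → W}
    (hs : ContDiffAt ℝ ∞ h 0) (hsurj : Function.Surjective (fderiv ℝ h 0)) :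
    ∃ (r : W → E) (r' : W →L[ℝ] E), HasFDerivAt r r' (h 0) ∧ r (h 0) = 0 ∧
      (∀ᶠ y in 𝓝 (h 0), h (r y) = y) ∧ ∀ y, fderiv ℝ h 0 (r' y) = y := by
  have : CompleteSpace W := FiniteDimensional.complete ℝ W
  obtain ⟨T, hT⟩ := (fderiv ℝ h 0).toLinearMap.exists_rightInverse_of_surjective
    (LinearMap.range_eq_top.2 hsurj)
  let r' : W →L[ℝ] E := LinearMap.toContinuousLinearMap T
  have hr' : ∀ y, fderiv ℝ h 0 (r' y) = y := fun y => LinearMap.congr_fun hT y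
  have h1 : HasStrictFDerivAt h (fderiv ℝ h 0) (r' 0) := by
    rw [map_zero]
    exact hs.hasStrictFDerivAt (by simp)
  have h2 : HasStrictFDerivAt (fun y => h (r' y))
      ((ContinuousLinearEquiv.refl ℝ W : W ≃L[ℝ] W) : W →L[ℝ] W) 0 :=
    (h1.comp (0 : W) r'.hasStrictFDerivAt).congr_fderiv (ContinuousLinearMap.ext hr')
  have h3 := h2.to_localInverse
  have h4 := h2.eventually_right_inverse
  have h5 := h2.localInverse_apply_image
  rw [map_zero] at h3 h4 h5
  refine ⟨fun y => r' (h2.localInverse _ _ _ y), r', ?_, ?_, h4, hr'⟩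
  · exact r'.hasFDerivAt.comp (h 0) h3.hasFDerivAt
  · change r' (h2.localInverse _ _ _ (h 0)) = 0
    rw [h5, map_zero]

/-! ### Differentials in an arbitrary smooth chart. -/

section Charts

variable {F : Type} [Group F] {b : FreeGroupBasis (Fin 2) F} {σ : RepVariety F}
  {W : Type} [NormedAddCommGroup W] {ψ : OpenPartialHomeomorph (CharVariety F) W}

lemma inCoord_zero : inCoord b ψ σ 0 = ψ (charClass σ) := by
  rw [inCoord, expCoord_zero]

lemma eventually_mem_source (hψ : charClass σ ∈ ψ.source) :
    ∀ᶠ X in 𝓝 (0 : Fin 2 → sl4), charClass (expCoord b σ X) ∈ ψ.source := by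
  have h : Continuous fun X => charClass (expCoord b σ X) :=
    continuous_charClass.comp (continuous_expCoord b σ)
  refine h.continuousAt.eventually_mem (ψ.open_source.mem_nhds ?_)
  rwa [expCoord_zero]

lemma conjMap_zero : conjMap b σ 0 = 0 := funext fun i => by
  rw [conjMap_apply, map_zero, bch_zero]
  exact bch_zero

variable [NormedSpace ℝ W]

/-- The map `inCoord b ψ σ` is constant along `Z ↦ conjMap b σ (Z, 0)`, whose velocity is
`orbitMap`. -/
lemma fderiv_inCoord_orbitMap (hs : ContDiffAt ℝ ∞ (inCoord b ψ σ) 0) (Z : sl4) :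
    fderiv ℝ (inCoord b ψ σ) 0 (orbitMap b σ Z) = 0 := by
  have h1 : HasFDerivAt (inCoord b ψ σ) (fderiv ℝ (inCoord b ψ σ) 0)
      (conjMap b σ (ContinuousLinearMap.inl ℝ sl4 (Fin 2 → sl4) 0)) := by
    rw [map_zero, conjMap_zero]
    exact (hs.differentiableAt (by simp)).hasFDerivAt
  have h2 := hasFDerivAt_conjMap b σ
  rw [← map_zero (ContinuousLinearMap.inl ℝ sl4 (Fin 2 → sl4))] at h2
  have h3 := h1.comp (0 : sl4) (h2.comp (0 : sl4)
    (ContinuousLinearMap.inl ℝ sl4 (Fin 2 → sl4)).hasFDerivAt)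
  have hl : Tendsto (ContinuousLinearMap.inl ℝ sl4 (Fin 2 → sl4)) (𝓝 0) (𝓝 0) := by
    have h := (ContinuousLinearMap.inl ℝ sl4 (Fin 2 → sl4)).continuous.tendsto 0
    rwa [map_zero] at h
  have h4 : (inCoord b ψ σ ∘ conjMap b σ ∘ ContinuousLinearMap.inl ℝ sl4 (Fin 2 → sl4)) =ᶠ[𝓝 0]
      fun _ => ψ (charClass σ) := by
    filter_upwards [hl.eventually (eventually_charClass_conjMap b σ)] with Y hY
    rw [Function.comp_apply, Function.comp_apply, inCoord, hY]
    exact inCoord_zero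
  have h5 := h3.unique ((hasFDerivAt_const (𝕜 := ℝ) (ψ (charClass σ)) (0 : sl4)).congr_of_eventuallyEq h4)
  have h6 := DFunLike.congr_fun h5 Z
  change fderiv ℝ (inCoord b ψ σ) 0 (orbitMap b σ Z + 0) = 0 at h6
  rwa [add_zero] at h6

/-- With `r` a local right inverse of `inCoord`, the points `r (inCoord X)` and `X` have the same
class, so the slice projection agrees on them. It therefore factors through `inCoord` to first
order. A vector killed by the differential of `inCoord` then has no slice component, and what
remains is an orbit direction. -/
theorem mem_range_orbitMap [FiniteDimensional ℝ W] {V : Type} [NormedAddCommGroup V]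
    [NormedSpace ℝ V] (s : LocalSlice b σ V) (hψ : charClass σ ∈ ψ.source)
    (hs : ContDiffAt ℝ ∞ (inCoord b ψ σ) 0)
    (hsurj : Function.Surjective (fderiv ℝ (inCoord b ψ σ) 0)) {X : Fin 2 → sl4}
    (hX : fderiv ℝ (inCoord b ψ σ) 0 X = 0) : ∃ Z, X = orbitMap b σ Z := by
  obtain ⟨r, r', hr, hr0, hright, -⟩ := exists_local_right_inverse hs hsurj
  have hd : HasFDerivAt (inCoord b ψ σ) (fderiv ℝ (inCoord b ψ σ) 0) 0 :=
    (hs.differentiableAt (by simp)).hasFDerivAt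
  have hp : HasFDerivAt s.proj (fderiv ℝ s.proj 0) 0 :=
    (s.contDiffAt_proj.differentiableAt (by simp)).hasFDerivAt
  have hrh : Tendsto (fun X => r (inCoord b ψ σ X)) (𝓝 0) (𝓝 0) := by
    have := hr.continuousAt.tendsto
    rw [hr0] at this
    exact this.comp hd.continuousAt.tendsto
  have hp0 : Tendsto s.proj (𝓝 0) (𝓝 0) := by
    have := hp.continuousAt.tendsto
    rwa [s.proj_zero] at this
  have heq : (fun X => s.proj (r (inCoord b ψ σ X))) =ᶠ[𝓝 0] s.proj := by
    have h1 : Tendsto (fun X => (s.proj (r (inCoord b ψ σ X)), s.proj X)) (𝓝 0) (𝓝 (0 : V × V)) :=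
      (hp0.comp hrh).prodMk_nhds hp0
    filter_upwards [h1.eventually s.charClass_injective, hd.continuousAt.eventually hright,
      eventually_mem_source hψ, hrh.eventually (eventually_mem_source (b := b) hψ),
      s.charClass_incl_proj, hrh.eventually s.charClass_incl_proj] with X h1 h2 h3 h4 h5 h6
    refine h1 ?_
    rw [h5, h6]
    exact ψ.injOn h4 h3 h2
  have hD : ∀ Y, fderiv ℝ (inCoord b ψ σ) 0 Y = 0 → fderiv ℝ s.proj 0 Y = 0 := by
    intro Y hY
    have hp' : HasFDerivAt s.proj (fderiv ℝ s.proj 0) (r (inCoord b ψ σ 0)) := by rwa [hr0]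
    have h1 := (hp'.comp _ hr).comp (0 : Fin 2 → sl4) hd
    have h2 := DFunLike.congr_fun (h1.unique (hp.congr_of_eventuallyEq heq)) Y
    change fderiv ℝ s.proj 0 (r' (fderiv ℝ (inCoord b ψ σ) 0 Y)) = fderiv ℝ s.proj 0 Y at h2
    rw [← h2, hY, map_zero, map_zero]
  have hincl : ∀ v, fderiv ℝ s.proj 0 (s.incl v) = v := by
    intro v
    have hp' : HasFDerivAt s.proj (fderiv ℝ s.proj 0) (s.incl 0) := by rwa [map_zero]
    exact DFunLike.congr_fun ((hp'.comp (0 : V) s.incl.hasFDerivAt).unique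
      ((hasFDerivAt_id (𝕜 := ℝ) (0 : V)).congr_of_eventuallyEq s.proj_incl)) v
  obtain ⟨Z, v, rfl⟩ := s.exists_eq_add X
  rw [map_add, fderiv_inCoord_orbitMap hs, zero_add] at hX
  have hv := hD _ hX
  rw [hincl] at hv
  exact ⟨Z, by rw [hv, map_zero, add_zero]⟩

/-- Differentiability of the action on representations, in exponential coordinates. -/
theorem exists_conj_word {R : Fin 2 → GL (Fin 4) ℝ} (hR : ∀ i, toPGL (R i) = σ (b i))
    {D : F → ((Fin 2 → sl4) →L[ℝ] sl4)}
    (hD : ∀ w, HasFDerivAt (fun X => glOp (coordLift b R X w))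
      ((ContinuousLinearMap.mul ℝ Op).flip (glOp (coordLift b R 0 w)) ∘L slOp ∘L D w) 0)
    {g : PGL4} {w : Fin 2 → F} (hg : ∀ i, g * σ (w i) * g⁻¹ = σ (b i)) :
    ∃ Y : (Fin 2 → sl4) → (Fin 2 → sl4), Y 0 = 0 ∧
      HasFDerivAt Y (ContinuousLinearMap.pi fun i => adL g ∘L D (w i)) 0 ∧
      ∀ᶠ X in 𝓝 (0 : Fin 2 → sl4), ∀ i,
        expPGL (Y X i) * σ (b i) = g * expCoord b σ X (w i) * g⁻¹ := by
  obtain ⟨G, rfl⟩ := toPGL_surjective g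
  have hc : ∀ i, ∃ c : ℝ, c ≠ 0 ∧
      glOp (G * coordLift b R 0 (w i) * G⁻¹) = c • glOp (R i) := by
    intro i
    refine exists_glOp_smul_of_toPGL_eq ?_
    rw [map_mul, map_mul, toPGL_coordLift b hR, expCoord_zero, map_inv, hg, hR]
  choose c hc0 hc using hc
  -- The fixed-point relation lifts to `GL(4, ℝ)` only up to the scalar `c i`; dividing by it gives
  -- `B i 0 = 1`, where `plog` is differentiable.
  let B : Fin 2 → (Fin 2 → sl4) → Op := fun i X =>
    (c i)⁻¹ • glOp (G * coordLift b R X (w i) * G⁻¹ * (R i)⁻¹)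
  have hB0 : ∀ i, B i 0 = 1 := fun i => by
    change (c i)⁻¹ • glOp (G * coordLift b R 0 (w i) * G⁻¹ * (R i)⁻¹) = 1
    rw [map_mul, hc, smul_mul_assoc, smul_smul, inv_mul_cancel₀ (hc0 i), one_smul, glOp_mul_inv]
  have hBd : ∀ i, HasFDerivAt (B i) (slOp ∘L adL (toPGL G) ∘L D (w i)) 0 := by
    intro i
    let M : Op →L[ℝ] Op := (c i)⁻¹ • ((ContinuousLinearMap.mul ℝ Op).flip (glOp (R i)⁻¹) ∘L
      (ContinuousLinearMap.mul ℝ Op).flip (glOp G⁻¹) ∘L ContinuousLinearMap.mul ℝ Op (glOp G))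
    have hM : ∀ T, M T = (c i)⁻¹ • (glOp G * T * glOp G⁻¹ * glOp (R i)⁻¹) := fun T => rfl
    have e : (fun X => M (glOp (coordLift b R X (w i)))) = B i := funext fun X => by
      rw [hM, ← map_mul, ← map_mul, ← map_mul]
    have h1 := M.hasFDerivAt.comp (0 : Fin 2 → sl4) (hD (w i))
    change HasFDerivAt (fun X => M (glOp (coordLift b R X (w i)))) _ _ at h1
    rw [e] at h1
    refine h1.congr_fderiv (ContinuousLinearMap.ext fun X => ?_)
    change M (slOp (D (w i) X) * glOp (coordLift b R 0 (w i))) = slOp (adL (toPGL G) (D (w i) X))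
    have h2 : glOp G * (slOp (D (w i) X) * glOp (coordLift b R 0 (w i))) * glOp G⁻¹ *
        glOp (R i)⁻¹ = glOp G * slOp (D (w i) X) * glOp G⁻¹ *
          glOp (G * coordLift b R 0 (w i) * G⁻¹ * (R i)⁻¹) := by
      rw [map_mul, map_mul, map_mul]
      simp only [mul_assoc]
      rw [← mul_assoc (glOp G⁻¹) (glOp G), glOp_inv_mul, one_mul]
    rw [hM, h2, ← mul_smul_comm]
    change _ * B i 0 = _
    rw [hB0, mul_one, slOp_adL]
  refine ⟨fun X i => plog (B i X), ?_, ?_, ?_⟩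
  · funext i
    change plog (B i 0) = 0
    rw [hB0, plog_one]
  · refine hasFDerivAt_pi'.2 fun i => ?_
    have h1 : HasFDerivAt plog tracelessPart (B i 0) := by
      rw [hB0]
      exact hasFDerivAt_plog
    refine (h1.comp (0 : Fin 2 → sl4) (hBd i)).congr_fderiv (ContinuousLinearMap.ext fun X => ?_)
    exact tracelessPart_slOp _
  · refine eventually_all.2 fun i => ?_
    have h1 : Tendsto (B i) (𝓝 0) (𝓝 1) := hB0 i ▸ (hBd i).continuousAt.tendsto
    filter_upwards [h1.eventually eventually_toPGL_eq_expPGL_plog] with X hX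
    have e : B i X * (c i • glOp (G * coordLift b R X (w i) * G⁻¹ * (R i)⁻¹)⁻¹) = 1 := by
      change ((c i)⁻¹ • glOp (G * coordLift b R X (w i) * G⁻¹ * (R i)⁻¹)) * _ = 1
      rw [smul_mul_smul_comm, inv_mul_cancel₀ (hc0 i), one_smul, glOp_mul_inv]
    obtain ⟨A', hA'⟩ := exists_glOp_eq e
    rw [← hX A' hA', toPGL_eq_of_smul hA', map_mul, map_mul, map_mul, map_inv, map_inv,
      toPGL_coordLift b hR, hR, inv_mul_cancel_right]

end Charts

lemma exists_linearEquiv_of_ker_eq {A B C : Type*} [AddCommGroup A] [AddCommGroup B]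
    [AddCommGroup C] [Module ℝ A] [Module ℝ B] [Module ℝ C] (p : A →ₗ[ℝ] B) (t : A →ₗ[ℝ] C)
    (hp : Function.Surjective p) (ht : Function.Surjective t)
    (h : ∀ x, p x = 0 ↔ t x = 0) : ∃ e : B ≃ₗ[ℝ] C, ∀ x, e (p x) = t x := by
  have hk : p.ker = t.ker := Submodule.ext h
  refine ⟨(p.quotKerEquivOfSurjective hp).symm ≪≫ₗ Submodule.quotEquivOfEq _ _ hk ≪≫ₗ
    t.quotKerEquivOfSurjective ht, fun x => ?_⟩
  have e : (p.quotKerEquivOfSurjective hp).symm (p x) = p.ker.mkQ x := by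
    rw [LinearEquiv.symm_apply_eq]
    rfl
  rw [LinearEquiv.trans_apply, LinearEquiv.trans_apply, e]
  rfl

/-! ### Cocycles on the free group and the differential of the action. -/

section Tangent

open groupCohomology

variable {Γ : Type} [Group Γ] (ρ : Γ →* PGL4) (N : Subgroup Γ)

/-- The restriction of the coefficients to `N`. -/
abbrev resModule : Rep.{0} ℝ N := Rep.res N.subtype (adModule ρ)

variable {ρ N}

lemma cocycle_mul (f : cocycles₁ (resModule ρ N)) (v w : N) :
    f (v * w) = f v + adL (restrict ρ N v) (f w) :=
  ((mem_cocycles₁_iff (f : N → (resModule ρ N).V)).1 f.2 v w).trans (add_comm _ _)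

lemma cocycle_ext (b : FreeGroupBasis (Fin 2) N) {f f' : cocycles₁ (resModule ρ N)}
    (h : ∀ i, f (b i) = f' (b i)) : f = f' := by
  refine cocycles₁_ext fun w => ?_
  induction w using basis_induction b with
  | one => rw [cocycles₁_map_one, cocycles₁_map_one]
  | of i => exact h i
  | inv_of i =>
    have h1 : ∀ f : cocycles₁ (resModule ρ N),
        f (b i)⁻¹ = -adL (restrict ρ N (b i)⁻¹) (f (b i)) := by
      intro f
      have h2 := cocycle_mul f (b i)⁻¹ (b i)
      rw [inv_mul_cancel, cocycles₁_map_one] at h2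
      exact eq_neg_of_add_eq_zero_left h2.symm
    rw [h1, h1, h]
  | mul v w hv hw => rw [cocycle_mul, cocycle_mul, hv, hw]

/-- Values of a cocycle on a free basis are arbitrary: the derivatives of the word maps in the
direction `X` provide the extension. -/
lemma exists_cocycle (b : FreeGroupBasis (Fin 2) N) {D : N → ((Fin 2 → sl4) →L[ℝ] sl4)}
    (hDb : ∀ i X, D (b i) X = X i)
    (hDm : ∀ v w X, D (v * w) X = D v X + adL (restrict ρ N v) (D w X)) (X : Fin 2 → sl4) :
    ∃ f : cocycles₁ (resModule ρ N), (∀ w, f w = D w X) ∧ ∀ i, f (b i) = X i := by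
  have h : (fun w => D w X : N → (resModule ρ N).V) ∈ cocycles₁ (resModule ρ N) :=
    (mem_cocycles₁_iff _).2 fun v w => (hDm v w X).trans (add_comm _ _)
  exact ⟨⟨_, h⟩, fun w => rfl, fun i => hDb i X⟩

lemma mem_coboundaries_of_basis (b : FreeGroupBasis (Fin 2) N) {f : cocycles₁ (resModule ρ N)}
    {Z : sl4} (h : ∀ i, f (b i) = orbitMap b (restrict ρ N) Z i) :
    ⇑f ∈ coboundaries₁ (resModule ρ N) := by
  -- The sign reconciles `orbitMap`, which is `Z - Ad Z`, with the coboundary convention `Ad Z - Z`.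
  have h1 : (d₀₁ (resModule ρ N)).hom (-Z) ∈ coboundaries₁ (resModule ρ N) := ⟨-Z, rfl⟩
  have e : f = ⟨(d₀₁ (resModule ρ N)).hom (-Z), coboundaries₁_le_cocycles₁ _ h1⟩ := by
    refine cocycle_ext b fun i => ?_
    rw [h]
    change Z - adL (restrict ρ N (b i)) Z = adL (restrict ρ N (b i)) (-Z) - -Z
    rw [map_neg]
    abel
  rw [e]
  exact h1

lemma exists_orbitMap_of_mem_coboundaries (b : FreeGroupBasis (Fin 2) N)
    {f : cocycles₁ (resModule ρ N)} (h : ⇑f ∈ coboundaries₁ (resModule ρ N)) :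
    ∃ Z, (fun i => f (b i)) = orbitMap b (restrict ρ N) Z := by
  obtain ⟨Z, hZ⟩ := h
  refine ⟨-(show sl4 from Z), funext fun i => ?_⟩
  have h1 : f (b i) = adL (restrict ρ N (b i)) Z - (show sl4 from Z) :=
    (congrFun hZ (b i)).symm
  rw [h1, orbitMap_apply, map_neg]
  abel

variable [N.Normal]

/-- Evaluation on the basis followed by the differential of `inCoord` is onto, because every vector
extends to a cocycle, and its kernel is the space of coboundaries. It descends to `Θ`, and the chain
rule then computes the differential of the action. -/
theorem exists_tangentIdentification (b : FreeGroupBasis (Fin 2) N) {R : Fin 2 → GL (Fin 4) ℝ}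
    (hR : ∀ i, toPGL (R i) = restrict ρ N (b i)) {V : Type} [NormedAddCommGroup V]
    [NormedSpace ℝ V] (s : LocalSlice b (restrict ρ N) V) {n : ℕ}
    {ψ : OpenPartialHomeomorph (CharVariety N) (EuclideanSpace ℝ (Fin n))}
    (hψ : IsSmoothChart b ψ) (hmem : charClass (restrict ρ N) ∈ ψ.source)
    (hfix : ∀ (γ : Γ) (w : N),
      ρ γ * restrict ρ N (MulAut.conjNormal γ⁻¹ w) * (ρ γ)⁻¹ = restrict ρ N w) :
    ∃ Θ : H1Ad ρ N ≃ₗ[ℝ] EuclideanSpace ℝ (Fin n), IsTangentIdentification ρ b ψ Θ ∧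
      ∀ q : Γ ⧸ N, HasFDerivAt (fun y => ψ (charAct ρ N q (ψ.symm y)))
        (LinearMap.toContinuousLinearMap
          (Θ.toLinearMap ∘ₗ lhsAct (adModule ρ) N q ∘ₗ Θ.symm.toLinearMap))
        (ψ (charClass (restrict ρ N))) := by
  have hs := hψ.smooth _ hmem
  have hsurj := hψ.submersion _ hmem
  obtain ⟨D, hD, hDb, hDm⟩ := exists_hasFDerivAt_coordLift b hR
  let ev : cocycles₁ (resModule ρ N) →ₗ[ℝ] (Fin 2 → sl4) :=
    { toFun := fun f i => f (b i)
      map_add' := fun _ _ => rfl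
      map_smul' := fun _ _ => rfl }
  let T : cocycles₁ (resModule ρ N) →ₗ[ℝ] EuclideanSpace ℝ (Fin n) :=
    (fderiv ℝ (inCoord b ψ (restrict ρ N)) 0).toLinearMap ∘ₗ ev
  have hT : Function.Surjective T := by
    intro y
    obtain ⟨X, hX⟩ := hsurj y
    obtain ⟨f, -, hf⟩ := exists_cocycle b hDb hDm X
    refine ⟨f, ?_⟩
    have : ev f = X := funext hf
    change fderiv ℝ (inCoord b ψ (restrict ρ N)) 0 (ev f) = y
    rw [this]
    exact hX
  have hπ : Function.Surjective (H1π (resModule ρ N)).hom := fun x => by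
    induction x using H1_induction_on with | h f => exact ⟨f, rfl⟩
  have hker : ∀ f, (H1π (resModule ρ N)).hom f = 0 ↔ T f = 0 := by
    intro f
    refine (H1π_eq_zero_iff f).trans ⟨fun h => ?_, fun h => ?_⟩
    · obtain ⟨Z, hZ⟩ := exists_orbitMap_of_mem_coboundaries b h
      change fderiv ℝ (inCoord b ψ (restrict ρ N)) 0 (fun i => f (b i)) = 0
      rw [hZ]
      exact fderiv_inCoord_orbitMap hs Z
    · obtain ⟨Z, hZ⟩ := mem_range_orbitMap s hmem hs hsurj h
      exact mem_coboundaries_of_basis b (congrFun hZ)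
  obtain ⟨Θ, hΘ⟩ := exists_linearEquiv_of_ker_eq _ T hπ hT hker
  refine ⟨Θ, hΘ, fun q => ?_⟩
  obtain ⟨γ, rfl⟩ := QuotientGroup.mk_surjective q
  obtain ⟨r, r', hr, hr0, hright, hr'⟩ := exists_local_right_inverse hs hsurj
  obtain ⟨Y, hY0, hY, hYeq⟩ := exists_conj_word hR hD (g := ρ γ)
    (w := fun i => MulAut.conjNormal γ⁻¹ (b i)) fun i => hfix γ (b i)
  have hd : HasFDerivAt (inCoord b ψ (restrict ρ N))
      (fderiv ℝ (inCoord b ψ (restrict ρ N)) 0) (Y (r (inCoord b ψ (restrict ρ N) 0))) := by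
    rw [hr0, hY0]
    exact (hs.differentiableAt (by simp)).hasFDerivAt
  have hY' := hY
  rw [← hr0] at hY'
  have h1 := hd.comp (inCoord b ψ (restrict ρ N) 0) (hY'.comp _ hr)
  have hrt : Tendsto r (𝓝 (inCoord b ψ (restrict ρ N) 0)) (𝓝 0) := by
    have := hr.continuousAt.tendsto
    rwa [hr0] at this
  -- Here `r` lifts a point of the chart to a representation, `Y` is the action on representations
  -- in exponential coordinates, and `inCoord` returns to the chart.
  have heq : (fun y => ψ (charAct ρ N (γ : Γ ⧸ N) (ψ.symm y))) =ᶠ[𝓝 (inCoord b ψ (restrict ρ N) 0)]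
      inCoord b ψ (restrict ρ N) ∘ Y ∘ r := by
    filter_upwards [hright, hrt.eventually (eventually_mem_source (b := b) hmem),
      hrt.eventually hYeq] with y hy1 hy2 hy3
    have e1 : ψ.symm y = charClass (expCoord b (restrict ρ N) (r y)) := by
      rw [← ψ.left_inv hy2]
      exact congrArg ψ.symm hy1.symm
    rw [e1, charAct_mk]
    change _ = ψ (charClass (expCoord b (restrict ρ N) (Y (r y))))
    congr 2
    refine b.ext_hom _ _ fun i => ?_
    rw [expCoord_basis, hy3, repAct_apply]
  have h2 := h1.congr_of_eventuallyEq heq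
  rw [inCoord_zero] at h2
  refine h2.congr_fderiv (ContinuousLinearMap.ext fun y => ?_)
  obtain ⟨f, hf, hfb⟩ := exists_cocycle b hDb hDm (r' y)
  obtain ⟨f', hf', hff'⟩ := exists_cocycle_lhsMap (adModule ρ) N γ f
  have e1 : Θ ((H1π (resModule ρ N)).hom f) = y := by
    rw [hΘ]
    have : ev f = r' y := funext hfb
    change fderiv ℝ (inCoord b ψ (restrict ρ N)) 0 (ev f) = y
    rw [this]
    exact hr' y
  have e2 : Θ.symm y = (H1π (resModule ρ N)).hom f := by rw [LinearEquiv.symm_apply_eq, e1]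
  change fderiv ℝ (inCoord b ψ (restrict ρ N)) 0
    (fun i => adL (ρ γ) (D (MulAut.conjNormal γ⁻¹ (b i)) (r' y))) =
    Θ ((lhsMap (adModule ρ) N γ).hom (Θ.symm y))
  rw [e2]
  refine Eq.trans ?_ (congrArg Θ hff').symm
  refine Eq.trans ?_ (hΘ f').symm
  change _ = fderiv ℝ (inCoord b ψ (restrict ρ N)) 0 (fun i => f' (b i))
  congr 1
  funext i
  rw [← hf]
  exact (hf' (b i)).symm

end Tangent

/-! ### Existence of slices -/

section Existence

lemma exists_complement {A E : Type*} [NormedAddCommGroup A] [NormedSpace ℝ A]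
    [NormedAddCommGroup E] [NormedSpace ℝ E] [FiniteDimensional ℝ A] [FiniteDimensional ℝ E]
    (f : A →L[ℝ] E) (hf : Function.Injective f) :
    ∃ (m : ℕ) (ι : EuclideanSpace ℝ (Fin m) →L[ℝ] E)
      (D : (A × EuclideanSpace ℝ (Fin m)) ≃L[ℝ] E), ∀ p, D p = f p.1 + ι p.2 := by
  obtain ⟨S, hS⟩ := f.toLinearMap.range.exists_isCompl
  let e : EuclideanSpace ℝ (Fin (Module.finrank ℝ S)) ≃ₗ[ℝ] S :=
    LinearEquiv.ofFinrankEq _ _ (by simp)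
  exact ⟨_, LinearMap.toContinuousLinearMap (S.subtype ∘ₗ e.toLinearMap),
    ((LinearEquiv.ofInjective f.toLinearMap hf).prodCongr e ≪≫ₗ
      Submodule.prodEquivOfIsCompl _ _ hS).toContinuousLinearEquiv, fun p => rfl⟩

variable {F : Type} [Group F] (b : FreeGroupBasis (Fin 2) F) (σ : RepVariety F)

/-- An element of the kernel of `orbitMap` commutes with the `R i`, so it is scalar by `hc` with `ε
= 1`, and traceless, hence zero. Any complement of the orbit directions then serves as a slice. -/
theorem exists_localSlice_euclidean {R : Fin 2 → GL (Fin 4) ℝ} (hR : ∀ i, toPGL (R i) = σ (b i))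
    (hc : ∀ (G : Op) (ε : Fin 2 → ℝ), (∀ i, ε i ≠ 0) →
      (∀ i, G * glOp (R i) = ε i • (glOp (R i) * G)) → ∃ t : ℝ, G = t • (1 : Op)) :
    ∃ m : ℕ, Nonempty (LocalSlice b σ (EuclideanSpace ℝ (Fin m))) := by
  have hinj : Function.Injective (orbitMap b σ) := by
    refine (injective_iff_map_eq_zero _).2 fun Z hZ => ?_
    obtain ⟨t, ht⟩ := hc (slOp Z) 1 (fun _ => one_ne_zero) fun i => by
      have h1 := congrFun hZ i
      rw [orbitMap_apply, ← hR] at h1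
      have h2 := congrArg slOp (sub_eq_zero.1 h1)
      rw [slOp_adL] at h2
      rw [Pi.one_apply, one_smul]
      nth_rw 1 [h2]
      rw [mul_assoc, glOp_inv_mul, mul_one]
    rw [← tracelessPart_slOp Z, ht, tracelessPart_smul_one]
  obtain ⟨m, ι, D, hD⟩ := exists_complement (orbitMap b σ) hinj
  obtain ⟨s, -⟩ := exists_localSlice b σ hR hc ι D hD
  exact ⟨m, ⟨s⟩⟩

end Existence

/-- Because `ρ` is defined on all of `Γ`, the representation `ρ|N` is fixed itself, and not only its
class. -/
lemma conj_restrict {Γ : Type} [Group Γ] (ρ : Γ →* PGL4) (N : Subgroup Γ) [N.Normal] (γ : Γ)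
    (w : N) : ρ γ * restrict ρ N (MulAut.conjNormal γ⁻¹ w) * (ρ γ)⁻¹ = restrict ρ N w := by
  change ρ γ * ρ (MulAut.conjNormal γ⁻¹ w : N) * (ρ γ)⁻¹ = ρ w
  rw [MulAut.conjNormal_apply, ← map_mul, ← map_inv, ← map_mul]
  group

lemma exists_eq_smul_one_of_commute_glOp {φ : MulAut F2}
    (hφ : IsConj (φ boundaryLoop) boundaryLoop) {ρ : BundleGroup φ →* PGL4}
    (hρ : IsHolonomy φ ρ) {R : Fin 2 → GL (Fin 4) ℝ}
    (hR : ∀ i, toPGL (R i) = ρ (SemidirectProduct.inl (FreeGroup.of i))) (G : Op) (ε : Fin 2 → ℝ)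
    (hε : ∀ i, ε i ≠ 0) (hG : ∀ i, G * glOp (R i) = ε i • (glOp (R i) * G)) :
    ∃ t : ℝ, G = t • (1 : Op) := by
  obtain ⟨g, rfl⟩ := op.surjective G
  obtain ⟨t, rfl⟩ := exists_eq_smul_one_of_commute hφ hρ hR (g := g) hε fun i =>
    op.injective (by
      rw [map_mul, map_smul, map_mul]
      exact hG i)
  exact ⟨t, by rw [map_smul, map_one]⟩

end TorusBundle

end

theorem mainTheorem5 (φ : MulAut TorusBundle.F2) (hφ : TorusBundle.IsHyperbolicMonodromy φ)
    (ρ : TorusBundle.BundleGroup φ →* TorusBundle.PGL4) (hρ : TorusBundle.IsHolonomy φ ρ) :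
    -- the class of the restricted holonomy is a smooth point of the character variety
    TorusBundle.IsSmoothPoint (TorusBundle.fiberBasis φ)
      (TorusBundle.charClass (TorusBundle.restrict ρ (TorusBundle.fiber φ))) ∧
    -- it is a fixed point of the action of `Γ/F₂`
    (∀ q : TorusBundle.BundleGroup φ ⧸ TorusBundle.fiber φ,
      TorusBundle.charAct ρ (TorusBundle.fiber φ) q
          (TorusBundle.charClass (TorusBundle.restrict ρ (TorusBundle.fiber φ))) =
        TorusBundle.charClass (TorusBundle.restrict ρ (TorusBundle.fiber φ))) ∧
    -- in every smooth chart there, the tangent space is identified with `H¹(F₂; 𝔰𝔩(4, ℝ)_{Ad ρ})`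
    -- and the differential of the action is the action of the spectral sequence
    ∀ (n : ℕ) (ψ : OpenPartialHomeomorph (TorusBundle.CharVariety (TorusBundle.fiber φ))
        (EuclideanSpace ℝ (Fin n))),
      TorusBundle.IsSmoothChart (TorusBundle.fiberBasis φ) ψ →
      TorusBundle.charClass (TorusBundle.restrict ρ (TorusBundle.fiber φ)) ∈ ψ.source →
      ∃ Θ : TorusBundle.H1Ad ρ (TorusBundle.fiber φ) ≃ₗ[ℝ] EuclideanSpace ℝ (Fin n),
        TorusBundle.IsTangentIdentification ρ (TorusBundle.fiberBasis φ) ψ Θ ∧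
        ∀ q : TorusBundle.BundleGroup φ ⧸ TorusBundle.fiber φ,
          HasFDerivAt
            (fun y => ψ (TorusBundle.charAct ρ (TorusBundle.fiber φ) q (ψ.symm y)))
            (LinearMap.toContinuousLinearMap
              (Θ.toLinearMap ∘ₗ
                TorusBundle.lhsAct (TorusBundle.adModule ρ) (TorusBundle.fiber φ) q ∘ₗ
                Θ.symm.toLinearMap))
            (ψ (TorusBundle.charClass (TorusBundle.restrict ρ (TorusBundle.fiber φ)))) := by
  obtain ⟨R, hR⟩ : ∃ R : Fin 2 → GL (Fin 4) ℝ, ∀ i, TorusBundle.toPGL (R i) =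
      TorusBundle.restrict ρ (TorusBundle.fiber φ) (TorusBundle.fiberBasis φ i) :=
    Classical.axiomOfChoice fun i => TorusBundle.toPGL_surjective _
  obtain ⟨m, ⟨s⟩⟩ := TorusBundle.exists_localSlice_euclidean (TorusBundle.fiberBasis φ) _ hR
    (TorusBundle.exists_eq_smul_one_of_commute_glOp hφ.boundary hρ fun i => by
      rw [hR, ← TorusBundle.coe_fiberBasis]
      rfl)
  have hfix : ∀ (γ : TorusBundle.BundleGroup φ) (w : TorusBundle.fiber φ),
      ρ γ * TorusBundle.restrict ρ (TorusBundle.fiber φ) (MulAut.conjNormal γ⁻¹ w) * (ρ γ)⁻¹ =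
        TorusBundle.restrict ρ (TorusBundle.fiber φ) w :=
    TorusBundle.conj_restrict ρ _
  refine ⟨?_, fun q => ?_, fun n ψ hψ hmem => ?_⟩
  · obtain ⟨ψ, h0, hψ⟩ := s.exists_chart
    exact ⟨m, ψ, ⟨fun τ hτ => (hψ τ hτ).1, fun τ hτ => (hψ τ hτ).2⟩, h0⟩
  · obtain ⟨γ, rfl⟩ := QuotientGroup.mk_surjective q
    rw [TorusBundle.charAct_mk]
    exact congrArg TorusBundle.charClass (MonoidHom.ext (hfix γ))
  · exact TorusBundle.exists_tangentIdentification _ hR s hψ hmem hfix
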